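/- For $(n,m)\in\mathbb{Z}^2$ there is exactly one real rational function $r^m_n(u)$ (the octahedral function) such that, on a neighborhood of $u=0$, $${}_2F_1\!\left(-\tfrac1{24}-\tfrac m2-\tfrac n2,\ \tfrac{11}{24}-\tfrac m2-\tfrac n2;\ \tfrac34-m;\ R(u)\right)=p_{\rm e}(u)^{-1/12-m-n}\,r^m_n(u),$$ where $p_{\rm e}(u)=(1+u)(1-34u+u^2)$ and $R(u)=-108\,u(1-u)^4/p_{\rm e}(u)^2$. Notation. For $\xi>0$ let $A_\pm=A_\pm(\xi)=\pm\cosh(\xi/3)+\sqrt{\sinh\xi/(3\sinh(\xi/3))}$, and for $\xi\in\mathbb{R}$ let $C_\pm=C_\pm(\xi)=\pm\sinh(\xi/3)+\sqrt{\cosh\xi/(3\cosh(\xi/3))}$; all four are positive. For $k\ge0$, $(d)_k=d(d+1)\cdots(d+k-1)$ and $(d)_{-k}=[(d-k)\cdots(d-1)]^{-1}$. For $z>1$, $\hat Q_\nu^\mu(z)=e^{-\mu\pi i}Q_\nu^\mu(z)$ is the normalized Legendre function of the second kind, $$\hat Q_\nu^\mu(z)=\frac{\sqrt\pi}{2^{\nu+1}}\,\frac{\Gamma(\nu+\mu+1)}{\Gamma(\nu+3/2)}\,\frac{(z^2-1)^{\mu/2}}{z^{\nu+\mu+1}}\;{}_2F_1\!\left(\tfrac\nu2+\tfrac\mu2+\tfrac12,\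 \tfrac\nu2+\tfrac\mu2+1;\ \nu+\tfrac32;\ \tfrac1{z^2}\right),$$ and $P_\nu^\mu(z)=\frac1{\Gamma(1-\mu)}\left(\frac{z+1}{z-1}\right)^{\mu/2}{}_2F_1\!\left(-\nu,\nu+1;1-\mu;\frac{1-z}2\right)$ is the Legendre function of the first kind, ${}_2F_1$ being continued analytically from $(-1,1)$ to $(-\infty,1)$. For $-1<x<1$, the Ferrers function of the first kind is ${\rm P}_\nu^\mu(x)=\frac1{\Gamma(1-\mu)}\left(\frac{1+x}{1-x}\right)^{\mu/2}{}_2F_1\!\left(-\nu,\nu+1;1-\mu;\frac{1-x}2\right)$. Write $e=\tfrac14+3m+3n$. Then for all $(n,m)\in\mathbb{Z}^2$ and all $\xi\in(0,\infty)$: $$\tfrac2\pi\hat Q_{-\frac34-m}^{-\frac13-n}(\coth\xi)=\frac{2^{11/4-2m-3n}\,3^{-3/8}\,(\frac14)_m}{(\frac{13}{12})_{m+n}\,\Gamma(\frac43)}\,(\sinh\xi)^{1/4-m}\left[-(-1)^n\sqrt{\sqrt3+1}\,A_+^{e}\,r^m_n(-A_- /A_+)\right],$$ $$\tfrac2\pi\hat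 Q_{-\frac14+m}^{-\frac13-n}(\coth\xi)=\frac{2^{11/4-2m-3n}\,3^{-3/8}\,(\frac14)_m}{(\frac{13}{12})_{m+n}\,\Gamma(\frac43)}\,(\sinh\xi)^{1/4-m}\left[(-1)^m\sqrt{\sqrt3-1}\,A_-^{e}\,r^m_n(-A_+/A_-)\right],$$ $$P_{-\frac34-m}^{-\frac13-n}(\coth\xi)=\frac{(-1)^n2^{5/4-2m-3n}\,3^{-3/8}\,(\frac14)_m}{(\frac{13}{12})_{m+n}\,\Gamma(\frac43)}\,(\sinh\xi)^{1/4-m}\left[(-1)^n\sqrt{\sqrt3-1}\,A_+^{e}\,r^m_n(-A_- /A_+)-(-1)^m\sqrt{\sqrt3+1}\,A_-^{e}\,r^m_n(-A_+/A_-)\right],$$ $$P_{-\frac34-m}^{\frac13+n}(\coth\xi)=\frac{(-1)^n2^{-1/4-2m-3n}\,3^{-3/8}\,(\frac14)_m}{(\frac5{12})_{m-n}\,\Gamma(\frac23)}\,(\sinh\xi)^{1/4-m}\left[(-1)^n\sqrt{\sqrt3+1}\,A_+^{e}\,r^m_n(-A_- /A_+)+(-1)^m\sqrt{\sqrt3-1}\,A_-^{e}\,r^m_n(-A_+/A_-)\right];$$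 and for all $(n,m)\in\mathbb{Z}^2$ and all $\xi\in\mathbb{R}$: $${\rm P}_{-\frac34-m}^{-\frac13-n}(\tanh\xi)=\frac{2^{5/4-2m-3n}\,3^{-3/8}\,(\frac14)_m}{(\frac{13}{12})_{m+n}\,\Gamma(\frac43)}\,(\cosh\xi)^{1/4-m}\left[-(-1)^n\sqrt{\sqrt3-1}\,C_+^{e}\,r^m_n(-C_- /C_+)+(-1)^m\sqrt{\sqrt3+1}\,C_-^{e}\,r^m_n(-C_+/C_-)\right],$$ $${\rm P}_{-\frac34-m}^{\frac13+n}(\tanh\xi)=\frac{(-1)^n2^{-1/4-2m-3n}\,3^{-3/8}\,(\frac14)_m}{(\frac5{12})_{m-n}\,\Gamma(\frac23)}\,(\cosh\xi)^{1/4-m}\left[(-1)^n\sqrt{\sqrt3+1}\,C_+^{e}\,r^m_n(-C_- /C_+)+(-1)^m\sqrt{\sqrt3-1}\,C_-^{e}\,r^m_n(-C_+/C_-)\right].$$ -/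

import Mathlib

open Filter Topology

noncomputable section

/-- The rising factorial `(d)_k` for every integer `k`: it is `d (d+1) ⋯ (d+k-1)` if `k ≥ 0` and
`[(d-k') ⋯ (d-1)]⁻¹` if `k = -k' < 0`. -/
def risingFactorial (d : ℝ) : ℤ → ℝ
  | Int.ofNat k => ∏ i ∈ Finset.range k, (d + (i : ℝ))
  | Int.negSucc k => (∏ i ∈ Finset.range (k + 1), (d - ((i : ℝ) + 1)))⁻¹

/-- `F` is the continuation to `(-∞, 1)` of the Gauss function: it is real-analytic there and it is
the sum of the Maclaurin series on `(-1, 1)`. By the identity theorem at most one such function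
exists, up to its values on `[1, ∞)`. -/
def IsGaussContinuation (a b c : ℝ) (F : ℝ → ℝ) : Prop :=
  AnalyticOnNhd ℝ F (Set.Iio 1) ∧ ∀ x ∈ Set.Ioo (-1 : ℝ) 1, F x = ₂F₁ a b c x

/-- The Gauss function `₂F₁(a, b; c; x)` for `x < 1` (where `c ≠ 0, -1, -2, …`), that is, the
analytic continuation to `(-∞, 1)` of the hypergeometric series. -/
def gaussF (a b c : ℝ) : ℝ → ℝ :=
  Classical.epsilon (IsGaussContinuation a b c)

/-- The Legendre function of the first kind `P_ν^μ(z)` for `z > 1` (where `μ ≠ 1, 2, 3, …`). -/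
def legendreP (ν μ z : ℝ) : ℝ :=
  (1 / Real.Gamma (1 - μ)) * ((z + 1) / (z - 1)) ^ (μ / 2) *
    gaussF (-ν) (ν + 1) (1 - μ) ((1 - z) / 2)

/-- The Ferrers function of the first kind `P_ν^μ(x)` for `-1 < x < 1`
(where `μ ≠ 1, 2, 3, …`). -/
def ferrersP (ν μ x : ℝ) : ℝ :=
  (1 / Real.Gamma (1 - μ)) * ((1 + x) / (1 - x)) ^ (μ / 2) *
    ₂F₁ (-ν) (ν + 1) (1 - μ) ((1 - x) / 2)

/-- The normalized Legendre function of the second kind `Q̂_ν^μ(z) = e^{-μπi} Q_ν^μ(z)` for `z > 1`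
(where `ν + 3/2` and `ν + μ + 1` are not in `{0, -1, -2, …}`). -/
def legendreQhat (ν μ z : ℝ) : ℝ :=
  (Real.sqrt Real.pi / (2 : ℝ) ^ (ν + 1)) * (Real.Gamma (ν + μ + 1) / Real.Gamma (ν + 3 / 2)) *
    ((z ^ 2 - 1) ^ (μ / 2) / z ^ (ν + μ + 1)) *
    ₂F₁ (ν / 2 + μ / 2 + 1 / 2) (ν / 2 + μ / 2 + 1) (ν + 3 / 2) (1 / z ^ 2)

/-- The edge-midpoint polynomial `p_e(u) = (1 + u)(1 - 34u + u²)`. -/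
def octahedralPe (u : ℝ) : ℝ := (1 + u) * (1 - 34 * u + u ^ 2)

/-- The degree-6 rational function `R(u) = -108 u (1 - u)⁴ / p_e(u)²`. -/
def octahedralR (u : ℝ) : ℝ := -108 * u * (1 - u) ^ 4 / octahedralPe u ^ 2

/-- The implicit definition of the octahedral function `r^m_n`: a rational function `r` such that
`₂F₁(-1/24 - m/2 - n/2, 11/24 - m/2 - n/2; 3/4 - m; R(u)) = p_e(u)^{-1/12 - m - n} r(u)`
on a neighborhood of `u = 0`. -/
def IsOctahedralFunction (n m : ℤ) (r : RatFunc ℝ) : Prop :=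
  ∀ᶠ u in 𝓝 (0 : ℝ),
    ₂F₁ (-(1 / 24) - (m : ℝ) / 2 - (n : ℝ) / 2) (11 / 24 - (m : ℝ) / 2 - (n : ℝ) / 2)
        (3 / 4 - (m : ℝ)) (octahedralR u) =
      octahedralPe u ^ (-(1 / 12) - (m : ℝ) - (n : ℝ)) * r.eval (RingHom.id ℝ) u

/-- The octahedral function `r^m_n`, the rational function satisfying the implicit definition. -/
def octahedralFunction (n m : ℤ) : RatFunc ℝ :=
  Classical.epsilon (IsOctahedralFunction n m)

/-- The value `r^m_n(u)`. -/
def octahedralEval (n m : ℤ) (u : ℝ) : ℝ := (octahedralFunction n m).eval (RingHom.id ℝ) u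

/-- The function `A_+` on `(0, ∞)`. -/
def Aplus (ξ : ℝ) : ℝ :=
  Real.cosh (ξ / 3) + Real.sqrt (Real.sinh ξ / (3 * Real.sinh (ξ / 3)))

/-- The function `A_-` on `(0, ∞)`. -/
def Aminus (ξ : ℝ) : ℝ :=
  -Real.cosh (ξ / 3) + Real.sqrt (Real.sinh ξ / (3 * Real.sinh (ξ / 3)))

/-- The function `C_+` on `(-∞, ∞)`. -/
def Cplus (ξ : ℝ) : ℝ :=
  Real.sinh (ξ / 3) + Real.sqrt (Real.cosh ξ / (3 * Real.cosh (ξ / 3)))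

/-- The function `C_-` on `(-∞, ∞)`. -/
def Cminus (ξ : ℝ) : ℝ :=
  -Real.sinh (ξ / 3) + Real.sqrt (Real.cosh ξ / (3 * Real.cosh (ξ / 3)))

/-- The hyperbolic cotangent. -/
def hypCoth (ξ : ℝ) : ℝ := Real.cosh ξ / Real.sinh ξ

end

/-!
In the coordinate `t = e^{-2ξ/3}` (and `t = -e^{-2ξ/3}` for the Ferrers functions) the Legendre
functions of the theorem become four families of functions of `t`, indexed by `(n, m)`: `familyQ`
and `familyQ'` are Gauss functions of `tanh² ξ` times a power of `1 + t³`, while `familyP` and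
`familyP'` are Gauss functions of `-t³/(1 - t³)` times powers of `t` and `1 - t³`. On the other side
stand the two branches `α_ε = (1 + t)/2 + ε √((1 + t + t²)/3)`, which are `A_±` or `C_±` up to sign
and a power of `|t|`, and the functions `octTerm ε ρ k t = |α_ε|^{1/4} α_ε^{3k} ρ(u_ε)`, where
`u_ε` is the octahedral parameter, `R(u_1) = tanh² ξ`. Each family turns out to be a combination of
the two branches of `octTerm` with `ρ = r^m_n` and `k = n + m`, with coefficients that do not depend
on `(n, m)`: `familyQ` and `familyQ'` are the branches themselves, and for `familyP` and `familyP'`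
the coefficients are `± √(√3 ± 1)`.

The proof is by climbing ladders. Contiguous relations of `₂F₁`, read off from the coefficients of
the series, show that with the right normalization every family is shifted by the same four
first-order operators `n → n ± 1`, `m → m ± 1` (`isLadder_familyQ` and its three companions). On
`octTerm` the same operators act on `ρ` alone and preserve rational functions with poles at the
zeros of `u (1 - u) (1 + 14 u + u²)` (`raiseOrder_octTerm` and so on). Their multipliers
never vanish, so everything reduces to `(n, m) = (0, 0)`
(`IsOctahedralData.exists_of_zero`). There `ρ = 1`, and both sides solve the same second-order
equation; they agree because their Wronskian with one solution vanishes at the singular point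
`t = 1` for the second Legendre functions, at `t = 0` for the first
(`SolvesBaseEquation.eq_zero`).

The formula for `familyQ` is the implicit definition of `r^m_n` along the curve `u = u_1(t)`, which
tends to `0` as `t → 1`. By the identity theorem for analytic functions it yields existence of the
octahedral function, and rational functions that agree near a point coincide
(`existsUnique_isOctahedralFunction`). The Gauss function at arguments `≤ -1` is identified by
noting that the right-hand side is itself an analytic continuation (`gaussF_eq_of_neg`). What
remains is to match constants; for `Q̂` this needs `Γ(5/12)` and `Γ(11/12)` in terms of
`Γ(1/4)`, `Γ(3/4)` and `Γ(1/3)`, which come from reflection, duplication and triplication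
(`Gamma_twelfths`).
-/

/-! ### Contiguous relations for the Gauss series -/

/-- The real number `x` is not an integer. All the hypergeometric parameters in this file have this
property, and it is stable under the integer shifts of the contiguous relations. -/
def NotInt (x : ℝ) : Prop := ∀ k : ℤ, x ≠ k

lemma NotInt.add_int {x : ℝ} (hx : NotInt x) (k : ℤ) : NotInt (x + k) := fun j h =>
  hx (j - k) (by push_cast; linarith)

lemma NotInt.add_one {x : ℝ} (hx : NotInt x) : NotInt (x + 1) := by
  simpa using hx.add_int 1

lemma NotInt.sub_one {x : ℝ} (hx : NotInt x) : NotInt (x - 1) := by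
  simpa [sub_eq_add_neg] using hx.add_int (-1)

lemma NotInt.add_nat_ne {x : ℝ} (hx : NotInt x) (k : ℕ) : x + k ≠ 0 := fun h =>
  hx (-(k : ℤ)) (by push_cast; linarith)

lemma NotInt.ne_zero {x : ℝ} (hx : NotInt x) : x ≠ 0 := by simpa using hx.add_nat_ne 0

lemma NotInt.sub_one_ne {x : ℝ} (hx : NotInt x) : x - 1 ≠ 0 := hx.sub_one.ne_zero

/-- A fraction `k / d` in lowest terms, `d ≠ 1`, is not an integer. -/
lemma notInt_of_mul_eq {x : ℝ} (d k : ℤ) (h : d * x = k) (hk : k % d ≠ 0) : NotInt x := by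
  rintro j rfl
  apply hk
  have : d * j = k := by exact_mod_cast h
  rw [← this, Int.mul_emod_right]

/-- The coefficients of the Gauss series `₂F₁(a, b; c; x)`. -/
noncomputable def gaussCoeff (a b c : ℝ) (k : ℕ) : ℝ := ordinaryHypergeometricCoefficient a b c k

lemma gaussCoeff_zero (a b c : ℝ) : gaussCoeff a b c 0 = 1 := by
  simp [gaussCoeff, ordinaryHypergeometricCoefficient]

lemma gaussCoeff_succ {c : ℝ} (a b : ℝ) (hc : NotInt c) (k : ℕ) :
    gaussCoeff a b c (k + 1) =
      gaussCoeff a b c k * ((a + k) * (b + k) / ((c + k) * (k + 1))) := by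
  have h1 : (k : ℝ) + 1 ≠ 0 := by positivity
  have h2 := hc.add_nat_ne k
  simp only [gaussCoeff, ordinaryHypergeometricCoefficient, ascPochhammer_succ_eval,
    Nat.factorial_succ, Nat.cast_mul, Nat.cast_add, Nat.cast_one, mul_inv]
  field_simp

lemma ascPochhammer_add_one_eval (a : ℝ) (k : ℕ) :
    a * (ascPochhammer ℝ k).eval (a + 1) = (a + k) * (ascPochhammer ℝ k).eval a := by
  have h := ascPochhammer_succ_eval k a
  rw [ascPochhammer_succ_left] at h
  simp at h
  linarith

lemma gaussCoeff_add_one_left {a : ℝ} (b c : ℝ) (ha : NotInt a) (k : ℕ) :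
    gaussCoeff (a + 1) b c k = gaussCoeff a b c k * ((a + k) / a) := by
  have h := ascPochhammer_add_one_eval a k
  have h0 := ha.ne_zero
  simp only [gaussCoeff, ordinaryHypergeometricCoefficient]
  field_simp
  linear_combination (Polynomial.eval b (ascPochhammer ℝ k)) / (Polynomial.eval c (ascPochhammer ℝ k)) * h

lemma gaussCoeff_symm (a b c : ℝ) (k : ℕ) : gaussCoeff a b c k = gaussCoeff b a c k := by
  simp only [gaussCoeff, ordinaryHypergeometricCoefficient]; ring

lemma gaussCoeff_sub_one_right {b : ℝ} (a c : ℝ) (hb : NotInt b) (k : ℕ) :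
    gaussCoeff a (b - 1) c k * (b - 1 + k) = gaussCoeff a b c k * (b - 1) := by
  have h := gaussCoeff_add_one_left a c hb.sub_one k
  have := hb.sub_one_ne
  rw [sub_add_cancel, gaussCoeff_symm, gaussCoeff_symm (b - 1)] at h
  rw [h]; field_simp

lemma gaussCoeff_add_one_bottom {c : ℝ} (a b : ℝ) (hc : NotInt c) (k : ℕ) :
    gaussCoeff a b (c + 1) k = gaussCoeff a b c k * (c / (c + k)) := by
  have h := ascPochhammer_add_one_eval c k
  have h0 := hc.ne_zero
  have h1 := hc.add_nat_ne k
  have h2 : (ascPochhammer ℝ k).eval c ≠ 0 := by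
    rw [Ne, ascPochhammer_eval_eq_zero_iff]
    rintro ⟨j, -, hj⟩
    exact hc.add_nat_ne j (by rw [hj]; ring)
  have h3 : (ascPochhammer ℝ k).eval (c + 1) ≠ 0 := by
    intro h4; rw [h4] at h; simp [h1, h2] at h
  simp only [gaussCoeff, ordinaryHypergeometricCoefficient]
  field_simp
  linear_combination (-(Polynomial.eval b (ascPochhammer ℝ k) * Polynomial.eval a (ascPochhammer ℝ k))) * h

lemma gaussCoeff_sub_one_bottom {c : ℝ} (a b : ℝ) (hc : NotInt c) (k : ℕ) :
    gaussCoeff a b (c - 1) k * (c - 1) = gaussCoeff a b c k * (c - 1 + k) := by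
  have h := gaussCoeff_add_one_bottom a b hc.sub_one k
  have h1 := hc.sub_one.add_nat_ne k
  rw [sub_add_cancel] at h
  rw [h]; field_simp

lemma hypergeometric_symm (a b c x : ℝ) : ₂F₁ a b c x = ₂F₁ b a c x := by
  rw [ordinaryHypergeometric, ordinaryHypergeometric, ordinaryHypergeometricSeries_symm]

section Series

variable {a b c x : ℝ}

lemma hasFPowerSeriesOnBall_hypergeometric (ha : NotInt a) (hb : NotInt b) (hc : NotInt c) :
    HasFPowerSeriesOnBall (₂F₁ a b c : ℝ → ℝ) (ordinaryHypergeometricSeries ℝ a b c) 0 1 := by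
  have hr : (ordinaryHypergeometricSeries ℝ a b c).radius = 1 :=
    ordinaryHypergeometricSeries_radius_eq_one ℝ a b c fun k =>
      ⟨fun h => ha.add_nat_ne k (by rw [h]; ring), fun h => hb.add_nat_ne k (by rw [h]; ring),
        fun h => hc.add_nat_ne k (by rw [h]; ring)⟩
  have := (ordinaryHypergeometricSeries ℝ a b c).hasFPowerSeriesOnBall (by rw [hr]; norm_num)
  rwa [hr] at this

lemma mem_eball_one (hx : |x| < 1) : x ∈ Metric.eball (0 : ℝ) 1 := by
  rw [← ENNReal.ofReal_one, Metric.eball_ofReal]; simpa using hx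

lemma analyticAt_hypergeometric (ha : NotInt a) (hb : NotInt b) (hc : NotInt c) (hx : |x| < 1) :
    AnalyticAt ℝ (₂F₁ a b c : ℝ → ℝ) x :=
  (hasFPowerSeriesOnBall_hypergeometric ha hb hc).analyticAt_of_mem (mem_eball_one hx)

lemma hasSum_hypergeometric (ha : NotInt a) (hb : NotInt b) (hc : NotInt c) (hx : |x| < 1) :
    HasSum (fun k : ℕ => gaussCoeff a b c k * x ^ k) (₂F₁ a b c x) := by
  have := (hasFPowerSeriesOnBall_hypergeometric ha hb hc).hasSum (mem_eball_one hx)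
  simpa [ordinaryHypergeometricSeries, gaussCoeff, FormalMultilinearSeries.coeff_ofScalars,
    mul_comm] using this

lemma coeff_hypergeometricSeries (k : ℕ) :
    (ordinaryHypergeometricSeries ℝ a b c).coeff k = gaussCoeff a b c k := by
  simp [ordinaryHypergeometricSeries, gaussCoeff, FormalMultilinearSeries.coeff_ofScalars]

lemma hasSum_mul_deriv_hypergeometric (ha : NotInt a) (hb : NotInt b) (hc : NotInt c)
    (hx : |x| < 1) :
    HasSum (fun k : ℕ => k * gaussCoeff a b c k * x ^ k) (x * deriv (₂F₁ a b c : ℝ → ℝ) x) := by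
  have h := ((hasFPowerSeriesOnBall_hypergeometric ha hb hc).fderiv).hasSum (mem_eball_one hx)
  have h2 := (h.mapL (ContinuousLinearMap.apply ℝ ℝ (1 : ℝ))).mul_left x
  simp only [zero_add, ContinuousLinearMap.apply_apply, fderiv_apply_one_eq_deriv] at h2
  rw [← hasSum_nat_add_iff' 1]
  simp only [Finset.range_one, Finset.sum_singleton, Nat.cast_zero, zero_mul, sub_zero]
  refine h2.congr_fun fun k => ?_
  rw [← coeff_hypergeometricSeries]
  rw [FormalMultilinearSeries.apply_eq_pow_smul_coeff]
  rw [smul_apply, FormalMultilinearSeries.derivSeries_coeff_one]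
  simp
  ring

lemma hasDerivAt_hypergeometric (ha : NotInt a) (hb : NotInt b) (hc : NotInt c) (hx : |x| < 1) :
    HasDerivAt (₂F₁ a b c : ℝ → ℝ) (deriv (₂F₁ a b c : ℝ → ℝ) x) x :=
  (analyticAt_hypergeometric ha hb hc hx).differentiableAt.hasDerivAt

end Series

/-- A first-order relation between two power series, read off from their coefficients. -/
lemma relation_of_coeff {f g : ℕ → ℝ} {x F D G : ℝ} (p₀ p₁ q₀ q₁ γ δ : ℝ)
    (hF : HasSum (fun k => f k * x ^ k) F) (hD : HasSum (fun k => k * f k * x ^ k) D)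
    (hG : HasSum (fun k => g k * x ^ k) G) (h0 : p₀ * f 0 = γ * g 0)
    (h : ∀ k : ℕ, (p₀ + p₁ * (k + 1)) * f (k + 1) + (q₀ + q₁ * k) * f k =
      γ * g (k + 1) + δ * g k) :
    p₀ * F + p₁ * D + x * (q₀ * F + q₁ * D) = γ * G + δ * (x * G) := by
  have shift {s : ℕ → ℝ} {S : ℝ} (hs : HasSum (fun k => s k * x ^ k) S) :
      HasSum (fun k => s (k + 1) * x ^ (k + 1)) (S - s 0) := by
    simpa using (hasSum_nat_add_iff' (f := fun k => s k * x ^ k) 1).2 hs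
  have e1 := (((shift hF).mul_left p₀).add ((shift hD).mul_left p₁)).add
    (((hF.mul_left q₀).add (hD.mul_left q₁)).mul_left x)
  have e2 := ((shift hG).mul_left γ).add ((hG.mul_left x).mul_left δ)
  have := (e1.congr_fun (fun k => ?_)).unique e2
  · simp at this
    linear_combination this + h0
  · have := h k
    push_cast
    linear_combination (-x ^ (k + 1)) * this

section Contiguous

variable {a b c x : ℝ}

lemma contiguous_sub_right (ha : NotInt a) (hb : NotInt b) (hc : NotInt c) (hx : |x| < 1) :
    x * (1 - x) * deriv (₂F₁ a b c : ℝ → ℝ) x =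
      (c - b) * ₂F₁ a (b - 1) c x + (b - c + a * x) * ₂F₁ a b c x := by
  have := relation_of_coeff (c - b) 1 (-a) (-1) (c - b) 0 (hasSum_hypergeometric ha hb hc hx)
    (hasSum_mul_deriv_hypergeometric ha hb hc hx) (hasSum_hypergeometric ha hb.sub_one hc hx)
    (by simp [gaussCoeff_zero]) (fun k => ?_)
  · linear_combination this
  · have h1 := gaussCoeff_sub_one_right a c hb k
    have h2 := hc.add_nat_ne k
    have h3 : (k : ℝ) + 1 ≠ 0 := by positivity
    have h4 := hb.sub_one_ne
    rw [gaussCoeff_succ a (b - 1) hc, gaussCoeff_succ a b hc]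
    have h5 : gaussCoeff a b c k = gaussCoeff a (b - 1) c k * (b - 1 + k) / (b - 1) := by
      rw [h1]; field_simp
    rw [h5]
    field_simp
    ring

lemma contiguous_add_left (ha : NotInt a) (hb : NotInt b) (hc : NotInt c) (hx : |x| < 1) :
    x * deriv (₂F₁ a b c : ℝ → ℝ) x = a * (₂F₁ (a + 1) b c x - ₂F₁ a b c x) := by
  have := relation_of_coeff a 1 0 0 a 0 (hasSum_hypergeometric ha hb hc hx)
    (hasSum_mul_deriv_hypergeometric ha hb hc hx) (hasSum_hypergeometric ha.add_one hb hc hx)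
    (by simp [gaussCoeff_zero]) (fun k => ?_)
  · linear_combination this
  · have h0 := ha.ne_zero
    rw [gaussCoeff_add_one_left b c ha]
    push_cast
    field_simp
    ring

lemma contiguous_sub_right_sub_bottom (ha : NotInt a) (hb : NotInt b) (hc : NotInt c)
    (hx : |x| < 1) :
    x * (1 - x) * deriv (₂F₁ a b c : ℝ → ℝ) x =
      (c - 1) * ₂F₁ a (b - 1) (c - 1) x + (1 - c + a * x) * ₂F₁ a b c x := by
  have := relation_of_coeff (c - 1) 1 (-a) (-1) (c - 1) 0 (hasSum_hypergeometric ha hb hc hx)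
    (hasSum_mul_deriv_hypergeometric ha hb hc hx)
    (hasSum_hypergeometric ha hb.sub_one hc.sub_one hx)
    (by simp [gaussCoeff_zero]) (fun k => ?_)
  · linear_combination this
  · have h1 := gaussCoeff_sub_one_right a (c - 1) hb k
    have h1' := gaussCoeff_sub_one_bottom a b hc k
    have h2 := hc.add_nat_ne k
    have h2' := hc.sub_one.add_nat_ne k
    have h3 : (k : ℝ) + 1 ≠ 0 := by positivity
    have h4 := hb.sub_one_ne
    rw [gaussCoeff_succ a (b - 1) hc.sub_one, gaussCoeff_succ a b hc]
    have h5 : gaussCoeff a b (c - 1) k =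
        gaussCoeff a (b - 1) (c - 1) k * (b - 1 + k) / (b - 1) := by
      rw [h1]; field_simp
    have h6 : gaussCoeff a b c k =
        gaussCoeff a (b - 1) (c - 1) k * (b - 1 + k) / (b - 1) * (c - 1) / (c - 1 + k) := by
      rw [← h5, h1']; field_simp
    rw [h6]
    field_simp
    ring

lemma contiguous_add_left_add_bottom (ha : NotInt a) (hb : NotInt b) (hc : NotInt c)
    (hx : |x| < 1) :
    c * (x * (1 - x) * deriv (₂F₁ a b c : ℝ → ℝ) x) =
      x * (a * c * ₂F₁ a b c x + a * (b - c) * ₂F₁ (a + 1) b (c + 1) x) := by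
  have := relation_of_coeff 0 c (-(a * c)) (-c) 0 (a * (b - c)) (hasSum_hypergeometric ha hb hc hx)
    (hasSum_mul_deriv_hypergeometric ha hb hc hx)
    (hasSum_hypergeometric ha.add_one hb hc.add_one hx)
    (by simp) (fun k => ?_)
  · linear_combination this
  · have h2 := hc.add_nat_ne k
    have h3 : (k : ℝ) + 1 ≠ 0 := by positivity
    have h4 := ha.ne_zero
    rw [gaussCoeff_add_one_left b (c + 1) ha k, gaussCoeff_add_one_bottom a b hc k,
      gaussCoeff_succ a b hc]
    field_simp
    ring

lemma contiguous_add_bottom (ha : NotInt a) (hb : NotInt b) (hc : NotInt c) (hx : |x| < 1) :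
    c * (x * (1 - x) * deriv (₂F₁ a b c : ℝ → ℝ) x) =
      x * ((c - a) * (c - b) * ₂F₁ a b (c + 1) x + c * (a + b - c) * ₂F₁ a b c x) := by
  have := relation_of_coeff 0 c (-c * (a + b - c)) (-c) 0 ((c - a) * (c - b))
    (hasSum_hypergeometric ha hb hc hx)
    (hasSum_mul_deriv_hypergeometric ha hb hc hx)
    (hasSum_hypergeometric ha hb hc.add_one hx)
    (by simp) (fun k => ?_)
  · linear_combination this
  · have h2 := hc.add_nat_ne k
    have h3 : (k : ℝ) + 1 ≠ 0 := by positivity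
    rw [gaussCoeff_add_one_bottom a b hc k, gaussCoeff_succ a b hc]
    field_simp
    ring

lemma contiguous_sub_bottom (ha : NotInt a) (hb : NotInt b) (hc : NotInt c) (hx : |x| < 1) :
    x * deriv (₂F₁ a b c : ℝ → ℝ) x = (c - 1) * (₂F₁ a b (c - 1) x - ₂F₁ a b c x) := by
  have := relation_of_coeff (c - 1) 1 0 0 (c - 1) 0 (hasSum_hypergeometric ha hb hc hx)
    (hasSum_mul_deriv_hypergeometric ha hb hc hx) (hasSum_hypergeometric ha hb hc.sub_one hx)
    (by simp [gaussCoeff_zero]) (fun k => ?_)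
  · linear_combination this
  · have h1 := gaussCoeff_sub_one_bottom a b hc (k + 1)
    push_cast at h1
    linear_combination -h1

lemma contiguous_add_left_sub_right (ha : NotInt a) (hb : NotInt b) (hc : NotInt c)
    (hx : |x| < 1) :
    (b - a - 1) * (x * (1 - x) * deriv (₂F₁ a b c : ℝ → ℝ) x) =
      a * (b - c) * (₂F₁ (a + 1) (b - 1) c x - ₂F₁ a b c x) +
        a * (b - a - 1) * x * ₂F₁ a b c x := by
  have := relation_of_coeff (a * (b - c)) (b - a - 1) (-a * (b - a - 1)) (-(b - a - 1))
    (a * (b - c)) 0 (hasSum_hypergeometric ha hb hc hx)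
    (hasSum_mul_deriv_hypergeometric ha hb hc hx)
    (hasSum_hypergeometric ha.add_one hb.sub_one hc hx)
    (by simp [gaussCoeff_zero]) (fun k => ?_)
  · linear_combination this
  · have h1 := gaussCoeff_sub_one_right a c hb k
    have h2 := hc.add_nat_ne k
    have h3 : (k : ℝ) + 1 ≠ 0 := by positivity
    have h4 := hb.sub_one_ne
    have h0 := ha.ne_zero
    have h5 : gaussCoeff a b c k = gaussCoeff a (b - 1) c k * (b - 1 + k) / (b - 1) := by
      rw [h1]; field_simp
    rw [gaussCoeff_add_one_left _ c ha, gaussCoeff_succ a (b - 1) hc, gaussCoeff_succ a b hc, h5]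
    push_cast
    field_simp
    ring

end Contiguous

/-! ### The algebraic parametrization and its ladder operators -/

/-- The quantity `α_ε = (1 + t)/2 + ε √((1 + t + t²)/3)` for `ε = ±1`. If `t = e^{-2ξ/3}` then
`A_± = ± t^{-1/2} α_{±1}`, and if `t = -e^{-2ξ/3}` then `C_± = ± |t|^{-1/2} α_{±1}`. -/
noncomputable def octAlpha (ε t : ℝ) : ℝ := (1 + t) / 2 + ε * Real.sqrt ((1 + t + t ^ 2) / 3)

/-- The octahedral parameter `u_ε = α_{-ε}/α_ε`, the argument of `r^m_n`. The numerator is written as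
`1 + t - α_ε`, since `α_1 + α_{-1} = 1 + t`. -/
noncomputable def octU (ε t : ℝ) : ℝ := (1 + t - octAlpha ε t) / octAlpha ε t

/-- The vertex polynomial `p_v(u) = 1 + 14 u + u²`. -/
def octPv (u : ℝ) : ℝ := 1 + 14 * u + u ^ 2

/-- The function `|α_ε|^{1/4} α_ε^{3k} ρ(u_ε)`, the algebraic form of the Legendre functions,
with `k = n + m`. The sign of `α_ε` is kept in the integral power only. -/
noncomputable def octTerm (ε : ℝ) (ρ : ℝ → ℝ) (k : ℤ) (t : ℝ) : ℝ :=
  |octAlpha ε t| ^ (1 / 4 : ℝ) * octAlpha ε t ^ (3 * k) * ρ (octU ε t)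

section Geometry

variable {ε t : ℝ}

lemma radicand_pos (t : ℝ) : 0 < (1 + t + t ^ 2) / 3 := by nlinarith [sq_nonneg (t + 1 / 2)]

lemma octAlpha_sub_sq (hε : ε ^ 2 = 1) :
    (2 * octAlpha ε t - 1 - t) ^ 2 = 4 * (1 + t + t ^ 2) / 3 := by
  have h := Real.sq_sqrt (radicand_pos t).le
  rw [octAlpha]
  linear_combination 4 * (ε ^ 2) * h + 4 * ((1 + t + t ^ 2) / 3) * hε

lemma octAlpha_sq (hε : ε ^ 2 = 1) :
    octAlpha ε t ^ 2 = (1 + t) * octAlpha ε t + (1 - t) ^ 2 / 12 := by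
  linear_combination octAlpha_sub_sq (t := t) hε / 4

lemma octAlpha_sub_ne (hε : ε ^ 2 = 1) : 2 * octAlpha ε t - 1 - t ≠ 0 := fun h => by
  have := octAlpha_sub_sq (t := t) hε
  rw [h] at this
  have := radicand_pos t
  linarith

lemma octAlpha_ne_zero (hε : ε ^ 2 = 1) (ht : t < 1) : octAlpha ε t ≠ 0 := fun h => by
  have := octAlpha_sq (t := t) hε
  rw [h] at this
  nlinarith [sub_pos.2 ht]

lemma octAlpha_mul_octU (hε : ε ^ 2 = 1) (ht : t < 1) :
    octAlpha ε t * octU ε t = 1 + t - octAlpha ε t := by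
  have := octAlpha_ne_zero hε ht
  rw [octU]; field_simp

lemma octAlpha_mul_one_sub_octU (hε : ε ^ 2 = 1) (ht : t < 1) :
    octAlpha ε t * (1 - octU ε t) = 2 * octAlpha ε t - 1 - t := by
  linear_combination -octAlpha_mul_octU hε ht

lemma octAlpha_sq_mul_octU (hε : ε ^ 2 = 1) (ht : t < 1) :
    octAlpha ε t ^ 2 * octU ε t = -(1 - t) ^ 2 / 12 := by
  linear_combination octAlpha ε t * octAlpha_mul_octU hε ht - octAlpha_sq (t := t) hε

lemma octPv_octU (hε : ε ^ 2 = 1) (ht : t < 1) : octPv (octU ε t) * octAlpha ε t ^ 2 = 4 * t := by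
  rw [octPv]
  linear_combination 12 * octAlpha_sq_mul_octU hε ht +
    (octAlpha ε t + octAlpha ε t * octU ε t + 1 + t) * octAlpha_mul_octU hε ht

lemma octahedralPe_octU (hε : ε ^ 2 = 1) (ht : t < 1) :
    octahedralPe (octU ε t) * octAlpha ε t ^ 3 = 4 * (1 + t ^ 3) := by
  have h1 := octAlpha_mul_octU hε ht
  have h2 := octAlpha_sq_mul_octU hε ht
  have h3 : (octAlpha ε t * (1 + octU ε t)) = 1 + t := by linear_combination h1
  have h4 : (1 - 34 * octU ε t + octU ε t ^ 2) * octAlpha ε t ^ 2 = (1 + t) ^ 2 + 3 * (1 - t) ^ 2 := by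
    linear_combination (octAlpha ε t * (1 + octU ε t) + 1 + t) * h3 - 36 * h2
  rw [octahedralPe]
  linear_combination (1 - 34 * octU ε t + octU ε t ^ 2) * octAlpha ε t ^ 2 * h3 + (1 + t) * h4

lemma one_sub_cube_sq (hε : ε ^ 2 = 1) (ht : t < 1) :
    (1 - t ^ 3) ^ 2 = -27 / 4 * octU ε t * (1 - octU ε t) ^ 4 * octAlpha ε t ^ 6 := by
  have h2 := octAlpha_sq_mul_octU hε ht
  have h3 : (octAlpha ε t * (1 - octU ε t)) ^ 2 = 4 * (1 + t + t ^ 2) / 3 := by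
    rw [octAlpha_mul_one_sub_octU hε ht, octAlpha_sub_sq hε]
  have : -27 / 4 * octU ε t * (1 - octU ε t) ^ 4 * octAlpha ε t ^ 6 =
      -27 / 4 * (octAlpha ε t ^ 2 * octU ε t) * ((octAlpha ε t * (1 - octU ε t)) ^ 2) ^ 2 := by ring
  rw [this, h2, h3]; ring

lemma octU_ne_zero (hε : ε ^ 2 = 1) (ht : t < 1) : octU ε t ≠ 0 := fun h => by
  have := octAlpha_sq_mul_octU hε ht
  rw [h] at this
  nlinarith [sub_pos.2 ht]

lemma one_sub_octU_ne_zero (hε : ε ^ 2 = 1) (ht : t < 1) : 1 - octU ε t ≠ 0 := fun h => by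
  have := octAlpha_mul_one_sub_octU hε ht
  rw [h] at this
  exact octAlpha_sub_ne (t := t) hε (by linarith)

lemma octPv_octU_ne_zero (hε : ε ^ 2 = 1) (ht : t < 1) (h0 : t ≠ 0) : octPv (octU ε t) ≠ 0 :=
  fun h => by
    have := octPv_octU hε ht
    rw [h] at this
    exact h0 (by linarith)

lemma one_sub_cube_pos (ht : t < 1) : 0 < 1 - t ^ 3 := by
  nlinarith [sub_pos.2 ht, radicand_pos t]

lemma hasDerivAt_octAlpha (hε : ε ^ 2 = 1) :
    HasDerivAt (octAlpha ε) ((octAlpha ε t - (1 - t) / 6) / (2 * octAlpha ε t - 1 - t)) t := by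
  have hs : HasDerivAt (fun t : ℝ => (1 + t + t ^ 2) / 3) ((1 + 2 * t) / 3) t := by
    have := ((((hasDerivAt_id t).const_add 1).add ((hasDerivAt_id t).pow 2)).div_const 3)
    refine this.congr_deriv ?_
    simp
  have h := ((((hasDerivAt_id t).const_add 1).div_const 2).add
    ((hs.sqrt (radicand_pos t).ne').const_mul ε))
  refine h.congr_deriv ?_
  have hq := (Real.sqrt_pos.2 (radicand_pos t)).ne'
  have h1 : 2 * octAlpha ε t - 1 - t = 2 * ε * Real.sqrt ((1 + t + t ^ 2) / 3) := by
    rw [octAlpha]; ring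
  have h2 : ε ≠ 0 := by rintro rfl; norm_num at hε
  rw [h1, octAlpha]
  set s := Real.sqrt ((1 + t + t ^ 2) / 3)
  field_simp
  linear_combination (24 * t + 12) * hε

lemma hasDerivAt_octU (hε : ε ^ 2 = 1) (ht : t < 1) :
    HasDerivAt (octU ε) (-3 * octAlpha ε t * octU ε t * (1 - octU ε t) / (1 - t ^ 3)) t := by
  have ha := hasDerivAt_octAlpha (t := t) hε
  have h := (((hasDerivAt_id t).const_add 1).sub ha).div ha (octAlpha_ne_zero hε ht)
  refine h.congr_deriv ?_
  have h0 := octAlpha_ne_zero hε ht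
  have h1 := octAlpha_sub_ne (t := t) hε
  have h2 := octAlpha_sub_sq (t := t) hε
  have h3 := octAlpha_sq (t := t) hε
  have h4 := (one_sub_cube_pos ht).ne'
  have h5 := one_sub_octU_ne_zero hε ht
  have h6 := octAlpha_sq_mul_octU hε ht
  have h7 := octAlpha_mul_one_sub_octU hε ht
  have h8 : (1 - t ^ 3) = (1 - t) * (3 / 4 * (2 * octAlpha ε t - 1 - t) ^ 2) := by rw [h2]; ring
  have h9 := (sub_pos.2 ht).ne'
  simp only [id, Pi.sub_apply]
  -- both sides equal `(1 - t) / (3 (2 α - 1 - t) α²)`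
  trans (1 - t) / (3 * (2 * octAlpha ε t - 1 - t) * octAlpha ε t ^ 2)
  · generalize octAlpha ε t = α at *
    have h10 : (1 - (α - (1 - t) / 6) / (2 * α - 1 - t)) * α -
        (1 + t - α) * ((α - (1 - t) / 6) / (2 * α - 1 - t)) =
        (1 - t) / 3 / (2 * α - 1 - t) := by
      rw [eq_div_iff h1]
      have : (α - (1 - t) / 6) / (2 * α - 1 - t) * (2 * α - 1 - t) = α - (1 - t) / 6 :=
        div_mul_cancel₀ _ h1
      linear_combination (-(1 + t)) * this + 2 * h3
    rw [h10]
    field_simp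
  · have h11 : -3 * octAlpha ε t * octU ε t * (1 - octU ε t) =
        (1 - t) ^ 2 / 4 * (2 * octAlpha ε t - 1 - t) / octAlpha ε t ^ 2 := by
      rw [eq_div_iff (pow_ne_zero 2 h0), ← h7]
      linear_combination (-3 * octAlpha ε t * (1 - octU ε t)) * h6
    rw [h11, h8]
    field_simp

/-- The logarithmic derivative of `α_ε`, expressed through `u_ε` and `α_ε³`. -/
lemma logDeriv_octAlpha (hε : ε ^ 2 = 1) (ht : t < 1) :
    (1 - t ^ 3) * t * ((octAlpha ε t - (1 - t) / 6) / (2 * octAlpha ε t - 1 - t)) =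
      octAlpha ε t * ((1 - t ^ 3) / 2 +
        3 / 8 * (14 + 2 * octU ε t) * octAlpha ε t ^ 3 * (octU ε t * (1 - octU ε t))) := by
  have h1 := octAlpha_sub_ne (t := t) hε
  have h2 := octAlpha_sub_sq (t := t) hε
  have h3 := octAlpha_sq (t := t) hε
  have h6 := octAlpha_sq_mul_octU hε ht
  have h7 := octAlpha_mul_one_sub_octU hε ht
  have h8 := octAlpha_mul_octU hε ht
  have h9 : octAlpha ε t * ((1 - t ^ 3) / 2 +
        3 / 8 * (14 + 2 * octU ε t) * octAlpha ε t ^ 3 * (octU ε t * (1 - octU ε t))) =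
      octAlpha ε t * (1 - t ^ 3) / 2 + 3 / 8 * (12 * octAlpha ε t + 2 * (1 + t)) *
        (-(1 - t) ^ 2 / 12) * (2 * octAlpha ε t - 1 - t) := by
    rw [← h6, ← h7]
    linear_combination 3 / 4 * octAlpha ε t ^ 3 * octU ε t * (1 - octU ε t) * h8
  rw [h9, mul_div_assoc', div_eq_iff h1]
  generalize octAlpha ε t = α at *
  linear_combination (3 / 2 * (1 - t) ^ 2 * α - 3 / 4 - t / 4 - t ^ 2 / 4 + 5 / 4 * t ^ 3) * h3

end Geometry

/-! The ladder operators. If `t = e^{-2ξ/3}` and `w(ξ) = t^{-1/2-3n/2} (1 - t³)^{1/4-m} E(t)` solves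
Legendre's equation of degree `-3/4 - m` and order `1/3 + n` in `coth ξ`, they correspond to the
operators `sinh ξ d/dξ ± μ cosh ξ` and `d/dξ - ν' coth ξ` that shift the order and the degree. -/

/-- The operator taking the index `n` to `n + 1`, as a function of `E' = D` and `E` at `t`. -/
noncomputable def raiseOrder (n m : ℤ) (t D E : ℝ) : ℝ :=
  (1 - t ^ 3) * t * D - ((1 + 3 * (n : ℝ)) + t ^ 3 * (3 / 4 - 3 * (m : ℝ))) * E

/-- The operator taking the index `n` to `n - 1`. -/
noncomputable def lowerOrder (n m : ℤ) (t D E : ℝ) : ℝ :=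
  (1 - t ^ 3) / t ^ 2 * D + (1 / 4 + 3 * (m : ℝ) + 3 * (n : ℝ)) * E

/-- The operator taking the index `m` to `m + 1`. -/
noncomputable def raiseDegree (n m : ℤ) (t D E : ℝ) : ℝ :=
  (1 - t ^ 3) * t * D - ((1 / 2 + 3 * (n : ℝ) / 2) * (1 - t ^ 3) +
    t ^ 3 * (3 / 4 - 3 * (m : ℝ)) - (9 / 8 + 3 * (m : ℝ) / 2) * (1 + t ^ 3)) * E

/-- The operator taking the index `m` to `m - 1`. -/
noncomputable def lowerDegree (n m : ℤ) (t D E : ℝ) : ℝ :=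
  (t * D - (1 / 4 + 3 * (m : ℝ) + 3 * (n : ℝ)) / 2 * E) / (1 - t ^ 3)

/-- The multiplier of `raiseOrder` on the functions normalized by `r^m_n(0) = 1`. -/
noncomputable def raiseOrderFactor (n m : ℤ) : ℝ := -(7 / 4 + 3 * (n : ℝ) - 3 * (m : ℝ)) / 8

/-- The multiplier of `lowerOrder`. -/
noncomputable def lowerOrderFactor (n m : ℤ) : ℝ := 8 * (1 / 4 + 3 * (m : ℝ) + 3 * (n : ℝ))

/-- The multiplier of `raiseDegree`. -/
noncomputable def raiseDegreeFactor (_n m : ℤ) : ℝ := (3 / 2 + 6 * (m : ℝ)) / 8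

/-- The multiplier of `lowerDegree`. -/
noncomputable def lowerDegreeFactor (n m : ℤ) : ℝ :=
  -(1 / 4 + 3 * (m : ℝ) + 3 * (n : ℝ)) * (7 / 12 + (n : ℝ) - (m : ℝ)) / (3 / 4 - (m : ℝ))

/-- A family of functions on `s`, indexed by `(n, m)`, on which the four ladder operators shift the
indices. -/
structure IsLadder (Y : ℤ → ℤ → ℝ → ℝ) (s : Set ℝ) : Prop where
  differentiableAt : ∀ n m, ∀ t ∈ s, DifferentiableAt ℝ (Y n m) t
  raiseOrder : ∀ n m, ∀ t ∈ s,
    raiseOrder n m t (deriv (Y n m) t) (Y n m t) = raiseOrderFactor n m * Y (n + 1) m t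
  lowerOrder : ∀ n m, ∀ t ∈ s,
    lowerOrder n m t (deriv (Y n m) t) (Y n m t) = lowerOrderFactor n m * Y (n - 1) m t
  raiseDegree : ∀ n m, ∀ t ∈ s,
    raiseDegree n m t (deriv (Y n m) t) (Y n m t) = raiseDegreeFactor n m * Y n (m + 1) t
  lowerDegree : ∀ n m, ∀ t ∈ s,
    lowerDegree n m t (deriv (Y n m) t) (Y n m t) = lowerDegreeFactor n m * Y n (m - 1) t

section OctTerm

variable {ε t : ℝ} {ρ : ℝ → ℝ} {ρ' : ℝ}

lemma hasDerivAt_abs_rpow_quarter {f : ℝ → ℝ} {f' : ℝ} (hf : HasDerivAt f f' t) (h0 : f t ≠ 0) :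
    HasDerivAt (fun s => |f s| ^ (1 / 4 : ℝ)) (1 / 4 * (f' / f t) * |f t| ^ (1 / 4 : ℝ)) t := by
  have h1 : ∀ s, |f s| ^ (1 / 4 : ℝ) = (f s ^ 2) ^ (1 / 8 : ℝ) := fun s => by
    rw [← sq_abs, ← Real.rpow_natCast, ← Real.rpow_mul (abs_nonneg _)]
    norm_num
  simp_rw [h1]
  have h := (hf.pow 2).rpow_const (p := 1 / 8) (Or.inl (pow_ne_zero 2 h0))
  refine h.congr_deriv ?_
  simp only [Pi.pow_apply]
  rw [Real.rpow_sub_one (pow_ne_zero 2 h0)]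
  field_simp
  norm_num
  ring

/-- The combination of `ρ` and `ρ'` common to the four ladder operators in the variable `u`. -/
noncomputable def octLog (e u r r' : ℝ) : ℝ :=
  -(3 / 4) * octPv u * (u * (1 - u)) * r' + 3 * e / 8 * (14 + 2 * u) * (u * (1 - u)) * r

lemma hasDerivAt_octTerm (k : ℤ) (hε : ε ^ 2 = 1) (ht : t < 1) (h0 : t ≠ 0)
    (hρ : HasDerivAt ρ ρ' (octU ε t)) :
    HasDerivAt (octTerm ε ρ k) (|octAlpha ε t| ^ (1 / 4 : ℝ) * octAlpha ε t ^ (3 * k) *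
      (octAlpha ε t ^ 3 * octLog (1 / 4 + 3 * k) (octU ε t) (ρ (octU ε t)) ρ' +
        (1 / 4 + 3 * k) * (1 - t ^ 3) / 2 * ρ (octU ε t)) / ((1 - t ^ 3) * t)) t := by
  have ha := hasDerivAt_octAlpha (t := t) hε
  have hα := octAlpha_ne_zero hε ht
  have hz := (hasDerivAt_zpow (3 * k) _ (Or.inl hα)).comp t ha
  have hu := hρ.comp t (hasDerivAt_octU hε ht)
  have h := ((hasDerivAt_abs_rpow_quarter ha hα).mul hz).mul hu
  refine h.congr_deriv ?_
  have hl := logDeriv_octAlpha hε ht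
  have hp := octPv_octU hε ht
  have hc := (one_sub_cube_pos ht).ne'
  rw [eq_div_iff (mul_ne_zero hc h0), zpow_sub_one₀ hα]
  simp only [Function.comp_apply, Pi.mul_apply, octLog]
  generalize (octAlpha ε t - (1 - t) / 6) / (2 * octAlpha ε t - 1 - t) = α' at *
  generalize octAlpha ε t = α at *
  generalize |α| ^ (1 / 4 : ℝ) = w
  generalize α ^ (3 * k) = z
  generalize octU ε t = u at *
  push_cast
  field_simp
  linear_combination w * z * ρ u * (192 * k + 16) * hl + 48 * w * z * α ^ 2 * ρ' * u * (1 - u) * hp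

lemma octTerm_of_eq {ρ₁ : ℝ → ℝ} {κ r : ℝ} (k : ℤ) (h : κ * ρ₁ (octU ε t) = r) :
    κ * octTerm ε ρ₁ k t = |octAlpha ε t| ^ (1 / 4 : ℝ) * octAlpha ε t ^ (3 * k) * r := by
  rw [← h, octTerm]; ring

lemma raiseOrder_octTerm {ρ₁ : ℝ → ℝ} (n m : ℤ) (hε : ε ^ 2 = 1) (ht : t < 1) (h0 : t ≠ 0)
    (hρ : HasDerivAt ρ ρ' (octU ε t))
    (h : raiseOrderFactor n m * ρ₁ (octU ε t) =
      octLog (1 / 4 + 3 * m + 3 * n) (octU ε t) (ρ (octU ε t)) ρ' +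
        1 / 4 * octahedralPe (octU ε t) * (-7 / 8 + 3 * m / 2 - 3 * n / 2) * ρ (octU ε t)) :
    raiseOrder n m t (deriv (octTerm ε ρ (n + m)) t) (octTerm ε ρ (n + m) t) =
      raiseOrderFactor n m * octTerm ε ρ₁ (n + 1 + m) t := by
  rw [octTerm_of_eq _ h, (hasDerivAt_octTerm (n + m) hε ht h0 hρ).deriv, raiseOrder, octTerm]
  have hc := (one_sub_cube_pos ht).ne'
  have hp := octahedralPe_octU hε ht
  have hα := octAlpha_ne_zero hε ht
  rw [show 3 * (n + 1 + m) = 3 * (n + m) + 3 by ring, zpow_add₀ hα,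
    show octAlpha ε t ^ (3 : ℤ) = octAlpha ε t ^ 3 by norm_cast]
  push_cast
  rw [show (1 / 4 + 3 * (n + m) : ℝ) = 1 / 4 + 3 * m + 3 * n by ring]
  generalize octLog _ _ _ _ = L
  rw [mul_div_cancel₀ _ (mul_ne_zero hc h0)]
  linear_combination (7 / 32 - 3 * m / 8 + 3 * n / 8) *
    (|octAlpha ε t| ^ (1 / 4 : ℝ) * octAlpha ε t ^ (3 * (n + m)) * ρ (octU ε t)) * hp

lemma lowerOrder_octTerm {ρ₁ : ℝ → ℝ} (n m : ℤ) (hε : ε ^ 2 = 1) (ht : t < 1) (h0 : t ≠ 0)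
    (hρ : HasDerivAt ρ ρ' (octU ε t))
    (h : lowerOrderFactor n m * ρ₁ (octU ε t) = 64 / octPv (octU ε t) ^ 3 *
      (octLog (1 / 4 + 3 * m + 3 * n) (octU ε t) (ρ (octU ε t)) ρ' +
        (1 / 4 + 3 * m + 3 * n) / 8 * octahedralPe (octU ε t) * ρ (octU ε t))) :
    lowerOrder n m t (deriv (octTerm ε ρ (n + m)) t) (octTerm ε ρ (n + m) t) =
      lowerOrderFactor n m * octTerm ε ρ₁ (n - 1 + m) t := by
  rw [octTerm_of_eq _ h, (hasDerivAt_octTerm (n + m) hε ht h0 hρ).deriv, lowerOrder, octTerm]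
  have hc := (one_sub_cube_pos ht).ne'
  have hp := octahedralPe_octU hε ht
  have hv := octPv_octU hε ht
  have hv0 := octPv_octU_ne_zero hε ht h0
  have hα := octAlpha_ne_zero hε ht
  rw [show 3 * (n - 1 + m) = 3 * (n + m) - 3 by ring, zpow_sub₀ hα,
    show octAlpha ε t ^ (3 : ℤ) = octAlpha ε t ^ 3 by norm_cast]
  push_cast
  rw [show (1 / 4 + 3 * (n + m) : ℝ) = 1 / 4 + 3 * m + 3 * n by ring]
  generalize octLog _ _ _ _ = L
  have hv3 : octPv (octU ε t) ^ 3 = 64 * t ^ 3 / octAlpha ε t ^ 6 := by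
    rw [eq_div_iff (pow_ne_zero 6 hα)]
    linear_combination ((octPv (octU ε t) * octAlpha ε t ^ 2) ^ 2 +
      octPv (octU ε t) * octAlpha ε t ^ 2 * (4 * t) + (4 * t) ^ 2) * hv
  rw [hv3]
  field_simp
  linear_combination (-(24 * m + 24 * n + 2)) * ρ (octU ε t) * hp

lemma raiseDegree_octTerm {ρ₁ : ℝ → ℝ} (n m : ℤ) (hε : ε ^ 2 = 1) (ht : t < 1) (h0 : t ≠ 0)
    (hρ : HasDerivAt ρ ρ' (octU ε t))
    (h : raiseDegreeFactor n m * ρ₁ (octU ε t) =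
      octLog (1 / 4 + 3 * m + 3 * n) (octU ε t) (ρ (octU ε t)) ρ' +
        (3 / 4 + 3 * m) / 4 * octahedralPe (octU ε t) * ρ (octU ε t)) :
    raiseDegree n m t (deriv (octTerm ε ρ (n + m)) t) (octTerm ε ρ (n + m) t) =
      raiseDegreeFactor n m * octTerm ε ρ₁ (n + (m + 1)) t := by
  rw [octTerm_of_eq _ h, (hasDerivAt_octTerm (n + m) hε ht h0 hρ).deriv, raiseDegree, octTerm]
  have hc := (one_sub_cube_pos ht).ne'
  have hp := octahedralPe_octU hε ht
  have hα := octAlpha_ne_zero hε ht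
  rw [show 3 * (n + (m + 1)) = 3 * (n + m) + 3 by ring, zpow_add₀ hα,
    show octAlpha ε t ^ (3 : ℤ) = octAlpha ε t ^ 3 by norm_cast]
  push_cast
  rw [show (1 / 4 + 3 * (n + m) : ℝ) = 1 / 4 + 3 * m + 3 * n by ring]
  generalize octLog _ _ _ _ = L
  rw [mul_div_cancel₀ _ (mul_ne_zero hc h0)]
  linear_combination (-(3 / 16 + 3 * m / 4)) *
    (|octAlpha ε t| ^ (1 / 4 : ℝ) * octAlpha ε t ^ (3 * (n + m)) * ρ (octU ε t)) * hp

lemma lowerDegree_octTerm {ρ₁ : ℝ → ℝ} (n m : ℤ) (hε : ε ^ 2 = 1) (ht : t < 1) (h0 : t ≠ 0)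
    (hρ : HasDerivAt ρ ρ' (octU ε t))
    (h : lowerDegreeFactor n m * ρ₁ (octU ε t) =
      -(4 / 27) / (octU ε t * (1 - octU ε t) ^ 4) *
        octLog (1 / 4 + 3 * m + 3 * n) (octU ε t) (ρ (octU ε t)) ρ') :
    lowerDegree n m t (deriv (octTerm ε ρ (n + m)) t) (octTerm ε ρ (n + m) t) =
      lowerDegreeFactor n m * octTerm ε ρ₁ (n + (m - 1)) t := by
  rw [octTerm_of_eq _ h, (hasDerivAt_octTerm (n + m) hε ht h0 hρ).deriv, lowerDegree, octTerm]
  have hc := (one_sub_cube_pos ht).ne'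
  have hs := one_sub_cube_sq hε ht
  have hα := octAlpha_ne_zero hε ht
  have hu := octU_ne_zero hε ht
  have hu1 := one_sub_octU_ne_zero hε ht
  rw [show 3 * (n + (m - 1)) = 3 * (n + m) - 3 by ring, zpow_sub₀ hα,
    show octAlpha ε t ^ (3 : ℤ) = octAlpha ε t ^ 3 by norm_cast]
  push_cast
  rw [show (1 / 4 + 3 * (n + m) : ℝ) = 1 / 4 + 3 * m + 3 * n by ring]
  generalize octLog _ _ _ _ = L
  have hs' : octU ε t * (1 - octU ε t) ^ 4 = -4 / 27 * (1 - t ^ 3) ^ 2 / octAlpha ε t ^ 6 := by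
    rw [eq_div_iff (pow_ne_zero 6 hα), hs]; ring
  rw [hs']
  field_simp
  ring

end OctTerm

/-! ### Ladders of Legendre functions -/

lemma risingFactorial_add_one {d : ℝ} (hd : NotInt d) (k : ℤ) :
    risingFactorial d (k + 1) = risingFactorial d k * (d + k) := by
  rcases k with k | k
  · change risingFactorial d (Int.ofNat (k + 1)) = _
    simp [risingFactorial, Finset.prod_range_succ]
  · rcases k with _ | k
    · change risingFactorial d (Int.ofNat 0) = _
      have := hd.sub_one_ne
      simp [risingFactorial, ← sub_eq_add_neg, this]
    · have h1 : Int.negSucc (k + 1) + 1 = Int.negSucc k := by omega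
      have h2 : d - ((k : ℝ) + 1 + 1) ≠ 0 := fun h => hd (k + 2) (by push_cast; linarith)
      rw [h1]
      simp only [risingFactorial]
      rw [Finset.prod_range_succ (n := k + 1)]
      push_cast
      rw [show d + -((k : ℝ) + 1 + 1) = d - (k + 1 + 1) by ring]
      rw [mul_inv, mul_assoc, inv_mul_cancel₀ h2, mul_one]

lemma risingFactorial_zero (d : ℝ) : risingFactorial d 0 = 1 := by
  change risingFactorial d (Int.ofNat 0) = 1
  simp [risingFactorial]

lemma risingFactorial_ne_zero {d : ℝ} (hd : NotInt d) (k : ℤ) : risingFactorial d k ≠ 0 := by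
  have hk : ∀ j : ℤ, d + j ≠ 0 := fun j h => hd (-j) (by push_cast; linarith)
  induction k using Int.induction_on with
  | zero => simp [risingFactorial_zero]
  | succ k ih => rw [risingFactorial_add_one hd]; exact mul_ne_zero ih (hk _)
  | pred k ih =>
    have h := risingFactorial_add_one hd (-(k : ℤ) - 1)
    rw [sub_add_cancel] at h
    intro h0
    rw [h0, zero_mul] at h
    exact ih h

/-- The argument `tanh² ξ` of the series of the second Legendre functions, at `t = e^{-2ξ/3}`. -/
noncomputable def tanhSq (t : ℝ) : ℝ := ((1 - t ^ 3) / (1 + t ^ 3)) ^ 2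

section TanhSq

variable {t : ℝ}

lemma one_add_cube_pos (h0 : 0 < t) : 0 < 1 + t ^ 3 := by positivity

lemma tanhSq_pos (h0 : 0 < t) (h1 : t < 1) : 0 < tanhSq t :=
  pow_pos (div_pos (one_sub_cube_pos h1) (one_add_cube_pos h0)) 2

lemma abs_tanhSq_lt_one (h0 : 0 < t) (h1 : t < 1) : |tanhSq t| < 1 := by
  rw [abs_of_pos (tanhSq_pos h0 h1), tanhSq, div_pow, div_lt_one (by positivity)]
  nlinarith [pow_pos h0 3]

lemma one_sub_tanhSq (h0 : 0 < t) : 1 - tanhSq t = 4 * t ^ 3 / (1 + t ^ 3) ^ 2 := by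
  have := (one_add_cube_pos h0).ne'
  rw [tanhSq]; field_simp; ring

lemma one_sub_tanhSq_ne (h0 : 0 < t) : 1 - tanhSq t ≠ 0 := by
  rw [one_sub_tanhSq h0]; positivity

lemma hasDerivAt_tanhSq (h0 : 0 < t) :
    HasDerivAt tanhSq (-12 * t ^ 2 * (1 - t ^ 3) / (1 + t ^ 3) ^ 3) t := by
  have hp := (one_add_cube_pos h0).ne'
  have h := ((((hasDerivAt_pow 3 t).const_sub 1).div ((hasDerivAt_pow 3 t).const_add 1) hp).pow 2)
  refine h.congr_deriv ?_
  simp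
  field_simp
  ring

/-- A solution `φ` of the hypergeometric equation in `tanh² ξ`, turned into a function of `t`. -/
noncomputable def liftTanhSq (n m : ℤ) (φ : ℝ → ℝ) (t : ℝ) : ℝ :=
  (4 * (1 + t ^ 3)) ^ (1 / 12 + (m : ℝ) + (n : ℝ)) * φ (tanhSq t)

variable {n m : ℤ} {φ φ₁ : ℝ → ℝ} {φ' : ℝ}

lemma hasDerivAt_liftTanhSq (h0 : 0 < t) (hφ : HasDerivAt φ φ' (tanhSq t)) :
    HasDerivAt (liftTanhSq n m φ) ((4 * (1 + t ^ 3)) ^ (1 / 12 + (m : ℝ) + (n : ℝ)) *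
      (3 * (1 / 12 + (m : ℝ) + (n : ℝ)) * t ^ 2 / (1 + t ^ 3) * φ (tanhSq t) +
        φ' * (-12 * t ^ 2 * (1 - t ^ 3) / (1 + t ^ 3) ^ 3))) t := by
  have hp := one_add_cube_pos h0
  have h1 := (((hasDerivAt_pow 3 t).const_add 1).const_mul 4).rpow_const
    (p := 1 / 12 + (m : ℝ) + (n : ℝ)) (Or.inl (mul_pos four_pos hp).ne')
  refine (h1.mul (hφ.comp t (hasDerivAt_tanhSq h0))).congr_deriv ?_
  have h4 : (4 * (1 + t ^ 3)) ≠ 0 := (mul_pos four_pos hp).ne'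
  rw [Real.rpow_sub_one h4]
  simp only [Function.comp_apply]
  generalize φ (tanhSq t) = f
  generalize (4 * (1 + t ^ 3)) ^ (1 / 12 + (m : ℝ) + (n : ℝ)) = w
  have := hp.ne'
  field_simp
  push_cast
  ring

lemma liftTanhSq_shift_up (n' m' : ℤ) (h : n' + m' = n + m + 1) (h0 : 0 < t) :
    liftTanhSq n' m' φ t =
      (4 * (1 + t ^ 3)) ^ (1 / 12 + (m : ℝ) + (n : ℝ)) * (4 * (1 + t ^ 3)) * φ (tanhSq t) := by
  have hp := one_add_cube_pos h0
  have h' : (n' : ℝ) + m' = n + m + 1 := by exact_mod_cast h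
  rw [liftTanhSq, ← Real.rpow_add_one (by positivity)]
  congr 2
  linarith

lemma liftTanhSq_shift_down (n' m' : ℤ) (h : n' + m' = n + m - 1) (h0 : 0 < t) :
    liftTanhSq n' m' φ t =
      (4 * (1 + t ^ 3)) ^ (1 / 12 + (m : ℝ) + (n : ℝ)) / (4 * (1 + t ^ 3)) * φ (tanhSq t) := by
  have hp := one_add_cube_pos h0
  have h' : (n' : ℝ) + m' = n + m - 1 := by exact_mod_cast h
  rw [liftTanhSq, ← Real.rpow_sub_one (by positivity)]
  congr 2
  linarith

lemma raiseOrder_liftTanhSq (h0 : 0 < t) (h1 : t < 1) (hφ : HasDerivAt φ φ' (tanhSq t))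
    (h : tanhSq t * (1 - tanhSq t) * φ' = (7 / 24 + ((n : ℝ) - m) / 2) * φ₁ (tanhSq t) +
      (-(7 / 24) - ((n : ℝ) - m) / 2 + (-(1 / 24) - (m : ℝ) / 2 - (n : ℝ) / 2) * tanhSq t) *
        φ (tanhSq t)) :
    raiseOrder n m t (deriv (liftTanhSq n m φ) t) (liftTanhSq n m φ t) =
      raiseOrderFactor n m * liftTanhSq (n + 1) m φ₁ t := by
  rw [(hasDerivAt_liftTanhSq h0 hφ).deriv, liftTanhSq_shift_up (n := n) (m := m) (n + 1) m (by ring) h0,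
    liftTanhSq, raiseOrder, raiseOrderFactor]
  generalize φ (tanhSq t) = f at *
  generalize φ₁ (tanhSq t) = f₁ at *
  generalize (4 * (1 + t ^ 3)) ^ (1 / 12 + (m : ℝ) + (n : ℝ)) = w
  have hp := (one_add_cube_pos h0).ne'
  have hm := (one_sub_cube_pos h1).ne'
  have ht := h0.ne'
  have h2 := mul_ne_zero (tanhSq_pos h0 h1).ne' (one_sub_tanhSq_ne h0)
  have hφ' := eq_div_of_mul_eq h2 ((mul_comm _ _).trans h)
  rw [hφ', one_sub_tanhSq h0, tanhSq]
  field_simp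
  ring

lemma lowerOrder_liftTanhSq (h0 : 0 < t) (h1 : t < 1) (hφ : HasDerivAt φ φ' (tanhSq t))
    (h : tanhSq t * φ' = (-(1 / 24) - (m : ℝ) / 2 - (n : ℝ) / 2) *
      (φ₁ (tanhSq t) - φ (tanhSq t))) :
    lowerOrder n m t (deriv (liftTanhSq n m φ) t) (liftTanhSq n m φ t) =
      lowerOrderFactor n m * liftTanhSq (n - 1) m φ₁ t := by
  rw [(hasDerivAt_liftTanhSq h0 hφ).deriv, liftTanhSq_shift_down (n := n) (m := m) (n - 1) m (by ring) h0,
    liftTanhSq, lowerOrder, lowerOrderFactor]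
  generalize φ (tanhSq t) = f at *
  generalize φ₁ (tanhSq t) = f₁ at *
  generalize (4 * (1 + t ^ 3)) ^ (1 / 12 + (m : ℝ) + (n : ℝ)) = w
  have hp := (one_add_cube_pos h0).ne'
  have hm := (one_sub_cube_pos h1).ne'
  have ht := h0.ne'
  have h2 := tanhSq_pos h0 h1
  have hφ' := eq_div_of_mul_eq h2.ne' ((mul_comm _ _).trans h)
  rw [hφ', tanhSq]
  field_simp
  ring

lemma raiseDegree_liftTanhSq (h0 : 0 < t) (h1 : t < 1) (hφ : HasDerivAt φ φ' (tanhSq t))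
    (h : tanhSq t * (1 - tanhSq t) * φ' = (-(1 / 4) - (m : ℝ)) * φ₁ (tanhSq t) +
      (1 / 4 + (m : ℝ) + (-(1 / 24) - (m : ℝ) / 2 - (n : ℝ) / 2) * tanhSq t) *
        φ (tanhSq t)) :
    raiseDegree n m t (deriv (liftTanhSq n m φ) t) (liftTanhSq n m φ t) =
      raiseDegreeFactor n m * liftTanhSq n (m + 1) φ₁ t := by
  rw [(hasDerivAt_liftTanhSq h0 hφ).deriv, liftTanhSq_shift_up (n := n) (m := m) n (m + 1) (by ring) h0,
    liftTanhSq, raiseDegree, raiseDegreeFactor]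
  generalize φ (tanhSq t) = f at *
  generalize φ₁ (tanhSq t) = f₁ at *
  generalize (4 * (1 + t ^ 3)) ^ (1 / 12 + (m : ℝ) + (n : ℝ)) = w
  have hp := (one_add_cube_pos h0).ne'
  have hm := (one_sub_cube_pos h1).ne'
  have ht := h0.ne'
  have h2 := mul_ne_zero (tanhSq_pos h0 h1).ne' (one_sub_tanhSq_ne h0)
  have hφ' := eq_div_of_mul_eq h2 ((mul_comm _ _).trans h)
  rw [hφ', one_sub_tanhSq h0, tanhSq]
  field_simp
  ring

lemma lowerDegree_liftTanhSq (h0 : 0 < t) (h1 : t < 1) (hφ : HasDerivAt φ φ' (tanhSq t))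
    (hm0 : (3 / 4 - (m : ℝ)) ≠ 0)
    (h : (3 / 4 - (m : ℝ)) * (tanhSq t * (1 - tanhSq t) * φ') =
      tanhSq t * ((-(1 / 24) - (m : ℝ) / 2 - (n : ℝ) / 2) * (3 / 4 - (m : ℝ)) * φ (tanhSq t) +
        (-(1 / 24) - (m : ℝ) / 2 - (n : ℝ) / 2) * (-(7 / 24) - ((n : ℝ) - m) / 2) *
          φ₁ (tanhSq t))) :
    lowerDegree n m t (deriv (liftTanhSq n m φ) t) (liftTanhSq n m φ t) =
      lowerDegreeFactor n m * liftTanhSq n (m - 1) φ₁ t := by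
  rw [(hasDerivAt_liftTanhSq h0 hφ).deriv, liftTanhSq_shift_down (n := n) (m := m) n (m - 1) (by ring) h0,
    liftTanhSq, lowerDegree, lowerDegreeFactor]
  generalize φ (tanhSq t) = f at *
  generalize φ₁ (tanhSq t) = f₁ at *
  generalize (4 * (1 + t ^ 3)) ^ (1 / 12 + (m : ℝ) + (n : ℝ)) = w
  have hp := (one_add_cube_pos h0).ne'
  have hm := (one_sub_cube_pos h1).ne'
  have ht := h0.ne'
  have h2 := mul_ne_zero (tanhSq_pos h0 h1).ne' (one_sub_tanhSq_ne h0)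
  generalize hM : (3 / 4 - (m : ℝ)) = M at *
  have hφ' := eq_div_of_mul_eq hm0 ((mul_comm _ _).trans h)
  have hφ'' := eq_div_of_mul_eq h2 ((mul_comm _ _).trans hφ')
  rw [hφ'', one_sub_tanhSq h0, tanhSq]
  field_simp
  ring
end TanhSq

/-- The argument `(1 - z)/2` of the series of the first Legendre functions: `z = coth ξ` if
`t = e^{-2ξ/3}`, and `z = tanh ξ` if `t = -e^{-2ξ/3}`. -/
noncomputable def legendreArg (t : ℝ) : ℝ := -t ^ 3 / (1 - t ^ 3)

section LegendreArg

variable {t : ℝ}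

lemma legendreArg_ne_zero (h1 : t < 1) (h0 : t ≠ 0) : legendreArg t ≠ 0 :=
  div_ne_zero (neg_ne_zero.2 (pow_ne_zero 3 h0)) (one_sub_cube_pos h1).ne'

lemma one_sub_legendreArg (h1 : t < 1) : 1 - legendreArg t = 1 / (1 - t ^ 3) := by
  have := (one_sub_cube_pos h1).ne'
  rw [legendreArg]; field_simp; ring

lemma one_sub_legendreArg_ne (h1 : t < 1) : 1 - legendreArg t ≠ 0 := by
  rw [one_sub_legendreArg h1]; exact one_div_ne_zero (one_sub_cube_pos h1).ne'

lemma hasDerivAt_legendreArg (h1 : t < 1) :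
    HasDerivAt legendreArg (-3 * t ^ 2 / (1 - t ^ 3) ^ 2) t := by
  have hp := (one_sub_cube_pos h1).ne'
  refine ((hasDerivAt_pow 3 t).neg.div ((hasDerivAt_pow 3 t).const_sub 1) hp).congr_deriv ?_
  simp
  field_simp
  ring

/-- A solution `φ` of the hypergeometric equation in `(1 - z)/2`, turned into a function of `t`. -/
noncomputable def liftLegendre (j m : ℤ) (φ : ℝ → ℝ) (t : ℝ) : ℝ :=
  t ^ j * (1 - t ^ 3) ^ ((m : ℝ) - 1 / 4) * φ (legendreArg t)

variable {j n m : ℤ} {φ φ₁ : ℝ → ℝ} {φ' : ℝ}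

lemma hasDerivAt_liftLegendre (h1 : t < 1) (h0 : t ≠ 0) (hφ : HasDerivAt φ φ' (legendreArg t)) :
    HasDerivAt (liftLegendre j m φ) (t ^ j * (1 - t ^ 3) ^ ((m : ℝ) - 1 / 4) *
      ((j / t - 3 * t ^ 2 * ((m : ℝ) - 1 / 4) / (1 - t ^ 3)) * φ (legendreArg t) +
        φ' * (-3 * t ^ 2 / (1 - t ^ 3) ^ 2))) t := by
  have hp := one_sub_cube_pos h1
  have h2 := ((hasDerivAt_pow 3 t).const_sub 1).rpow_const
    (p := (m : ℝ) - 1 / 4) (Or.inl hp.ne')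
  refine (((hasDerivAt_zpow j t (Or.inl h0)).mul h2).mul
    (hφ.comp t (hasDerivAt_legendreArg h1))).congr_deriv ?_
  rw [Real.rpow_sub_one hp.ne', zpow_sub_one₀ h0]
  simp only [Function.comp_apply, Pi.mul_apply]
  generalize φ (legendreArg t) = f
  generalize (1 - t ^ 3) ^ ((m : ℝ) - 1 / 4) = w
  have := hp.ne'
  field_simp
  push_cast
  ring

lemma liftLegendre_degree_add_one (h1 : t < 1) : liftLegendre j (m + 1) φ t =
    t ^ j * ((1 - t ^ 3) ^ ((m : ℝ) - 1 / 4) * (1 - t ^ 3)) * φ (legendreArg t) := by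
  rw [liftLegendre, ← Real.rpow_add_one (one_sub_cube_pos h1).ne']
  congr 3
  push_cast
  ring

lemma liftLegendre_degree_sub_one (h1 : t < 1) : liftLegendre j (m - 1) φ t =
    t ^ j * ((1 - t ^ 3) ^ ((m : ℝ) - 1 / 4) / (1 - t ^ 3)) * φ (legendreArg t) := by
  rw [liftLegendre, ← Real.rpow_sub_one (one_sub_cube_pos h1).ne']
  congr 3
  push_cast
  ring

lemma raiseDegree_liftLegendre {c : ℝ} (h1 : t < 1) (h0 : t ≠ 0)
    (hφ : HasDerivAt φ φ' (legendreArg t)) (hm : -(3 / 2) - 2 * (m : ℝ) ≠ 0)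
    (hj : (j : ℝ) = 1 / 2 + 3 * n / 2 + 3 / 2 * (c - 1))
    (h : (-(3 / 2) - 2 * (m : ℝ)) * (legendreArg t * (1 - legendreArg t) * φ') =
      (3 / 4 + m) * (1 / 4 - m - c) * (φ₁ (legendreArg t) - φ (legendreArg t)) +
        (3 / 4 + m) * (-(3 / 2) - 2 * (m : ℝ)) * legendreArg t * φ (legendreArg t)) :
    raiseDegree n m t (deriv (liftLegendre j m φ) t) (liftLegendre j m φ t) =
      3 / 2 * (c - 1 / 4 + m) * liftLegendre j (m + 1) φ₁ t := by
  rw [(hasDerivAt_liftLegendre h1 h0 hφ).deriv, liftLegendre_degree_add_one h1, liftLegendre,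
    raiseDegree, hj]
  have hs := (one_sub_cube_pos h1).ne'
  have h2 := mul_ne_zero (legendreArg_ne_zero h1 h0) (one_sub_legendreArg_ne h1)
  have h3 := eq_div_of_mul_eq h2 ((mul_comm _ _).trans (eq_div_of_mul_eq hm
    ((mul_comm _ _).trans h)))
  rw [h3, one_sub_legendreArg h1]
  generalize φ (legendreArg t) = f at *
  generalize φ₁ (legendreArg t) = f₁ at *
  generalize (1 - t ^ 3) ^ ((m : ℝ) - 1 / 4) = w
  generalize t ^ j = z
  obtain ⟨M, hM⟩ : ∃ M : ℝ, M = -(3 / 2) - 2 * (m : ℝ) := ⟨_, rfl⟩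
  have hM' : (m : ℝ) = -(M + 3 / 2) / 2 := by rw [hM]; ring
  rw [← hM] at hm ⊢
  rw [hM', legendreArg]
  field_simp
  ring

lemma lowerDegree_liftLegendre {c : ℝ} (h1 : t < 1) (h0 : t ≠ 0)
    (hφ : HasDerivAt φ φ' (legendreArg t)) (hm : -(1 / 2) + 2 * (m : ℝ) ≠ 0)
    (hj : (j : ℝ) = 1 / 2 + 3 * n / 2 + 3 / 2 * (c - 1))
    (h : (-(1 / 2) + 2 * (m : ℝ)) * (legendreArg t * (1 - legendreArg t) * φ') =
      (1 / 4 - m) * (3 / 4 + m - c) * (φ₁ (legendreArg t) - φ (legendreArg t)) +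
        (1 / 4 - m) * (-(1 / 2) + 2 * (m : ℝ)) * legendreArg t * φ (legendreArg t)) :
    lowerDegree n m t (deriv (liftLegendre j m φ) t) (liftLegendre j m φ t) =
      3 / 2 * (c - 3 / 4 - m) * liftLegendre j (m - 1) φ₁ t := by
  rw [(hasDerivAt_liftLegendre h1 h0 hφ).deriv, liftLegendre_degree_sub_one h1, liftLegendre,
    lowerDegree, hj]
  have hs := (one_sub_cube_pos h1).ne'
  have h2 := mul_ne_zero (legendreArg_ne_zero h1 h0) (one_sub_legendreArg_ne h1)
  have h3 := eq_div_of_mul_eq h2 ((mul_comm _ _).trans (eq_div_of_mul_eq hm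
    ((mul_comm _ _).trans h)))
  rw [h3, one_sub_legendreArg h1]
  generalize φ (legendreArg t) = f at *
  generalize φ₁ (legendreArg t) = f₁ at *
  generalize (1 - t ^ 3) ^ ((m : ℝ) - 1 / 4) = w
  generalize t ^ j = z
  obtain ⟨M, hM⟩ : ∃ M : ℝ, M = -(1 / 2) + 2 * (m : ℝ) := ⟨_, rfl⟩
  have hM' : (m : ℝ) = (M + 1 / 2) / 2 := by rw [hM]; ring
  rw [← hM] at hm ⊢
  rw [hM', legendreArg]
  field_simp
  ring

lemma raiseOrder_liftLegendre_bottom_add_one (h1 : t < 1) (h0 : t ≠ 0)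
    (hφ : HasDerivAt φ φ' (legendreArg t)) (hc : 4 / 3 + (n : ℝ) ≠ 0)
    (h : (4 / 3 + (n : ℝ)) * (legendreArg t * (1 - legendreArg t) * φ') =
      legendreArg t * ((7 / 12 + n - m) * (13 / 12 + n + m) * φ₁ (legendreArg t) -
        (4 / 3 + (n : ℝ)) * (1 / 3 + n) * φ (legendreArg t))) :
    raiseOrder n m t (deriv (liftLegendre (1 + 3 * n) m φ) t) (liftLegendre (1 + 3 * n) m φ t) =
      -3 * ((7 / 12 + n - m) * (13 / 12 + n + m)) / (4 / 3 + n) *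
        liftLegendre (1 + 3 * (n + 1)) m φ₁ t := by
  rw [(hasDerivAt_liftLegendre h1 h0 hφ).deriv, liftLegendre, liftLegendre, raiseOrder,
    show 1 + 3 * (n + 1) = 1 + 3 * n + 3 by ring, zpow_add₀ h0 (1 + 3 * n) 3,
    show t ^ (3 : ℤ) = t ^ 3 by norm_cast]
  have hs := (one_sub_cube_pos h1).ne'
  have h2 := mul_ne_zero (legendreArg_ne_zero h1 h0) (one_sub_legendreArg_ne h1)
  have h3 := eq_div_of_mul_eq h2 ((mul_comm _ _).trans (eq_div_of_mul_eq hc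
    ((mul_comm _ _).trans h)))
  rw [h3, one_sub_legendreArg h1]
  generalize φ (legendreArg t) = f at *
  generalize φ₁ (legendreArg t) = f₁ at *
  generalize (1 - t ^ 3) ^ ((m : ℝ) - 1 / 4) = w
  generalize t ^ (1 + 3 * n) = z
  obtain ⟨M, hM⟩ : ∃ M : ℝ, M = 4 / 3 + (n : ℝ) := ⟨_, rfl⟩
  have hM' : (n : ℝ) = M - 4 / 3 := by rw [hM]; ring
  push_cast
  rw [← hM] at hc ⊢
  rw [hM', legendreArg]
  field_simp
  ring

lemma lowerOrder_liftLegendre_bottom_sub_one (h1 : t < 1) (h0 : t ≠ 0)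
    (hφ : HasDerivAt φ φ' (legendreArg t))
    (h : legendreArg t * φ' = (1 / 3 + n) * (φ₁ (legendreArg t) - φ (legendreArg t))) :
    lowerOrder n m t (deriv (liftLegendre (1 + 3 * n) m φ) t) (liftLegendre (1 + 3 * n) m φ t) =
      3 * (1 / 3 + n) * liftLegendre (1 + 3 * (n - 1)) m φ₁ t := by
  rw [(hasDerivAt_liftLegendre h1 h0 hφ).deriv, liftLegendre, liftLegendre, lowerOrder,
    show 1 + 3 * (n - 1) = 1 + 3 * n - 3 by ring, zpow_sub₀ h0 (1 + 3 * n) 3,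
    show t ^ (3 : ℤ) = t ^ 3 by norm_cast]
  have hs := (one_sub_cube_pos h1).ne'
  have h3 := eq_div_of_mul_eq (legendreArg_ne_zero h1 h0) ((mul_comm _ _).trans h)
  rw [h3]
  generalize φ (legendreArg t) = f at *
  generalize φ₁ (legendreArg t) = f₁ at *
  generalize (1 - t ^ 3) ^ ((m : ℝ) - 1 / 4) = w
  generalize t ^ (1 + 3 * n) = z
  push_cast
  rw [legendreArg]
  field_simp
  ring

lemma raiseOrder_liftLegendre_bottom_sub_one (h1 : t < 1) (h0 : t ≠ 0)
    (hφ : HasDerivAt φ φ' (legendreArg t))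
    (h : legendreArg t * φ' = (-(1 / 3) - n) * (φ₁ (legendreArg t) - φ (legendreArg t))) :
    raiseOrder n m t (deriv (liftLegendre 0 m φ) t) (liftLegendre 0 m φ t) =
      -3 * (1 / 3 + n) * liftLegendre 0 m φ₁ t := by
  rw [(hasDerivAt_liftLegendre h1 h0 hφ).deriv, liftLegendre, liftLegendre, raiseOrder]
  have hs := (one_sub_cube_pos h1).ne'
  have h3 := eq_div_of_mul_eq (legendreArg_ne_zero h1 h0) ((mul_comm _ _).trans h)
  rw [h3]
  generalize φ (legendreArg t) = f at *
  generalize φ₁ (legendreArg t) = f₁ at *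
  generalize (1 - t ^ 3) ^ ((m : ℝ) - 1 / 4) = w
  rw [legendreArg]
  push_cast
  field_simp
  ring

lemma lowerOrder_liftLegendre_bottom_add_one (h1 : t < 1) (h0 : t ≠ 0)
    (hφ : HasDerivAt φ φ' (legendreArg t)) (hc : 2 / 3 - (n : ℝ) ≠ 0)
    (h : (2 / 3 - (n : ℝ)) * (legendreArg t * (1 - legendreArg t) * φ') =
      legendreArg t * ((-(1 / 12) - n - m) * (5 / 12 - n + m) * φ₁ (legendreArg t) +
        (2 / 3 - (n : ℝ)) * (1 / 3 + n) * φ (legendreArg t))) :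
    lowerOrder n m t (deriv (liftLegendre 0 m φ) t) (liftLegendre 0 m φ t) =
      3 * ((1 / 12 + n + m) * (5 / 12 - n + m)) / (2 / 3 - n) * liftLegendre 0 m φ₁ t := by
  rw [(hasDerivAt_liftLegendre h1 h0 hφ).deriv, liftLegendre, liftLegendre, lowerOrder]
  have hs := (one_sub_cube_pos h1).ne'
  have h2 := mul_ne_zero (legendreArg_ne_zero h1 h0) (one_sub_legendreArg_ne h1)
  have h3 := eq_div_of_mul_eq h2 ((mul_comm _ _).trans (eq_div_of_mul_eq hc
    ((mul_comm _ _).trans h)))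
  rw [h3, one_sub_legendreArg h1]
  generalize φ (legendreArg t) = f at *
  generalize φ₁ (legendreArg t) = f₁ at *
  generalize (1 - t ^ 3) ^ ((m : ℝ) - 1 / 4) = w
  obtain ⟨M, hM⟩ : ∃ M : ℝ, M = 2 / 3 - (n : ℝ) := ⟨_, rfl⟩
  have hM' : (n : ℝ) = 2 / 3 - M := by rw [hM]; ring
  rw [← hM] at hc ⊢
  rw [hM', legendreArg]
  push_cast
  field_simp
  ring

end LegendreArg

/-! ### The four families -/

section Parameters

variable (n m : ℤ)

lemma notInt_a : NotInt (-(1 / 24) - (m : ℝ) / 2 - (n : ℝ) / 2) :=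
  notInt_of_mul_eq 24 (-1 - 12 * m - 12 * n) (by push_cast; ring) (by omega)

lemma notInt_b : NotInt (11 / 24 - (m : ℝ) / 2 - (n : ℝ) / 2) :=
  notInt_of_mul_eq 24 (11 - 12 * m - 12 * n) (by push_cast; ring) (by omega)

lemma notInt_c : NotInt (3 / 4 - (m : ℝ)) :=
  notInt_of_mul_eq 4 (3 - 4 * m) (by push_cast; ring) (by omega)

lemma notInt_a' : NotInt (5 / 24 + (m : ℝ) / 2 - (n : ℝ) / 2) :=
  notInt_of_mul_eq 24 (5 + 12 * m - 12 * n) (by push_cast; ring) (by omega)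

lemma notInt_b' : NotInt (17 / 24 + (m : ℝ) / 2 - (n : ℝ) / 2) :=
  notInt_of_mul_eq 24 (17 + 12 * m - 12 * n) (by push_cast; ring) (by omega)

lemma notInt_c' : NotInt (5 / 4 + (m : ℝ)) :=
  notInt_of_mul_eq 4 (5 + 4 * m) (by push_cast; ring) (by omega)

lemma notInt_legendre : NotInt (3 / 4 + (m : ℝ)) :=
  notInt_of_mul_eq 4 (3 + 4 * m) (by push_cast; ring) (by omega)

lemma notInt_legendre' : NotInt (1 / 4 - (m : ℝ)) :=
  notInt_of_mul_eq 4 (1 - 4 * m) (by push_cast; ring) (by omega)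

lemma notInt_neg_order : NotInt (4 / 3 + (n : ℝ)) :=
  notInt_of_mul_eq 3 (4 + 3 * n) (by push_cast; ring) (by omega)

lemma notInt_pos_order : NotInt (2 / 3 - (n : ℝ)) :=
  notInt_of_mul_eq 3 (2 - 3 * n) (by push_cast; ring) (by omega)

end Parameters

/-- The function proportional to `Q̂_{-3/4-m}^{-1/3-n}(coth ξ)`. -/
noncomputable def familyQ (n m : ℤ) : ℝ → ℝ :=
  liftTanhSq n m (₂F₁ (-(1 / 24) - (m : ℝ) / 2 - (n : ℝ) / 2) (11 / 24 - (m : ℝ) / 2 - (n : ℝ) / 2)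
    (3 / 4 - (m : ℝ)))

/-- The normalizing constant of `familyQ'`. -/
noncomputable def constQ' (n m : ℤ) : ℝ :=
  (108 : ℝ) ^ (-(1 / 4) : ℝ) * (-1 : ℝ) ^ n * ((2 : ℝ) ^ (-2 * m)) *
    risingFactorial (5 / 12) (m - n) * risingFactorial (13 / 12) (m + n) /
      (risingFactorial (5 / 4) m * risingFactorial (1 / 4) m)

/-- The function proportional to `Q̂_{-1/4+m}^{-1/3-n}(coth ξ)`. -/
noncomputable def familyQ' (n m : ℤ) : ℝ → ℝ :=
  liftTanhSq n m fun x => constQ' n m * (x ^ (1 / 4 + (m : ℝ)) *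
    ₂F₁ (5 / 24 + (m : ℝ) / 2 - (n : ℝ) / 2) (17 / 24 + (m : ℝ) / 2 - (n : ℝ) / 2)
      (5 / 4 + (m : ℝ)) x)

/-- The normalizing constant of `familyP`. -/
noncomputable def constP (n m : ℤ) : ℝ :=
  (3 : ℝ) ^ (3 / 8 : ℝ) * ((2 : ℝ) ^ (-1 + m + 3 * n)) * risingFactorial (13 / 12) (m + n) /
    (risingFactorial (1 / 4) m * risingFactorial (4 / 3) n)

/-- The function proportional to `P_{-3/4-m}^{-1/3-n}(z)` at `z = coth ξ` or `z = tanh ξ`. -/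
noncomputable def familyP (n m : ℤ) (t : ℝ) : ℝ :=
  constP n m *
    liftLegendre (1 + 3 * n) m (₂F₁ (3 / 4 + (m : ℝ)) (1 / 4 - (m : ℝ)) (4 / 3 + (n : ℝ))) t

/-- The normalizing constant of `familyP'`. -/
noncomputable def constP' (n m : ℤ) : ℝ :=
  (3 : ℝ) ^ (3 / 8 : ℝ) * Real.sqrt 2 * ((2 : ℝ) ^ (m + 3 * n)) *
    risingFactorial (5 / 12) (m - n) /
      (risingFactorial (1 / 4) m * risingFactorial (2 / 3) (-n))

/-- The function proportional to `P_{-3/4-m}^{1/3+n}(z)` at `z = coth ξ` or `z = tanh ξ`. -/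
noncomputable def familyP' (n m : ℤ) (t : ℝ) : ℝ :=
  constP' n m *
    liftLegendre 0 m (₂F₁ (3 / 4 + (m : ℝ)) (1 / 4 - (m : ℝ)) (2 / 3 - (n : ℝ))) t

/-- The set of parameters `t` at which the series of `familyP` converges. -/
def seriesDomain : Set ℝ := {t | t < 1 ∧ t ≠ 0 ∧ |legendreArg t| < 1}

section FamilyQ

variable {n m : ℤ} {t : ℝ}

lemma isLadder_familyQ : IsLadder familyQ (Set.Ioo 0 1) := by
  have hd : ∀ n m : ℤ, ∀ t ∈ Set.Ioo (0 : ℝ) 1, HasDerivAt _ _ (tanhSq t) := fun n m t ht =>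
    hasDerivAt_hypergeometric (notInt_a n m) (notInt_b n m) (notInt_c m)
      (abs_tanhSq_lt_one ht.1 ht.2)
  constructor
  · exact fun n m t ht => (hasDerivAt_liftTanhSq ht.1 (hd n m t ht)).differentiableAt
  · intro n m t ht
    have h := contiguous_sub_right (notInt_a n m) (notInt_b n m) (notInt_c m)
      (abs_tanhSq_lt_one ht.1 ht.2)
    refine raiseOrder_liftTanhSq ht.1 ht.2 (hd n m t ht) (h.trans ?_)
    rw [hypergeometric_symm _ (_ - 1)]
    push_cast
    ring_nf
  · intro n m t ht
    have h := contiguous_add_left (notInt_a n m) (notInt_b n m) (notInt_c m)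
      (abs_tanhSq_lt_one ht.1 ht.2)
    refine lowerOrder_liftTanhSq ht.1 ht.2 (hd n m t ht) (h.trans ?_)
    rw [hypergeometric_symm (_ + 1)]
    push_cast
    ring_nf
  · intro n m t ht
    have h := contiguous_sub_right_sub_bottom (notInt_a n m) (notInt_b n m) (notInt_c m)
      (abs_tanhSq_lt_one ht.1 ht.2)
    refine raiseDegree_liftTanhSq ht.1 ht.2 (hd n m t ht) (h.trans ?_)
    rw [hypergeometric_symm _ (_ - 1)]
    push_cast
    ring_nf
  · intro n m t ht
    have h := contiguous_add_left_add_bottom (notInt_a n m) (notInt_b n m) (notInt_c m)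
      (abs_tanhSq_lt_one ht.1 ht.2)
    refine lowerDegree_liftTanhSq ht.1 ht.2 (hd n m t ht) (notInt_c m).ne_zero (h.trans ?_)
    rw [hypergeometric_symm (_ + 1)]
    push_cast
    ring_nf

end FamilyQ

section FamilyQ'

variable (n m : ℤ)

lemma notInt_quarter : NotInt (1 / 4) := notInt_of_mul_eq 4 1 (by norm_num) (by norm_num)
lemma notInt_five_quarters : NotInt (5 / 4) := notInt_of_mul_eq 4 5 (by norm_num) (by norm_num)
lemma notInt_five_twelfths : NotInt (5 / 12) := notInt_of_mul_eq 12 5 (by norm_num) (by norm_num)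
lemma notInt_thirteen_twelfths : NotInt (13 / 12) :=
  notInt_of_mul_eq 12 13 (by norm_num) (by norm_num)
lemma notInt_two_thirds : NotInt (2 / 3) := notInt_of_mul_eq 3 2 (by norm_num) (by norm_num)
lemma notInt_four_thirds : NotInt (4 / 3) := notInt_of_mul_eq 3 4 (by norm_num) (by norm_num)

lemma NotInt.add_int_ne {d : ℝ} (hd : NotInt d) (k : ℤ) : d + k ≠ 0 := (hd.add_int k).ne_zero

lemma risingFactorial_sub_one {d : ℝ} (hd : NotInt d) (k : ℤ) :
    risingFactorial d (k - 1) = risingFactorial d k / (d + ((k - 1 : ℤ) : ℝ)) := by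
  have h := risingFactorial_add_one hd (k - 1)
  rw [sub_add_cancel] at h
  rw [h, mul_div_cancel_right₀ _ (hd.add_int_ne _)]

lemma constQ'_add_one_order :
    constQ' (n + 1) m * (7 / 24 + ((n : ℝ) - m) / 2) =
      constQ' n m * (13 / 24 + ((m : ℝ) + n) / 2) := by
  have h2 := notInt_five_twelfths.add_int_ne (m - n - 1)
  rw [constQ', constQ', show m - (n + 1) = m - n - 1 by ring,
    show m + (n + 1) = m + n + 1 by ring, risingFactorial_add_one notInt_thirteen_twelfths,
    risingFactorial_sub_one notInt_five_twelfths, zpow_add_one₀ (by norm_num)]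
  obtain ⟨M, hM⟩ : ∃ M : ℝ, M = 5 / 12 + ((m - n - 1 : ℤ) : ℝ) := ⟨_, rfl⟩
  rw [← hM] at h2 ⊢
  have hM' : (7 / 24 + ((n : ℝ) - m) / 2) = -M / 2 := by rw [hM]; push_cast; ring
  rw [hM']
  push_cast
  field_simp
  ring

lemma constQ'_sub_one_order :
    constQ' (n - 1) m * (-(1 / 24) - (m : ℝ) / 2 - (n : ℝ) / 2) =
      constQ' n m * (5 / 24 + (m : ℝ) / 2 - (n : ℝ) / 2) := by
  have h := constQ'_add_one_order (n - 1) m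
  rw [sub_add_cancel] at h
  push_cast at h
  linear_combination h

lemma constQ'_add_one_degree :
    constQ' n (m + 1) * (-(1 / 4) - (m : ℝ)) * (5 / 4 + (m : ℝ)) =
      constQ' n m * ((5 / 24 + (m : ℝ) / 2 - (n : ℝ) / 2) *
        (-(13 / 24) - (m : ℝ) / 2 - (n : ℝ) / 2)) := by
  have h2 := notInt_quarter.add_int_ne m
  have h3 := notInt_five_quarters.add_int_ne m
  rw [constQ', constQ', show m + 1 - n = m - n + 1 by ring,
    show m + 1 + n = m + n + 1 by ring, risingFactorial_add_one notInt_thirteen_twelfths,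
    risingFactorial_add_one notInt_five_twelfths, risingFactorial_add_one notInt_quarter,
    risingFactorial_add_one notInt_five_quarters, show -2 * (m + 1) = -2 * m - 2 by ring,
    zpow_sub₀ (by norm_num)]
  obtain ⟨M, hM⟩ : ∃ M : ℝ, M = 1 / 4 + (m : ℝ) := ⟨_, rfl⟩
  have hM' : (m : ℝ) = M - 1 / 4 := by rw [hM]; ring
  have h4 : M + 1 ≠ 0 := by rw [hM]; convert h3 using 1; ring
  rw [← hM] at h2 ⊢
  push_cast
  rw [hM', show 5 / 4 + (M - 1 / 4) = M + 1 by ring, show -(1 / 4) - (M - 1 / 4) = -M by ring]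
  have h5 := risingFactorial_ne_zero notInt_quarter m
  have h6 := risingFactorial_ne_zero notInt_five_quarters m
  field_simp
  ring

lemma constQ'_sub_one_degree :
    constQ' n (m - 1) * ((-(1 / 24) - (m : ℝ) / 2 - (n : ℝ) / 2) *
        (-(7 / 24) - ((n : ℝ) - m) / 2)) =
      constQ' n m * ((3 / 4 - (m : ℝ)) * (1 / 4 + (m : ℝ))) := by
  have h := constQ'_add_one_degree n (m - 1)
  rw [sub_add_cancel] at h
  push_cast at h
  linear_combination -h

variable {n m}

lemma rpow_quarter_add_one {x : ℝ} (hx : 0 < x) :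
    x ^ (1 / 4 + ((m + 1 : ℤ) : ℝ)) = x ^ (1 / 4 + (m : ℝ)) * x := by
  rw [← Real.rpow_add_one hx.ne']; congr 1; push_cast; ring

lemma rpow_quarter_sub_one {x : ℝ} (hx : 0 < x) :
    x ^ (1 / 4 + ((m - 1 : ℤ) : ℝ)) = x ^ (1 / 4 + (m : ℝ)) / x := by
  rw [← Real.rpow_sub_one hx.ne']; congr 1; push_cast; ring

lemma hasDerivAt_familyQ'_aux (k s : ℝ) {G : ℝ → ℝ} {G' x : ℝ} (hx : 0 < x)
    (hG : HasDerivAt G G' x) :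
    HasDerivAt (fun x => k * (x ^ s * G x)) (k * (x ^ s * (s * G x / x + G'))) x := by
  refine (((Real.hasDerivAt_rpow_const (p := s) (Or.inl hx.ne')).mul hG).const_mul k).congr_deriv ?_
  rw [Real.rpow_sub_one hx.ne']
  field_simp

lemma mul_familyQ'_aux {x : ℝ} (k w s G G' : ℝ) (hx : 0 < x) :
    x * (k * (w * (s * G / x + G'))) = k * w * (s * G + x * G') := by
  field_simp

lemma isLadder_familyQ' : IsLadder familyQ' (Set.Ioo 0 1) := by
  have hd : ∀ n m : ℤ, ∀ t ∈ Set.Ioo (0 : ℝ) 1, HasDerivAt _ _ (tanhSq t) := fun n m t ht =>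
    hasDerivAt_familyQ'_aux (constQ' n m) (1 / 4 + (m : ℝ)) (tanhSq_pos ht.1 ht.2)
    (hasDerivAt_hypergeometric (notInt_a' n m) (notInt_b' n m) (notInt_c' m)
      (abs_tanhSq_lt_one ht.1 ht.2))
  constructor
  · exact fun n m t ht => (hasDerivAt_liftTanhSq ht.1 (hd n m t ht)).differentiableAt
  · intro n m t ht
    have h := contiguous_sub_right (notInt_a' n m) (notInt_b' n m) (notInt_c' m)
      (abs_tanhSq_lt_one ht.1 ht.2)
    refine raiseOrder_liftTanhSq ht.1 ht.2 (hd n m t ht) ?_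
    have hk := constQ'_add_one_order n m
    rw [hypergeometric_symm _ (_ - 1)] at h
    rw [show (5 / 24 + (m : ℝ) / 2 - ((n + 1 : ℤ) : ℝ) / 2) = 17 / 24 + (m : ℝ) / 2 - (n : ℝ) / 2 - 1
        by push_cast; ring,
      show (17 / 24 + (m : ℝ) / 2 - ((n + 1 : ℤ) : ℝ) / 2) = 5 / 24 + (m : ℝ) / 2 - (n : ℝ) / 2
        by push_cast; ring]
    have hm := mul_familyQ'_aux (constQ' n m) (tanhSq t ^ (1 / 4 + (m : ℝ))) (1 / 4 + (m : ℝ))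
      (₂F₁ (5 / 24 + (m : ℝ) / 2 - (n : ℝ) / 2) (17 / 24 + (m : ℝ) / 2 - (n : ℝ) / 2)
        (5 / 4 + (m : ℝ)) (tanhSq t)) (deriv (₂F₁ (5 / 24 + (m : ℝ) / 2 - (n : ℝ) / 2)
        (17 / 24 + (m : ℝ) / 2 - (n : ℝ) / 2) (5 / 4 + (m : ℝ))) (tanhSq t))
      (tanhSq_pos ht.1 ht.2)
    linear_combination (1 - tanhSq t) * hm +
      constQ' n m * tanhSq t ^ (1 / 4 + (m : ℝ)) * h - tanhSq t ^ (1 / 4 + (m : ℝ)) *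
      ₂F₁ (17 / 24 + (m : ℝ) / 2 - (n : ℝ) / 2 - 1) (5 / 24 + (m : ℝ) / 2 - (n : ℝ) / 2)
        (5 / 4 + (m : ℝ)) (tanhSq t) * hk
  · intro n m t ht
    have h := contiguous_add_left (notInt_a' n m) (notInt_b' n m) (notInt_c' m)
      (abs_tanhSq_lt_one ht.1 ht.2)
    refine lowerOrder_liftTanhSq ht.1 ht.2 (hd n m t ht) ?_
    have hk := constQ'_sub_one_order n m
    rw [hypergeometric_symm (_ + 1)] at h
    rw [show (5 / 24 + (m : ℝ) / 2 - ((n - 1 : ℤ) : ℝ) / 2) = 17 / 24 + (m : ℝ) / 2 - (n : ℝ) / 2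
        by push_cast; ring,
      show (17 / 24 + (m : ℝ) / 2 - ((n - 1 : ℤ) : ℝ) / 2) = 5 / 24 + (m : ℝ) / 2 - (n : ℝ) / 2 + 1
        by push_cast; ring]
    have hm := mul_familyQ'_aux (constQ' n m) (tanhSq t ^ (1 / 4 + (m : ℝ))) (1 / 4 + (m : ℝ))
      (₂F₁ (5 / 24 + (m : ℝ) / 2 - (n : ℝ) / 2) (17 / 24 + (m : ℝ) / 2 - (n : ℝ) / 2)
        (5 / 4 + (m : ℝ)) (tanhSq t)) (deriv (₂F₁ (5 / 24 + (m : ℝ) / 2 - (n : ℝ) / 2)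
        (17 / 24 + (m : ℝ) / 2 - (n : ℝ) / 2) (5 / 4 + (m : ℝ))) (tanhSq t))
      (tanhSq_pos ht.1 ht.2)
    linear_combination hm +
      constQ' n m * tanhSq t ^ (1 / 4 + (m : ℝ)) * h - tanhSq t ^ (1 / 4 + (m : ℝ)) *
      ₂F₁ (17 / 24 + (m : ℝ) / 2 - (n : ℝ) / 2) (5 / 24 + (m : ℝ) / 2 - (n : ℝ) / 2 + 1)
        (5 / 4 + (m : ℝ)) (tanhSq t) * hk
  · intro n m t ht
    have h := contiguous_add_left_add_bottom (notInt_a' n m) (notInt_b' n m) (notInt_c' m)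
      (abs_tanhSq_lt_one ht.1 ht.2)
    refine raiseDegree_liftTanhSq ht.1 ht.2 (hd n m t ht) ?_
    have hk := constQ'_add_one_degree n m
    rw [hypergeometric_symm (_ + 1)] at h
    rw [show (5 / 24 + ((m + 1 : ℤ) : ℝ) / 2 - (n : ℝ) / 2) = 17 / 24 + (m : ℝ) / 2 - (n : ℝ) / 2
        by push_cast; ring,
      show (17 / 24 + ((m + 1 : ℤ) : ℝ) / 2 - (n : ℝ) / 2) = 5 / 24 + (m : ℝ) / 2 - (n : ℝ) / 2 + 1
        by push_cast; ring,
      show (5 / 4 + ((m + 1 : ℤ) : ℝ)) = 5 / 4 + (m : ℝ) + 1 by push_cast; ring,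
      rpow_quarter_add_one (tanhSq_pos ht.1 ht.2)]
    have hm := mul_familyQ'_aux (constQ' n m) (tanhSq t ^ (1 / 4 + (m : ℝ))) (1 / 4 + (m : ℝ))
      (₂F₁ (5 / 24 + (m : ℝ) / 2 - (n : ℝ) / 2) (17 / 24 + (m : ℝ) / 2 - (n : ℝ) / 2)
        (5 / 4 + (m : ℝ)) (tanhSq t)) (deriv (₂F₁ (5 / 24 + (m : ℝ) / 2 - (n : ℝ) / 2)
        (17 / 24 + (m : ℝ) / 2 - (n : ℝ) / 2) (5 / 4 + (m : ℝ))) (tanhSq t))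
      (tanhSq_pos ht.1 ht.2)
    apply mul_left_cancel₀ (notInt_c' m).ne_zero
    linear_combination (5 / 4 + (m : ℝ)) * (1 - tanhSq t) * hm +
      constQ' n m * tanhSq t ^ (1 / 4 + (m : ℝ)) * h - tanhSq t ^ (1 / 4 + (m : ℝ)) * tanhSq t *
      ₂F₁ (17 / 24 + (m : ℝ) / 2 - (n : ℝ) / 2) (5 / 24 + (m : ℝ) / 2 - (n : ℝ) / 2 + 1)
        (5 / 4 + (m : ℝ) + 1) (tanhSq t) * hk
  · intro n m t ht
    have h := contiguous_sub_right_sub_bottom (notInt_a' n m) (notInt_b' n m) (notInt_c' m)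
      (abs_tanhSq_lt_one ht.1 ht.2)
    refine lowerDegree_liftTanhSq ht.1 ht.2 (hd n m t ht) (notInt_c m).ne_zero ?_
    have hk := constQ'_sub_one_degree n m
    have hx := (tanhSq_pos ht.1 ht.2).ne'
    rw [hypergeometric_symm _ (_ - 1)] at h
    rw [show (5 / 24 + ((m - 1 : ℤ) : ℝ) / 2 - (n : ℝ) / 2) = 17 / 24 + (m : ℝ) / 2 - (n : ℝ) / 2 - 1
        by push_cast; ring,
      show (17 / 24 + ((m - 1 : ℤ) : ℝ) / 2 - (n : ℝ) / 2) = 5 / 24 + (m : ℝ) / 2 - (n : ℝ) / 2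
        by push_cast; ring,
      show (5 / 4 + ((m - 1 : ℤ) : ℝ)) = 5 / 4 + (m : ℝ) - 1 by push_cast; ring,
      rpow_quarter_sub_one (tanhSq_pos ht.1 ht.2)]
    have hm := mul_familyQ'_aux (constQ' n m) (tanhSq t ^ (1 / 4 + (m : ℝ))) (1 / 4 + (m : ℝ))
      (₂F₁ (5 / 24 + (m : ℝ) / 2 - (n : ℝ) / 2) (17 / 24 + (m : ℝ) / 2 - (n : ℝ) / 2)
        (5 / 4 + (m : ℝ)) (tanhSq t)) (deriv (₂F₁ (5 / 24 + (m : ℝ) / 2 - (n : ℝ) / 2)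
        (17 / 24 + (m : ℝ) / 2 - (n : ℝ) / 2) (5 / 4 + (m : ℝ))) (tanhSq t))
      (tanhSq_pos ht.1 ht.2)
    have hd' : tanhSq t * (tanhSq t ^ (1 / 4 + (m : ℝ)) / tanhSq t) =
        tanhSq t ^ (1 / 4 + (m : ℝ)) := mul_div_cancel₀ _ hx
    linear_combination (3 / 4 - (m : ℝ)) * (1 - tanhSq t) * hm +
      (3 / 4 - (m : ℝ)) * constQ' n m * tanhSq t ^ (1 / 4 + (m : ℝ)) * h -
      tanhSq t ^ (1 / 4 + (m : ℝ)) *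
      ₂F₁ (17 / 24 + (m : ℝ) / 2 - (n : ℝ) / 2 - 1) (5 / 24 + (m : ℝ) / 2 - (n : ℝ) / 2)
        (5 / 4 + (m : ℝ) - 1) (tanhSq t) * hk -
      constQ' n (m - 1) * ((-(1 / 24) - (m : ℝ) / 2 - (n : ℝ) / 2) *
        (-(7 / 24) - ((n : ℝ) - m) / 2)) *
      ₂F₁ (17 / 24 + (m : ℝ) / 2 - (n : ℝ) / 2 - 1) (5 / 24 + (m : ℝ) / 2 - (n : ℝ) / 2)
        (5 / 4 + (m : ℝ) - 1) (tanhSq t) * hd'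

end FamilyQ'

section FamilyP

variable (n m : ℤ)

lemma constP_add_one_order : constP (n + 1) m * (4 / 3 + n) = constP n m * (8 * (13 / 12 + m + n)) := by
  have h := notInt_four_thirds.add_int_ne n
  have h5 := risingFactorial_ne_zero notInt_quarter m
  have h6 := risingFactorial_ne_zero notInt_four_thirds n
  rw [constP, constP, show m + (n + 1) = m + n + 1 by ring,
    show -1 + m + 3 * (n + 1) = -1 + m + 3 * n + 3 by ring, zpow_add₀ (by norm_num) _ 3,
    risingFactorial_add_one notInt_thirteen_twelfths, risingFactorial_add_one notInt_four_thirds]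
  obtain ⟨M, hM⟩ : ∃ M : ℝ, M = 4 / 3 + (n : ℝ) := ⟨_, rfl⟩
  rw [← hM] at h ⊢
  push_cast
  field_simp
  ring

lemma constP_add_one_degree :
    constP n (m + 1) * (1 / 4 + m) = constP n m * (2 * (13 / 12 + m + n)) := by
  have h := notInt_quarter.add_int_ne m
  have h5 := risingFactorial_ne_zero notInt_quarter m
  have h6 := risingFactorial_ne_zero notInt_four_thirds n
  rw [constP, constP, show m + 1 + n = m + n + 1 by ring,
    show -1 + (m + 1) + 3 * n = -1 + m + 3 * n + 1 by ring, zpow_add_one₀ (by norm_num),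
    risingFactorial_add_one notInt_thirteen_twelfths, risingFactorial_add_one notInt_quarter]
  obtain ⟨M, hM⟩ : ∃ M : ℝ, M = 1 / 4 + (m : ℝ) := ⟨_, rfl⟩
  rw [← hM] at h ⊢
  push_cast
  field_simp
  try ring

lemma constP'_add_one_order :
    constP' (n + 1) m * (7 / 12 + n - m) = constP' n m * (8 * (1 / 3 + n)) := by
  have h := notInt_five_twelfths.add_int_ne (m - n - 1)
  have h' := notInt_two_thirds.add_int_ne (-n - 1)
  have h5 := risingFactorial_ne_zero notInt_quarter m
  have h6 := risingFactorial_ne_zero notInt_two_thirds (-n)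
  rw [constP', constP', show m - (n + 1) = m - n - 1 by ring, show -(n + 1) = -n - 1 by ring,
    show m + 3 * (n + 1) = m + 3 * n + 3 by ring, zpow_add₀ (by norm_num) _ 3,
    risingFactorial_sub_one notInt_five_twelfths, risingFactorial_sub_one notInt_two_thirds]
  obtain ⟨M, hM⟩ : ∃ M : ℝ, M = 5 / 12 + ((m - n - 1 : ℤ) : ℝ) := ⟨_, rfl⟩
  obtain ⟨N, hN⟩ : ∃ N : ℝ, N = 2 / 3 + ((-n - 1 : ℤ) : ℝ) := ⟨_, rfl⟩
  have hM' : (7 / 12 + n - m : ℝ) = -M := by rw [hM]; push_cast; ring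
  have hN' : (1 / 3 + n : ℝ) = -N := by rw [hN]; push_cast; ring
  rw [← hM, ← hN, hM', hN']
  rw [← hM] at h
  rw [← hN] at h'
  field_simp
  norm_num

lemma constP'_add_one_degree :
    constP' n (m + 1) * (1 / 4 + m) = constP' n m * (2 * (5 / 12 + m - n)) := by
  have h := notInt_quarter.add_int_ne m
  have h5 := risingFactorial_ne_zero notInt_quarter m
  have h6 := risingFactorial_ne_zero notInt_two_thirds (-n)
  rw [constP', constP', show m + 1 - n = m - n + 1 by ring,
    show m + 1 + 3 * n = m + 3 * n + 1 by ring, zpow_add_one₀ (by norm_num),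
    risingFactorial_add_one notInt_five_twelfths, risingFactorial_add_one notInt_quarter]
  obtain ⟨M, hM⟩ : ∃ M : ℝ, M = 1 / 4 + (m : ℝ) := ⟨_, rfl⟩
  rw [← hM] at h ⊢
  push_cast
  field_simp
  try ring

variable {n m}

lemma raiseOrder_const_mul (k t D E : ℝ) :
    raiseOrder n m t (k * D) (k * E) = k * raiseOrder n m t D E := by
  simp only [raiseOrder]; ring

lemma lowerOrder_const_mul (k t D E : ℝ) :
    lowerOrder n m t (k * D) (k * E) = k * lowerOrder n m t D E := by
  simp only [lowerOrder]; ring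

lemma raiseDegree_const_mul (k t D E : ℝ) :
    raiseDegree n m t (k * D) (k * E) = k * raiseDegree n m t D E := by
  simp only [raiseDegree]; ring

lemma lowerDegree_const_mul (k t D E : ℝ) :
    lowerDegree n m t (k * D) (k * E) = k * lowerDegree n m t D E := by
  simp only [lowerDegree]; ring

lemma isLadder_familyP : IsLadder familyP seriesDomain := by
  have hF : ∀ n m : ℤ, ∀ t ∈ seriesDomain, HasDerivAt _ _ (legendreArg t) := fun n m t ht =>
    hasDerivAt_hypergeometric (notInt_legendre m) (notInt_legendre' m) (notInt_neg_order n) ht.2.2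
  have hd : ∀ n m : ℤ, ∀ t ∈ seriesDomain, HasDerivAt (familyP n m) _ t := fun n m t ht =>
    ((hasDerivAt_liftLegendre (j := 1 + 3 * n) (m := m) ht.1 ht.2.1
      (hF n m t ht)).differentiableAt.hasDerivAt.const_mul (constP n m))
  constructor
  · exact fun n m t ht => (hd n m t ht).differentiableAt
  · intro n m t ht
    rw [(hd n m t ht).deriv, familyP, raiseOrder_const_mul]
    have h := contiguous_add_bottom (notInt_legendre m) (notInt_legendre' m) (notInt_neg_order n)
      ht.2.2
    rw [raiseOrder_liftLegendre_bottom_add_one ht.1 ht.2.1 (hF n m t ht)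
      (notInt_neg_order n).ne_zero (φ₁ := ₂F₁ (3 / 4 + (m : ℝ)) (1 / 4 - (m : ℝ)) (4 / 3 + n + 1))
      (h.trans (by ring)), familyP,
      show (4 / 3 + ((n + 1 : ℤ) : ℝ)) = 4 / 3 + n + 1 by push_cast; ring, raiseOrderFactor]
    have hk := constP_add_one_order n m
    have h0 := (notInt_neg_order n).ne_zero
    generalize liftLegendre _ _ _ t = L
    rw [eq_div_of_mul_eq h0 hk]
    generalize constP n m = K
    field_simp
    ring
  · intro n m t ht
    rw [(hd n m t ht).deriv, familyP, lowerOrder_const_mul]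
    have h := contiguous_sub_bottom (notInt_legendre m) (notInt_legendre' m) (notInt_neg_order n)
      ht.2.2
    rw [lowerOrder_liftLegendre_bottom_sub_one ht.1 ht.2.1 (hF n m t ht)
      (φ₁ := ₂F₁ (3 / 4 + (m : ℝ)) (1 / 4 - (m : ℝ)) (4 / 3 + n - 1))
      (h.trans (by ring)), familyP,
      show (4 / 3 + ((n - 1 : ℤ) : ℝ)) = 4 / 3 + n - 1 by push_cast; ring, lowerOrderFactor]
    have hk := constP_add_one_order (n - 1) m
    rw [sub_add_cancel] at hk
    push_cast at hk
    generalize liftLegendre _ _ _ t = L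
    linear_combination 3 * L * hk
  · intro n m t ht
    rw [(hd n m t ht).deriv, familyP, raiseDegree_const_mul]
    have h := contiguous_add_left_sub_right (notInt_legendre m) (notInt_legendre' m)
      (notInt_neg_order n) ht.2.2
    rw [raiseDegree_liftLegendre ht.1 ht.2.1 (hF n m t ht)
      (φ₁ := ₂F₁ (3 / 4 + (m : ℝ) + 1) (1 / 4 - (m : ℝ) - 1) (4 / 3 + n)) (c := 4 / 3 + n)
      (fun h0 => notInt_legendre m 0 (by push_cast; linarith)) (by push_cast; ring)
      ((by ring : _ = _).trans (h.trans (by ring))), familyP,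
      show (3 / 4 + ((m + 1 : ℤ) : ℝ)) = 3 / 4 + m + 1 by push_cast; ring,
      show (1 / 4 - ((m + 1 : ℤ) : ℝ)) = 1 / 4 - m - 1 by push_cast; ring, raiseDegreeFactor]
    have hk := constP_add_one_degree n m
    generalize liftLegendre _ _ _ t = L
    linear_combination (-3 / 4) * L * hk
  · intro n m t ht
    rw [(hd n m t ht).deriv, familyP, lowerDegree_const_mul]
    have h := contiguous_add_left_sub_right (notInt_legendre' m) (notInt_legendre m)
      (notInt_neg_order n) ht.2.2
    rw [funext (hypergeometric_symm (1 / 4 - (m : ℝ)) (3 / 4 + m) (4 / 3 + n)),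
      hypergeometric_symm (_ + 1)] at h
    rw [lowerDegree_liftLegendre ht.1 ht.2.1 (hF n m t ht)
      (φ₁ := ₂F₁ (3 / 4 + (m : ℝ) - 1) (1 / 4 - (m : ℝ) + 1) (4 / 3 + n)) (c := 4 / 3 + n)
      (fun h0 => notInt_legendre' m 0 (by push_cast; linarith)) (by push_cast; ring)
      ((by ring : _ = _).trans (h.trans (by ring))), familyP,
      show (3 / 4 + ((m - 1 : ℤ) : ℝ)) = 3 / 4 + m - 1 by push_cast; ring,
      show (1 / 4 - ((m - 1 : ℤ) : ℝ)) = 1 / 4 - m + 1 by push_cast; ring, lowerDegreeFactor]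
    have hk := constP_add_one_degree n (m - 1)
    have h0 := (notInt_c m).ne_zero
    rw [sub_add_cancel] at hk
    push_cast at hk
    generalize liftLegendre _ _ _ t = L
    rw [div_mul_eq_mul_div _ (3 / 4 - (m : ℝ)), eq_div_iff h0]
    linear_combination (-3 / 2) * (7 / 12 + n - m) * L * hk

lemma isLadder_familyP' : IsLadder familyP' seriesDomain := by
  have hF : ∀ n m : ℤ, ∀ t ∈ seriesDomain, HasDerivAt _ _ (legendreArg t) := fun n m t ht =>
    hasDerivAt_hypergeometric (notInt_legendre m) (notInt_legendre' m) (notInt_pos_order n) ht.2.2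
  have hd : ∀ n m : ℤ, ∀ t ∈ seriesDomain, HasDerivAt (familyP' n m) _ t := fun n m t ht =>
    ((hasDerivAt_liftLegendre (j := 0) (m := m) ht.1 ht.2.1
      (hF n m t ht)).differentiableAt.hasDerivAt.const_mul (constP' n m))
  constructor
  · exact fun n m t ht => (hd n m t ht).differentiableAt
  · intro n m t ht
    rw [(hd n m t ht).deriv, familyP', raiseOrder_const_mul]
    have h := contiguous_sub_bottom (notInt_legendre m) (notInt_legendre' m) (notInt_pos_order n)
      ht.2.2
    rw [raiseOrder_liftLegendre_bottom_sub_one ht.1 ht.2.1 (hF n m t ht)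
      (φ₁ := ₂F₁ (3 / 4 + (m : ℝ)) (1 / 4 - (m : ℝ)) (2 / 3 - n - 1))
      (h.trans (by ring)), familyP',
      show (2 / 3 - ((n + 1 : ℤ) : ℝ)) = 2 / 3 - n - 1 by push_cast; ring, raiseOrderFactor]
    have hk := constP'_add_one_order n m
    generalize liftLegendre _ _ _ t = L
    linear_combination (3 / 8) * L * hk
  · intro n m t ht
    rw [(hd n m t ht).deriv, familyP', lowerOrder_const_mul]
    have h := contiguous_add_bottom (notInt_legendre m) (notInt_legendre' m) (notInt_pos_order n)
      ht.2.2
    rw [lowerOrder_liftLegendre_bottom_add_one ht.1 ht.2.1 (hF n m t ht)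
      (notInt_pos_order n).ne_zero (φ₁ := ₂F₁ (3 / 4 + (m : ℝ)) (1 / 4 - (m : ℝ)) (2 / 3 - n + 1))
      (h.trans (by ring)), familyP',
      show (2 / 3 - ((n - 1 : ℤ) : ℝ)) = 2 / 3 - n + 1 by push_cast; ring, lowerOrderFactor]
    have hk := constP'_add_one_order (n - 1) m
    have h0 := (notInt_pos_order n).ne_zero
    rw [sub_add_cancel] at hk
    push_cast at hk
    generalize liftLegendre _ _ _ t = L
    generalize constP' n m = K at *
    generalize constP' (n - 1) m = K' at *
    obtain ⟨M, hM⟩ : ∃ M : ℝ, M = 2 / 3 - (n : ℝ) := ⟨_, rfl⟩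
    have hM' : (n : ℝ) = 2 / 3 - M := by rw [hM]; ring
    rw [← hM] at h0 ⊢
    rw [hM'] at hk ⊢
    field_simp
    linear_combination (5184 * M - 5184 * m - 3888) * L * hk
  · intro n m t ht
    rw [(hd n m t ht).deriv, familyP', raiseDegree_const_mul]
    have h := contiguous_add_left_sub_right (notInt_legendre m) (notInt_legendre' m)
      (notInt_pos_order n) ht.2.2
    rw [raiseDegree_liftLegendre ht.1 ht.2.1 (hF n m t ht)
      (φ₁ := ₂F₁ (3 / 4 + (m : ℝ) + 1) (1 / 4 - (m : ℝ) - 1) (2 / 3 - n)) (c := 2 / 3 - n)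
      (fun h0 => notInt_legendre m 0 (by push_cast; linarith)) (by push_cast; ring)
      ((by ring : _ = _).trans (h.trans (by ring))), familyP',
      show (3 / 4 + ((m + 1 : ℤ) : ℝ)) = 3 / 4 + m + 1 by push_cast; ring,
      show (1 / 4 - ((m + 1 : ℤ) : ℝ)) = 1 / 4 - m - 1 by push_cast; ring, raiseDegreeFactor]
    have hk := constP'_add_one_degree n m
    generalize liftLegendre _ _ _ t = L
    linear_combination (-3 / 4) * L * hk
  · intro n m t ht
    rw [(hd n m t ht).deriv, familyP', lowerDegree_const_mul]
    have h := contiguous_add_left_sub_right (notInt_legendre' m) (notInt_legendre m)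
      (notInt_pos_order n) ht.2.2
    rw [funext (hypergeometric_symm (1 / 4 - (m : ℝ)) (3 / 4 + m) (2 / 3 - n)),
      hypergeometric_symm (_ + 1)] at h
    rw [lowerDegree_liftLegendre ht.1 ht.2.1 (hF n m t ht)
      (φ₁ := ₂F₁ (3 / 4 + (m : ℝ) - 1) (1 / 4 - (m : ℝ) + 1) (2 / 3 - n)) (c := 2 / 3 - n)
      (fun h0 => notInt_legendre' m 0 (by push_cast; linarith)) (by push_cast; ring)
      ((by ring : _ = _).trans (h.trans (by ring))), familyP',
      show (3 / 4 + ((m - 1 : ℤ) : ℝ)) = 3 / 4 + m - 1 by push_cast; ring,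
      show (1 / 4 - ((m - 1 : ℤ) : ℝ)) = 1 / 4 - m + 1 by push_cast; ring, lowerDegreeFactor]
    have hk := constP'_add_one_degree n (m - 1)
    have h0 := (notInt_c m).ne_zero
    rw [sub_add_cancel] at hk
    push_cast at hk
    generalize liftLegendre _ _ _ t = L
    rw [div_mul_eq_mul_div _ (3 / 4 - (m : ℝ)), eq_div_iff h0]
    linear_combination (3 / 2) * (1 / 12 + n + m) * L * hk

end FamilyP

/-! ### Rational functions in the octahedral parameter -/

/-- The polynomial `u (1 - u) (1 + 14 u + u²)`, whose zeros are the only possible poles of the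
octahedral functions. -/
noncomputable def octDenom : Polynomial ℝ :=
  Polynomial.X * (1 - Polynomial.X) * (1 + 14 * Polynomial.X + Polynomial.X ^ 2)

lemma eval_octDenom (u : ℝ) : octDenom.eval u = u * (1 - u) * octPv u := by
  simp [octDenom, octPv]

/-- Away from the zeros of `octDenom`, the function `ρ` is a quotient of a polynomial by a power of
`octDenom`. -/
def IsOctRational (ρ : ℝ → ℝ) : Prop :=
  ∃ (q : Polynomial ℝ) (k : ℕ), ∀ u, octDenom.eval u ≠ 0 → ρ u = q.eval u / octDenom.eval u ^ k

namespace IsOctRational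

variable {ρ σ : ℝ → ℝ}

lemma polynomial (q : Polynomial ℝ) : IsOctRational fun u => q.eval u := ⟨q, 0, by simp⟩

lemma const (a : ℝ) : IsOctRational fun _ => a := by
  simpa using polynomial (Polynomial.C a)

lemma id : IsOctRational fun u => u := by simpa using polynomial Polynomial.X

lemma add (hρ : IsOctRational ρ) (hσ : IsOctRational σ) : IsOctRational fun u => ρ u + σ u := by
  obtain ⟨p, k, hp⟩ := hρ
  obtain ⟨q, l, hq⟩ := hσ
  refine ⟨p * octDenom ^ l + q * octDenom ^ k, k + l, fun u hu => ?_⟩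
  simp only [hp u hu, hq u hu]
  simp only [Polynomial.eval_add, Polynomial.eval_mul, Polynomial.eval_pow]
  field_simp
  ring

lemma mul (hρ : IsOctRational ρ) (hσ : IsOctRational σ) : IsOctRational fun u => ρ u * σ u := by
  obtain ⟨p, k, hp⟩ := hρ
  obtain ⟨q, l, hq⟩ := hσ
  refine ⟨p * q, k + l, fun u hu => ?_⟩
  simp only [hp u hu, hq u hu]
  simp only [Polynomial.eval_mul]
  field_simp
  ring

lemma congr (hρ : IsOctRational ρ) (h : ∀ u, octDenom.eval u ≠ 0 → σ u = ρ u) :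
    IsOctRational σ := by
  obtain ⟨p, k, hp⟩ := hρ
  exact ⟨p, k, fun u hu => (h u hu).trans (hp u hu)⟩

lemma inv_denom : IsOctRational fun u => (octDenom.eval u)⁻¹ :=
  ⟨1, 1, fun u _ => by simp⟩

lemma octPv : IsOctRational octPv := by
  refine (polynomial (1 + 14 * Polynomial.X + Polynomial.X ^ 2)).congr fun u _ => ?_
  simp [_root_.octPv]

lemma octahedralPe : IsOctRational octahedralPe := by
  refine (polynomial ((1 + Polynomial.X) * (1 - 34 * Polynomial.X + Polynomial.X ^ 2))).congr
    fun u _ => ?_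
  simp [_root_.octahedralPe]

lemma one_sub : IsOctRational fun u => 1 - u := by
  exact (polynomial (1 - Polynomial.X)).congr fun u _ => by simp

lemma inv_octPv : IsOctRational fun u => (_root_.octPv u)⁻¹ := by
  refine ((id.mul one_sub).mul inv_denom).congr fun u hu => ?_
  rw [eval_octDenom] at *
  have h1 := left_ne_zero_of_mul (left_ne_zero_of_mul hu)
  have h2 := right_ne_zero_of_mul (left_ne_zero_of_mul hu)
  have h3 := right_ne_zero_of_mul hu
  field_simp

lemma inv_mul_one_sub : IsOctRational fun u => (u * (1 - u))⁻¹ := by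
  refine (octPv.mul inv_denom).congr fun u hu => ?_
  rw [eval_octDenom] at *
  have h1 := left_ne_zero_of_mul hu
  have h2 := right_ne_zero_of_mul hu
  field_simp

lemma inv_one_sub : IsOctRational fun u => (1 - u)⁻¹ := by
  refine (inv_mul_one_sub.mul id).congr fun u hu => ?_
  rw [eval_octDenom] at hu
  have h1 := left_ne_zero_of_mul (left_ne_zero_of_mul hu)
  have h2 := right_ne_zero_of_mul (left_ne_zero_of_mul hu)
  field_simp

lemma pow (hρ : IsOctRational ρ) (k : ℕ) : IsOctRational fun u => ρ u ^ k := by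
  induction k with
  | zero => simpa using const 1
  | succ k ih => simpa [pow_succ] using ih.mul hρ

/-- The derivative of such a function is of the same form. -/
lemma exists_deriv (hρ : IsOctRational ρ) : ∃ ρ' : ℝ → ℝ, IsOctRational ρ' ∧
    ∀ u, octDenom.eval u ≠ 0 → HasDerivAt ρ (ρ' u) u := by
  obtain ⟨q, k, hq⟩ := hρ
  refine ⟨fun u => (q.derivative.eval u * octDenom.eval u ^ k -
    q.eval u * (k * octDenom.eval u ^ (k - 1) * octDenom.derivative.eval u)) *
      ((octDenom.eval u)⁻¹ ^ k) ^ 2, ?_, fun u hu => ?_⟩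
  · have h := (polynomial (q.derivative * octDenom ^ k -
      q * ((k : Polynomial ℝ) * octDenom ^ (k - 1) * octDenom.derivative))).mul
        ((inv_denom.pow k).pow 2)
    simpa using h
  · have h1 : HasDerivAt (fun u => q.eval u / octDenom.eval u ^ k) _ u :=
      (q.hasDerivAt u).div ((octDenom.hasDerivAt u).pow k) (pow_ne_zero k hu)
    have h2 : ρ =ᶠ[𝓝 u] fun u => q.eval u / octDenom.eval u ^ k := by
      filter_upwards [octDenom.continuous.continuousAt.eventually_ne hu] with v hv using hq v hv
    refine (h1.congr_of_eventuallyEq h2).congr_deriv ?_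
    simp [div_eq_mul_inv]

lemma octLog (e : ℝ) (hρ : IsOctRational ρ) (hσ : IsOctRational σ) :
    IsOctRational fun u => octLog e u (ρ u) (σ u) := by
  refine (((((const (-(3 / 4))).mul octPv).mul (id.mul one_sub)).mul hσ).add
    ((((const (3 * e / 8)).mul (polynomial (14 + 2 * Polynomial.X))).mul (id.mul one_sub)).mul
      hρ)).congr fun u _ => ?_
  simp [_root_.octLog]

end IsOctRational

lemma octDenom_octU_ne_zero {ε t : ℝ} (hε : ε ^ 2 = 1) (ht : t < 1) (h0 : t ≠ 0) :
    octDenom.eval (octU ε t) ≠ 0 := by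
  rw [eval_octDenom]
  exact mul_ne_zero (mul_ne_zero (octU_ne_zero hε ht) (one_sub_octU_ne_zero hε ht))
    (octPv_octU_ne_zero hε ht h0)

/-! ### Climbing the ladder -/

/-- The family `Y` is the combination of the two branches of `octTerm` with weights `w` and `w'`,
at the indices `(n, m)` and with `ρ` in the role of the octahedral function. -/
def Represents (Y : ℤ → ℤ → ℝ → ℝ) (s : Set ℝ) (w w' : ℝ) (n m : ℤ) (ρ : ℝ → ℝ) : Prop :=
  ∀ t ∈ s, Y n m t = w * octTerm 1 ρ (n + m) t + w' * octTerm (-1) ρ (n + m) t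

section Climb

variable {Y : ℤ → ℤ → ℝ → ℝ} {s : Set ℝ} {w w' : ℝ} {n m : ℤ} {ρ ρ' ρ₁ : ℝ → ℝ}

lemma raiseOrderFactor_ne_zero (n m : ℤ) : raiseOrderFactor n m ≠ 0 := fun h => by
  rw [raiseOrderFactor] at h
  have : (7 + 12 * n - 12 * m : ℝ) = 0 := by linarith
  have : (7 + 12 * n - 12 * m : ℤ) = 0 := by exact_mod_cast this
  omega

lemma lowerOrderFactor_ne_zero (n m : ℤ) : lowerOrderFactor n m ≠ 0 := fun h => by
  rw [lowerOrderFactor] at h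
  have : (1 + 12 * n + 12 * m : ℝ) = 0 := by linarith
  have : (1 + 12 * n + 12 * m : ℤ) = 0 := by exact_mod_cast this
  omega

lemma raiseDegreeFactor_ne_zero (n m : ℤ) : raiseDegreeFactor n m ≠ 0 := fun h => by
  rw [raiseDegreeFactor] at h
  have : (1 + 4 * m : ℝ) = 0 := by linarith
  have : (1 + 4 * m : ℤ) = 0 := by exact_mod_cast this
  omega

lemma lowerDegreeFactor_ne_zero (n m : ℤ) : lowerDegreeFactor n m ≠ 0 := by
  have h1 := lowerOrderFactor_ne_zero n m
  have h2 := raiseOrderFactor_ne_zero n m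
  rw [lowerDegreeFactor]
  refine div_ne_zero (mul_ne_zero (neg_ne_zero.2 fun h => h1 ?_) fun h => h2 ?_)
    (notInt_c m).ne_zero
  · rw [lowerOrderFactor, h, mul_zero]
  · rw [raiseOrderFactor]; linarith

lemma Represents.deriv_eq (h : Represents Y s w w' n m ρ) (hs : IsOpen s)
    (hs' : ∀ t ∈ s, t < 1 ∧ t ≠ 0)
    (hρ : ∀ u, octDenom.eval u ≠ 0 → HasDerivAt ρ (ρ' u) u) {t : ℝ} (ht : t ∈ s) :
    deriv (Y n m) t = w * deriv (octTerm 1 ρ (n + m)) t +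
      w' * deriv (octTerm (-1) ρ (n + m)) t := by
  have h1 : Y n m =ᶠ[𝓝 t] fun t =>
      w * octTerm 1 ρ (n + m) t + w' * octTerm (-1) ρ (n + m) t := by
    filter_upwards [hs.mem_nhds ht] with v hv using h v hv
  obtain ⟨ht1, ht0⟩ := hs' t ht
  have hd : ∀ ε : ℝ, ε ^ 2 = 1 → DifferentiableAt ℝ (octTerm ε ρ (n + m)) t := fun ε hε =>
    (hasDerivAt_octTerm _ hε ht1 ht0
      (hρ _ (octDenom_octU_ne_zero hε ht1 ht0))).differentiableAt
  have hd1 := hd 1 (by norm_num)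
  have hd2 := hd (-1) (by norm_num)
  rw [h1.deriv_eq, deriv_fun_add (hd1.const_mul w) (hd2.const_mul w'), deriv_const_mul _ hd1,
    deriv_const_mul _ hd2]

lemma Represents.raiseOrder (h : Represents Y s w w' n m ρ) (hY : IsLadder Y s) (hs : IsOpen s)
    (hs' : ∀ t ∈ s, t < 1 ∧ t ≠ 0)
    (hρ : ∀ u, octDenom.eval u ≠ 0 → HasDerivAt ρ (ρ' u) u)
    (h₁ : ∀ u, raiseOrderFactor n m * ρ₁ u = octLog (1 / 4 + 3 * m + 3 * n) u (ρ u) (ρ' u) +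
        1 / 4 * octahedralPe u * (-7 / 8 + 3 * m / 2 - 3 * n / 2) * ρ u) :
    Represents Y s w w' (n + 1) m ρ₁ := by
  intro t ht
  obtain ⟨ht1, ht0⟩ := hs' t ht
  have e : ∀ ε : ℝ, ε ^ 2 = 1 → _ := fun ε hε => raiseOrder_octTerm n m hε ht1 ht0
    (hρ _ (octDenom_octU_ne_zero hε ht1 ht0)) (h₁ (octU ε t))
  have e1 := e 1 (by norm_num)
  have e2 := e (-1) (by norm_num)
  have e3 := hY.raiseOrder n m t ht
  rw [h.deriv_eq hs hs' hρ ht, h t ht] at e3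
  apply mul_left_cancel₀ (raiseOrderFactor_ne_zero n m)
  simp only [_root_.raiseOrder] at e1 e2 e3
  linear_combination w * e1 + w' * e2 - e3

lemma Represents.lowerOrder (h : Represents Y s w w' n m ρ) (hY : IsLadder Y s) (hs : IsOpen s)
    (hs' : ∀ t ∈ s, t < 1 ∧ t ≠ 0)
    (hρ : ∀ u, octDenom.eval u ≠ 0 → HasDerivAt ρ (ρ' u) u)
    (h₁ : ∀ u, lowerOrderFactor n m * ρ₁ u = 64 / octPv u ^ 3 *
      (octLog (1 / 4 + 3 * m + 3 * n) u (ρ u) (ρ' u) +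
        (1 / 4 + 3 * m + 3 * n) / 8 * octahedralPe u * ρ u)) :
    Represents Y s w w' (n - 1) m ρ₁ := by
  intro t ht
  obtain ⟨ht1, ht0⟩ := hs' t ht
  have e : ∀ ε : ℝ, ε ^ 2 = 1 → _ := fun ε hε => lowerOrder_octTerm n m hε ht1 ht0
    (hρ _ (octDenom_octU_ne_zero hε ht1 ht0)) (h₁ (octU ε t))
  have e1 := e 1 (by norm_num)
  have e2 := e (-1) (by norm_num)
  have e3 := hY.lowerOrder n m t ht
  rw [h.deriv_eq hs hs' hρ ht, h t ht] at e3
  apply mul_left_cancel₀ (lowerOrderFactor_ne_zero n m)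
  simp only [_root_.lowerOrder] at e1 e2 e3
  linear_combination w * e1 + w' * e2 - e3

lemma Represents.raiseDegree (h : Represents Y s w w' n m ρ) (hY : IsLadder Y s) (hs : IsOpen s)
    (hs' : ∀ t ∈ s, t < 1 ∧ t ≠ 0)
    (hρ : ∀ u, octDenom.eval u ≠ 0 → HasDerivAt ρ (ρ' u) u)
    (h₁ : ∀ u, raiseDegreeFactor n m * ρ₁ u = octLog (1 / 4 + 3 * m + 3 * n) u (ρ u) (ρ' u) +
        (3 / 4 + 3 * m) / 4 * octahedralPe u * ρ u) :
    Represents Y s w w' n (m + 1) ρ₁ := by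
  intro t ht
  obtain ⟨ht1, ht0⟩ := hs' t ht
  have e : ∀ ε : ℝ, ε ^ 2 = 1 → _ := fun ε hε => raiseDegree_octTerm n m hε ht1 ht0
    (hρ _ (octDenom_octU_ne_zero hε ht1 ht0)) (h₁ (octU ε t))
  have e1 := e 1 (by norm_num)
  have e2 := e (-1) (by norm_num)
  have e3 := hY.raiseDegree n m t ht
  rw [h.deriv_eq hs hs' hρ ht, h t ht] at e3
  apply mul_left_cancel₀ (raiseDegreeFactor_ne_zero n m)
  simp only [_root_.raiseDegree] at e1 e2 e3
  linear_combination w * e1 + w' * e2 - e3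

lemma Represents.lowerDegree (h : Represents Y s w w' n m ρ) (hY : IsLadder Y s) (hs : IsOpen s)
    (hs' : ∀ t ∈ s, t < 1 ∧ t ≠ 0)
    (hρ : ∀ u, octDenom.eval u ≠ 0 → HasDerivAt ρ (ρ' u) u)
    (h₁ : ∀ u, lowerDegreeFactor n m * ρ₁ u = -(4 / 27) / (u * (1 - u) ^ 4) *
      octLog (1 / 4 + 3 * m + 3 * n) u (ρ u) (ρ' u)) :
    Represents Y s w w' n (m - 1) ρ₁ := by
  intro t ht
  obtain ⟨ht1, ht0⟩ := hs' t ht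
  have e : ∀ ε : ℝ, ε ^ 2 = 1 → _ := fun ε hε => lowerDegree_octTerm n m hε ht1 ht0
    (hρ _ (octDenom_octU_ne_zero hε ht1 ht0)) (h₁ (octU ε t))
  have e1 := e 1 (by norm_num)
  have e2 := e (-1) (by norm_num)
  have e3 := hY.lowerDegree n m t ht
  rw [h.deriv_eq hs hs' hρ ht, h t ht] at e3
  apply mul_left_cancel₀ (lowerDegreeFactor_ne_zero n m)
  simp only [_root_.lowerDegree] at e1 e2 e3
  linear_combination w * e1 + w' * e2 - e3

end Climb

lemma legendreArg_continuousOn : ContinuousOn legendreArg (Set.Iio 1) := fun _ ht =>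
  (hasDerivAt_legendreArg ht).continuousAt.continuousWithinAt

lemma isOpen_seriesDomain : IsOpen seriesDomain := by
  have h := (continuous_abs.comp_continuousOn legendreArg_continuousOn).isOpen_inter_preimage
    isOpen_Iio (isOpen_Iio (a := (1 : ℝ)))
  have h2 := h.inter (isOpen_ne (x := (0 : ℝ)))
  convert h2 using 1
  ext t
  simp only [seriesDomain, Set.mem_ofPred_eq, Set.mem_inter_iff, Set.mem_Iio, Set.mem_preimage,
    Function.comp_apply]
  tauto

/-- All four families of Legendre functions are given at `(n, m)` by the same function `ρ` of the
octahedral parameter. The weights do not depend on `(n, m)`. -/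
structure IsOctahedralData (n m : ℤ) (ρ : ℝ → ℝ) : Prop where
  isOctRational : IsOctRational ρ
  familyQ : Represents familyQ (Set.Ioo 0 1) 1 0 n m ρ
  familyQ' : Represents familyQ' (Set.Ioo 0 1) 0 1 n m ρ
  familyP : Represents familyP seriesDomain (Real.sqrt (Real.sqrt 3 - 1))
    (-Real.sqrt (Real.sqrt 3 + 1)) n m ρ
  familyP' : Represents familyP' seriesDomain (Real.sqrt (Real.sqrt 3 + 1))
    (Real.sqrt (Real.sqrt 3 - 1)) n m ρ

namespace IsOctahedralData

variable {n m : ℤ} {ρ : ℝ → ℝ}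

lemma step {n' m' : ℤ} {ρ₁ : ℝ → ℝ} (h : IsOctahedralData n m ρ) (hρ₁ : IsOctRational ρ₁)
    (hs : ∀ (Y : ℤ → ℤ → ℝ → ℝ) (s : Set ℝ) (w w' : ℝ), IsLadder Y s → IsOpen s →
      (∀ t ∈ s, t < 1 ∧ t ≠ 0) → Represents Y s w w' n m ρ → Represents Y s w w' n' m' ρ₁) :
    IsOctahedralData n' m' ρ₁ :=
  ⟨hρ₁, hs _ _ _ _ isLadder_familyQ isOpen_Ioo (fun _ ht => ⟨ht.2, ht.1.ne'⟩) h.familyQ,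
    hs _ _ _ _ isLadder_familyQ' isOpen_Ioo (fun _ ht => ⟨ht.2, ht.1.ne'⟩) h.familyQ',
    hs _ _ _ _ isLadder_familyP isOpen_seriesDomain (fun _ ht => ⟨ht.1, ht.2.1⟩) h.familyP,
    hs _ _ _ _ isLadder_familyP' isOpen_seriesDomain (fun _ ht => ⟨ht.1, ht.2.1⟩) h.familyP'⟩

lemma raiseOrder (h : IsOctahedralData n m ρ) : ∃ ρ₁, IsOctahedralData (n + 1) m ρ₁ := by
  obtain ⟨ρ', hρ', hd⟩ := h.isOctRational.exists_deriv
  refine ⟨fun u => (raiseOrderFactor n m)⁻¹ *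
    (octLog (1 / 4 + 3 * m + 3 * n) u (ρ u) (ρ' u) +
        1 / 4 * octahedralPe u * (-7 / 8 + 3 * m / 2 - 3 * n / 2) * ρ u), h.step ?_ ?_⟩
  · exact (IsOctRational.const _).mul ((h.isOctRational.octLog _ hρ').add
      ((((IsOctRational.const _).mul .octahedralPe).mul (.const _)).mul h.isOctRational))
  · exact fun Y s w w' hY hs hs' hr => hr.raiseOrder hY hs hs' hd fun u =>
      mul_inv_cancel_left₀ (raiseOrderFactor_ne_zero n m) _

lemma lowerOrder (h : IsOctahedralData n m ρ) : ∃ ρ₁, IsOctahedralData (n - 1) m ρ₁ := by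
  obtain ⟨ρ', hρ', hd⟩ := h.isOctRational.exists_deriv
  refine ⟨fun u => (lowerOrderFactor n m)⁻¹ * (64 / octPv u ^ 3 *
      (octLog (1 / 4 + 3 * m + 3 * n) u (ρ u) (ρ' u) +
        (1 / 4 + 3 * m + 3 * n) / 8 * octahedralPe u * ρ u)), h.step ?_ ?_⟩
  · refine ((IsOctRational.const (lowerOrderFactor n m)⁻¹).mul
      (((IsOctRational.const 64).mul (IsOctRational.inv_octPv.pow 3)).mul
      ((h.isOctRational.octLog (1 / 4 + 3 * m + 3 * n) hρ').add
      (((IsOctRational.const ((1 / 4 + 3 * m + 3 * n) / 8)).mul .octahedralPe).mul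
        h.isOctRational)))).congr fun u _ => ?_
    simp [div_eq_mul_inv]
  · exact fun Y s w w' hY hs hs' hr => hr.lowerOrder hY hs hs' hd fun u =>
      mul_inv_cancel_left₀ (lowerOrderFactor_ne_zero n m) _

lemma raiseDegree (h : IsOctahedralData n m ρ) : ∃ ρ₁, IsOctahedralData n (m + 1) ρ₁ := by
  obtain ⟨ρ', hρ', hd⟩ := h.isOctRational.exists_deriv
  refine ⟨fun u => (raiseDegreeFactor n m)⁻¹ *
    (octLog (1 / 4 + 3 * m + 3 * n) u (ρ u) (ρ' u) +
        (3 / 4 + 3 * m) / 4 * octahedralPe u * ρ u), h.step ?_ ?_⟩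
  · exact (IsOctRational.const _).mul ((h.isOctRational.octLog _ hρ').add
      (((IsOctRational.const _).mul .octahedralPe).mul h.isOctRational))
  · exact fun Y s w w' hY hs hs' hr => hr.raiseDegree hY hs hs' hd fun u =>
      mul_inv_cancel_left₀ (raiseDegreeFactor_ne_zero n m) _

lemma lowerDegree (h : IsOctahedralData n m ρ) : ∃ ρ₁, IsOctahedralData n (m - 1) ρ₁ := by
  obtain ⟨ρ', hρ', hd⟩ := h.isOctRational.exists_deriv
  refine ⟨fun u => (lowerDegreeFactor n m)⁻¹ * (-(4 / 27) / (u * (1 - u) ^ 4) *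
      octLog (1 / 4 + 3 * m + 3 * n) u (ρ u) (ρ' u)), h.step ?_ ?_⟩
  · refine ((IsOctRational.const (lowerDegreeFactor n m)⁻¹).mul
      (((IsOctRational.const (-(4 / 27))).mul
        (IsOctRational.inv_mul_one_sub.mul (IsOctRational.inv_one_sub.pow 3))).mul
      (h.isOctRational.octLog (1 / 4 + 3 * m + 3 * n) hρ'))).congr fun u _ => ?_
    rw [div_eq_mul_inv, pow_succ' (1 - u) 3, ← mul_assoc u, mul_inv (u * (1 - u)), inv_pow]
  · exact fun Y s w w' hY hs hs' hr => hr.lowerDegree hY hs hs' hd fun u =>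
      mul_inv_cancel_left₀ (lowerDegreeFactor_ne_zero n m) _

/-- The ladder operators reach every pair of indices from `(0, 0)`. -/
lemma exists_of_zero (h : IsOctahedralData 0 0 ρ) (n m : ℤ) : ∃ ρ₁, IsOctahedralData n m ρ₁ := by
  have h1 : ∃ ρ₁, IsOctahedralData n 0 ρ₁ := by
    induction n using Int.induction_on with
    | zero => exact ⟨ρ, h⟩
    | succ k ih => exact ih.elim fun _ h => h.raiseOrder
    | pred k ih => exact ih.elim fun _ h => h.lowerOrder
  induction m using Int.induction_on with
  | zero => exact h1
  | succ k ih => exact ih.elim fun _ h => h.raiseDegree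
  | pred k ih => exact ih.elim fun _ h => h.lowerDegree

end IsOctahedralData

/-! ### The case of indices `(0, 0)` -/

/-- The second-order equation satisfied by the families at `(n, m) = (0, 0)`, as a first-order
system for `f` and `V = (1 - t³) f'`. -/
def SolvesBaseEquation (f : ℝ → ℝ) (s : Set ℝ) : Prop :=
  ∃ V : ℝ → ℝ, ∀ t ∈ s, HasDerivAt f (V t / (1 - t ^ 3)) t ∧
    HasDerivAt V (-(3 / 2) * t ^ 2 / (1 - t ^ 3) * V t - 3 / 16 * t * f t) t

namespace SolvesBaseEquation

variable {f g : ℝ → ℝ} {s : Set ℝ}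

lemma mono {s' : Set ℝ} (h : SolvesBaseEquation f s) (hs : s' ⊆ s) : SolvesBaseEquation f s' :=
  h.imp fun _ hV t ht => hV t (hs ht)

lemma sub (hf : SolvesBaseEquation f s) (hg : SolvesBaseEquation g s) :
    SolvesBaseEquation (fun t => f t - g t) s := by
  obtain ⟨V, hV⟩ := hf
  obtain ⟨W, hW⟩ := hg
  refine ⟨fun t => V t - W t, fun t ht => ⟨?_, ?_⟩⟩
  · exact ((hV t ht).1.sub (hW t ht).1).congr_deriv (by ring)
  · exact ((hV t ht).2.sub (hW t ht).2).congr_deriv (by ring)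

lemma const_mul (w : ℝ) (hf : SolvesBaseEquation f s) :
    SolvesBaseEquation (fun t => w * f t) s := by
  obtain ⟨V, hV⟩ := hf
  refine ⟨fun t => w * V t, fun t ht => ⟨?_, ?_⟩⟩
  · exact ((hV t ht).1.const_mul w).congr_deriv (by ring)
  · exact ((hV t ht).2.const_mul w).congr_deriv (by ring)

/-- Lowering the order from `(0, 0)` and raising it again gives the equation. -/
lemma of_lower_raise (hs : ∀ t ∈ s, t < 1 ∧ t ≠ 0)
    (hf : ∀ t ∈ s, DifferentiableAt ℝ f t) (hg : ∀ t ∈ s, DifferentiableAt ℝ g t)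
    (h₁ : ∀ t ∈ s, lowerOrder 0 0 t (deriv f t) (f t) = lowerOrderFactor 0 0 * g t)
    (h₂ : ∀ t ∈ s, raiseOrder (-1) 0 t (deriv g t) (g t) = raiseOrderFactor (-1) 0 * f t) :
    SolvesBaseEquation f s := by
  refine ⟨fun t => t ^ 2 * (2 * g t - f t / 4), fun t ht => ?_⟩
  obtain ⟨ht1, ht0⟩ := hs t ht
  have hc := (one_sub_cube_pos ht1).ne'
  have e1 := h₁ t ht
  have e2 := h₂ t ht
  simp only [lowerOrder, raiseOrder, lowerOrderFactor, raiseOrderFactor] at e1 e2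
  push_cast at e1 e2
  have d1 := (hf t ht).hasDerivAt
  have d2 := (hg t ht).hasDerivAt
  have e3 : deriv f t = t ^ 2 * (2 * g t - f t / 4) / (1 - t ^ 3) := by
    field_simp at e1 ⊢
    linear_combination e1
  have e4 : deriv g t = ((-2 + 3 / 4 * t ^ 3) * g t + 5 / 32 * f t) / ((1 - t ^ 3) * t) := by
    rw [eq_div_iff (mul_ne_zero hc ht0)]
    linear_combination e2
  refine ⟨e3 ▸ d1, ((hasDerivAt_pow 2 t).mul ((d2.const_mul 2).sub (d1.div_const 4))).congr_deriv ?_⟩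
  simp only [Pi.sub_apply]
  rw [e3, e4]
  field_simp
  ring

lemma of_isLadder {Y : ℤ → ℤ → ℝ → ℝ} (hY : IsLadder Y s) (hs : ∀ t ∈ s, t < 1 ∧ t ≠ 0) :
    SolvesBaseEquation (Y 0 0) s :=
  of_lower_raise hs (hY.differentiableAt 0 0) (hY.differentiableAt (-1) 0)
    (fun t ht => by simpa using hY.lowerOrder 0 0 t ht)
    (fun t ht => by simpa using hY.raiseOrder (-1) 0 t ht)

lemma octTerm_one {ε : ℝ} (hε : ε ^ 2 = 1) (hs : ∀ t ∈ s, t < 1 ∧ t ≠ 0) :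
    SolvesBaseEquation (octTerm ε (fun _ => 1) 0) s := by
  have h0 : ∀ u : ℝ, HasDerivAt (fun _ : ℝ => (1 : ℝ)) 0 u := fun u => hasDerivAt_const u 1
  have h1 : ∀ u : ℝ, octPv u ≠ 0 → HasDerivAt (fun u => (1 - 5 * u) / octPv u ^ 2)
      ((-5 * octPv u - (1 - 5 * u) * 2 * (14 + 2 * u)) / octPv u ^ 3) u := fun u hu => by
    have hp : HasDerivAt octPv (14 + 2 * u) u := by
      refine ((((hasDerivAt_id u).const_mul 14).const_add 1).add
        (hasDerivAt_pow 2 u)).congr_deriv ?_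
      simp
    have hq : HasDerivAt (fun u : ℝ => 1 - 5 * u) (-5) u :=
      (((hasDerivAt_id u).const_mul 5).const_sub 1).congr_deriv (by simp)
    refine (hq.div (hp.pow 2) (pow_ne_zero 2 hu)).congr_deriv ?_
    simp only [Pi.pow_apply]
    field_simp
    ring
  refine of_lower_raise (g := octTerm ε (fun u => (1 - 5 * u) / octPv u ^ 2) (-1)) hs
    (fun t ht => ?_) (fun t ht => ?_) (fun t ht => ?_) fun t ht => ?_
  all_goals
    obtain ⟨ht1, ht0⟩ := hs t ht
    have hv := octPv_octU_ne_zero hε ht1 ht0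
  · exact (hasDerivAt_octTerm 0 hε ht1 ht0 (h0 _)).differentiableAt
  · exact (hasDerivAt_octTerm (-1) hε ht1 ht0 (h1 _ hv)).differentiableAt
  · refine lowerOrder_octTerm 0 0 hε ht1 ht0 (h0 _) ?_
    simp only [lowerOrderFactor, octLog, octahedralPe]
    rw [mul_div_assoc', div_mul_eq_mul_div, div_eq_div_iff (pow_ne_zero 2 hv) (pow_ne_zero 3 hv)]
    simp only [octPv]
    push_cast
    ring
  · refine raiseOrder_octTerm (ρ₁ := fun _ => 1) (-1) 0 hε ht1 ht0 (h1 _ hv) ?_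
    simp only [raiseOrderFactor, octLog, octahedralPe]
    generalize octU ε t = u at *
    field_simp
    simp only [octPv]
    push_cast
    ring

/-- Two solutions whose Wronskian and whose quotient tend to `0` at a singular point: the first one
vanishes. At the singular point both are `(1 - t)^κ` times an analytic function, and
`(1 - t³)^{-1/2}` times the Wronskian `f V_g - g V_f` is constant. -/
lemma eq_zero (hf : SolvesBaseEquation f s) (hg : SolvesBaseEquation g s) (hs : IsOpen s)
    (hs' : IsPreconnected s) (h1 : ∀ t ∈ s, t < 1) (hg0 : ∀ t ∈ s, g t ≠ 0)
    {t₀ κ : ℝ} (ht₀ : t₀ ∈ closure s) (hκ : 0 ≤ κ) {φ ψ : ℝ → ℝ}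
    (hfφ : ∀ t ∈ s, f t = (1 - t) ^ κ * φ t) (hgψ : ∀ t ∈ s, g t = (1 - t) ^ κ * ψ t)
    (hφ : AnalyticAt ℝ φ t₀) (hψ : AnalyticAt ℝ ψ t₀) (hφ0 : φ t₀ = 0) (hψ0 : ψ t₀ ≠ 0)
    (hφ' : (1 - t₀) * deriv φ t₀ = 0) : ∀ t ∈ s, f t = 0 := by
  obtain ⟨V, hV⟩ := hf
  obtain ⟨W, hW⟩ := hg
  have hne : (𝓝[s] t₀).NeBot := mem_closure_iff_nhdsWithin_neBot.1 ht₀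
  have hmem : ∀ᶠ t in 𝓝[s] t₀, t ∈ s := self_mem_nhdsWithin
  -- the normalized Wronskian is constant
  have hd : ∀ t ∈ s, HasDerivAt (fun t => (f t * W t - g t * V t) * (Real.sqrt (1 - t ^ 3))⁻¹) 0 t := by
    intro t ht
    have hp := one_sub_cube_pos (h1 t ht)
    have hq := Real.sqrt_pos.2 hp
    have e1 := (((hV t ht).1.mul (hW t ht).2).sub ((hW t ht).1.mul (hV t ht).2)).mul
      ((((hasDerivAt_pow 3 t).const_sub 1).sqrt hp.ne').inv hq.ne')
    refine e1.congr_deriv ?_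
    have hq2 := Real.sq_sqrt hp.le
    simp only [Pi.mul_apply, Pi.sub_apply, Pi.inv_apply]
    generalize Real.sqrt (1 - t ^ 3) = q at *
    rw [← hq2] at hp ⊢
    have := hq.ne'
    field_simp
    push_cast
    ring
  obtain ⟨C, hC⟩ := hs.exists_is_const_of_deriv_eq_zero hs'
    (fun t ht => (hd t ht).differentiableAt.differentiableWithinAt) (fun t ht => (hd t ht).deriv)
  -- its value, computed at the singular point
  have hlim : Tendsto (fun t => Real.sqrt (1 - t ^ 3) * ((1 - t) ^ κ * (1 - t) ^ κ) *
      (φ t * deriv ψ t - ψ t * deriv φ t)) (𝓝[s] t₀) (𝓝 0) := by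
    have hc : ContinuousAt (fun t => Real.sqrt (1 - t ^ 3) * ((1 - t) ^ κ * (1 - t) ^ κ) *
        (φ t * deriv ψ t - ψ t * deriv φ t)) t₀ := by
      have c0 : ContinuousAt (fun t : ℝ => (1 - t) ^ κ) t₀ :=
        (continuousAt_const.sub continuousAt_id).rpow_const (Or.inr hκ)
      have c1 : ContinuousAt (fun t : ℝ => Real.sqrt (1 - t ^ 3)) t₀ := by fun_prop
      exact (c1.mul (c0.mul c0)).mul ((hφ.continuousAt.mul hψ.deriv.continuousAt).sub
        (hψ.continuousAt.mul hφ.deriv.continuousAt))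
    have h2 := hc.tendsto.mono_left (nhdsWithin_le_nhds (s := s))
    convert h2 using 2
    rw [hφ0]
    rcases mul_eq_zero.1 hφ' with h | h
    · have : 1 - t₀ ^ 3 = 0 := by
        have : t₀ = 1 := by linarith
        rw [this]; norm_num
      rw [this, Real.sqrt_zero]; ring
    · rw [h]; ring
  have hval : ∀ᶠ t in 𝓝[s] t₀, Real.sqrt (1 - t ^ 3) * ((1 - t) ^ κ * (1 - t) ^ κ) *
      (φ t * deriv ψ t - ψ t * deriv φ t) = C := by
    have a1 := hφ.eventually_analyticAt.filter_mono (nhdsWithin_le_nhds (s := s))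
    have a2 := hψ.eventually_analyticAt.filter_mono (nhdsWithin_le_nhds (s := s))
    filter_upwards [hmem, a1, a2] with t ht b1 b2
    have hp := one_sub_cube_pos (h1 t ht)
    have hk : HasDerivAt (fun t : ℝ => (1 - t) ^ κ) _ t :=
      ((hasDerivAt_id t).const_sub 1).rpow_const (Or.inl (sub_pos.2 (h1 t ht)).ne')
    have hnear : ∀ᶠ x in 𝓝 t, x ∈ s := hs.mem_nhds ht
    have c1 := ((hk.mul b1.differentiableAt.hasDerivAt).congr_of_eventuallyEq
      (hnear.mono hfφ)).unique (hV t ht).1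
    have c2 := ((hk.mul b2.differentiableAt.hasDerivAt).congr_of_eventuallyEq
      (hnear.mono hgψ)).unique (hW t ht).1
    rw [eq_div_iff hp.ne'] at c1 c2
    rw [← hC t ht]
    rw [← c1, ← c2, hfφ t ht, hgψ t ht]
    have hq := Real.sqrt_pos.2 hp
    have hq2 := Real.sq_sqrt hp.le
    generalize Real.sqrt (1 - t ^ 3) = q at *
    rw [← hq2]
    field_simp
    ring
  have hC0 : C = 0 :=
    tendsto_nhds_unique (tendsto_const_nhds.congr' (hval.mono fun _ h => h.symm)) hlim
  -- hence the quotient `f / g` is constant, and its value is found in the same way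
  have hd2 : ∀ t ∈ s, HasDerivAt (fun t => f t / g t) 0 t := by
    intro t ht
    have hp := one_sub_cube_pos (h1 t ht)
    have e := hC t ht
    rw [hC0] at e
    have e' := (mul_eq_zero.1 e).resolve_right (inv_ne_zero (Real.sqrt_pos.2 hp).ne')
    refine ((hV t ht).1.div (hW t ht).1 (hg0 t ht)).congr_deriv ?_
    rw [div_eq_zero_iff]
    left
    rw [mul_div_assoc', div_mul_eq_mul_div, ← sub_div, div_eq_zero_iff]
    left
    linear_combination -e'
  obtain ⟨K, hK⟩ := hs.exists_is_const_of_deriv_eq_zero hs'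
    (fun t ht => (hd2 t ht).differentiableAt.differentiableWithinAt) (fun t ht => (hd2 t ht).deriv)
  have hK0 : K = 0 := by
    have l1 : Tendsto (fun t => φ t / ψ t) (𝓝[s] t₀) (𝓝 0) := by
      have h : Tendsto (fun t => φ t / ψ t) (𝓝[s] t₀) (𝓝 (φ t₀ / ψ t₀)) :=
        (hφ.continuousAt.div hψ.continuousAt hψ0).tendsto.mono_left nhdsWithin_le_nhds
      rwa [hφ0, zero_div] at h
    refine tendsto_nhds_unique (tendsto_const_nhds.congr' ?_) l1
    filter_upwards [hmem] with t ht
    rw [← hK t ht, hfφ t ht, hgψ t ht]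
    exact mul_div_mul_left _ _ (Real.rpow_pos_of_pos (sub_pos.2 (h1 t ht)) κ).ne'
  intro t ht
  have := hK t ht
  rw [hK0, div_eq_zero_iff] at this
  exact this.resolve_right (hg0 t ht)

end SolvesBaseEquation

lemma AnalyticAt.rpow_const_of_pos {f : ℝ → ℝ} {x : ℝ} (hf : AnalyticAt ℝ f x) (hx : 0 < f x)
    (p : ℝ) : AnalyticAt ℝ (fun y => f y ^ p) x := by
  refine ((hf.log hx).mul (analyticAt_const (v := p))).rexp'.congr ?_
  filter_upwards [hf.continuousAt.eventually (lt_mem_nhds hx)] with y hy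
  exact (Real.rpow_def_of_pos hy p).symm

section Base

variable {t : ℝ}

lemma analyticAt_octAlpha (ε t : ℝ) : AnalyticAt ℝ (octAlpha ε) t := by
  have h1 : AnalyticAt ℝ (fun t : ℝ => (1 + t + t ^ 2) / 3) t := by fun_prop
  have h2 := h1.rpow_const_of_pos (radicand_pos t) (1 / 2)
  simp_rw [← Real.sqrt_eq_rpow] at h2
  have h3 : AnalyticAt ℝ (fun t : ℝ => (1 + t) / 2) t := by fun_prop
  exact h3.add (analyticAt_const.mul h2)

lemma octAlpha_mul_octAlpha (t : ℝ) : octAlpha 1 t * octAlpha (-1) t = -(1 - t) ^ 2 / 12 := by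
  have h := Real.sq_sqrt (radicand_pos t).le
  simp only [octAlpha]
  linear_combination -h

lemma octAlpha_one_pos (t : ℝ) : 0 < octAlpha 1 t := by
  have h := Real.sq_sqrt (radicand_pos t).le
  have h0 := Real.sqrt_pos.2 (radicand_pos t)
  rw [octAlpha]
  by_contra! h2
  nlinarith [sq_nonneg (1 - t)]

lemma octAlpha_neg_one_neg (h1 : t < 1) : octAlpha (-1) t < 0 := by
  have h := octAlpha_mul_octAlpha t
  have h0 := octAlpha_one_pos t
  have : 0 < (1 - t) ^ 2 := pow_pos (sub_pos.2 h1) 2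
  nlinarith

lemma octTerm_zero (ε t : ℝ) : octTerm ε (fun _ => 1) 0 t = |octAlpha ε t| ^ (1 / 4 : ℝ) := by
  simp [octTerm]

lemma octTerm_zero_ne {ε : ℝ} (hε : ε ^ 2 = 1) (h1 : t < 1) :
    octTerm ε (fun _ => 1) 0 t ≠ 0 := by
  rw [octTerm_zero]
  exact (Real.rpow_pos_of_pos (abs_pos.2 (octAlpha_ne_zero hε h1)) _).ne'

lemma analyticAt_octTerm_zero {ε : ℝ} (h : octAlpha ε t ≠ 0) :
    AnalyticAt ℝ (octTerm ε (fun _ => 1) 0) t := by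
  have h0 : AnalyticAt ℝ (fun s => octAlpha ε s ^ 2) t := (analyticAt_octAlpha ε t).pow 2
  have h1 := h0.rpow_const_of_pos (p := 1 / 8) (by positivity)
  convert h1 using 2 with s
  rw [octTerm_zero, ← sq_abs, ← Real.rpow_natCast, ← Real.rpow_mul (abs_nonneg _)]
  norm_num

lemma analyticAt_tanhSq_one : AnalyticAt ℝ tanhSq 1 := by
  unfold tanhSq
  exact (AnalyticAt.div (by fun_prop) (by fun_prop) (by norm_num)).pow 2

lemma analyticAt_four_mul_rpow_one : AnalyticAt ℝ
    (fun t : ℝ => (4 * (1 + t ^ 3)) ^ (1 / 12 : ℝ)) 1 :=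
  AnalyticAt.rpow_const_of_pos (by fun_prop) (by norm_num) _

lemma analyticAt_hypergeometric_tanhSq_one {a b c : ℝ} (ha : NotInt a) (hb : NotInt b)
    (hc : NotInt c) : AnalyticAt ℝ (fun t => ₂F₁ a b c (tanhSq t)) 1 := by
  have h0 : tanhSq 1 = 0 := by norm_num [tanhSq]
  refine AnalyticAt.comp (g := ₂F₁ a b c) ?_ analyticAt_tanhSq_one
  exact analyticAt_hypergeometric ha hb hc (by rw [h0]; norm_num)

lemma eight_rpow : (8 : ℝ) ^ (1 / 12 : ℝ) = 2 ^ (1 / 4 : ℝ) := by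
  rw [show (8 : ℝ) = 2 ^ (3 : ℝ) by norm_num, ← Real.rpow_mul (by norm_num)]
  norm_num

lemma one_mem_closure : (1 : ℝ) ∈ closure (Set.Ioo (0 : ℝ) 1) := by
  rw [closure_Ioo (by norm_num)]; norm_num

lemma represents_familyQ_zero : Represents familyQ (Set.Ioo 0 1) 1 0 0 0 fun _ => 1 := by
  have hd : ∀ t ∈ Set.Ioo (0 : ℝ) 1, t < 1 ∧ t ≠ 0 := fun t ht => ⟨ht.2, ht.1.ne'⟩
  have hE := SolvesBaseEquation.octTerm_one (ε := 1) (by norm_num) hd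
  have hα : octAlpha 1 1 = 2 := by norm_num [octAlpha]
  have hψ : AnalyticAt ℝ (octTerm 1 (fun _ => 1) 0) 1 :=
    analyticAt_octTerm_zero (by rw [hα]; norm_num)
  have hY : ∀ t, familyQ 0 0 t = (4 * (1 + t ^ 3)) ^ (1 / 12 : ℝ) *
      ₂F₁ (-(1 / 24) - ((0 : ℤ) : ℝ) / 2 - ((0 : ℤ) : ℝ) / 2)
        (11 / 24 - ((0 : ℤ) : ℝ) / 2 - ((0 : ℤ) : ℝ) / 2) (3 / 4 - ((0 : ℤ) : ℝ)) (tanhSq t) := by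
    intro t
    simp [familyQ, liftTanhSq]
  have hφ : AnalyticAt ℝ (fun t => familyQ 0 0 t - octTerm 1 (fun _ => 1) 0 t) 1 := by
    simp_rw [hY]
    exact (analyticAt_four_mul_rpow_one.mul (analyticAt_hypergeometric_tanhSq_one
      (notInt_a 0 0) (notInt_b 0 0) (notInt_c 0))).sub hψ
  have h1 : octTerm 1 (fun _ => 1) 0 1 = (2 : ℝ) ^ (1 / 4 : ℝ) := by
    rw [octTerm_zero, hα]; norm_num
  have h := ((SolvesBaseEquation.of_isLadder isLadder_familyQ hd).sub hE).eq_zero hE isOpen_Ioo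
    isPreconnected_Ioo (fun t ht => ht.2) (fun t ht => octTerm_zero_ne (by norm_num) ht.2)
    (κ := 0) one_mem_closure le_rfl (by simp) (by simp) hφ hψ ?_ ?_ (by simp)
  · intro t ht
    have := h t ht
    simp only [one_mul, zero_mul, add_zero]
    linarith
  · rw [hY, h1, show tanhSq 1 = 0 by norm_num [tanhSq], ordinaryHypergeometric_zero,
      ← eight_rpow]
    norm_num
  · rw [h1]; positivity

lemma represents_familyQ'_zero : Represents familyQ' (Set.Ioo 0 1) 0 1 0 0 fun _ => 1 := by
  have hd : ∀ t ∈ Set.Ioo (0 : ℝ) 1, t < 1 ∧ t ≠ 0 := fun t ht => ⟨ht.2, ht.1.ne'⟩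
  have hE := SolvesBaseEquation.octTerm_one (ε := -1) (by norm_num) hd
  have hα : octAlpha 1 1 = 2 := by norm_num [octAlpha]
  -- the common factor `(1 - t)^{1/2}` at `t = 1`
  have hEψ : ∀ t ∈ Set.Ioo (0 : ℝ) 1, octTerm (-1) (fun _ => 1) 0 t =
      (1 - t) ^ (1 / 2 : ℝ) * (12 * octAlpha 1 t) ^ (-(1 / 4) : ℝ) := by
    intro t ht
    have hp := octAlpha_one_pos t
    have h1 : 0 < 1 - t := sub_pos.2 ht.2
    have h2 : |octAlpha (-1) t| = (1 - t) ^ (2 : ℝ) * (12 * octAlpha 1 t) ^ (-1 : ℝ) := by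
      rw [abs_of_neg (octAlpha_neg_one_neg ht.2), Real.rpow_neg_one, Real.rpow_two,
        ← div_eq_mul_inv, eq_div_iff (by positivity)]
      linear_combination -12 * octAlpha_mul_octAlpha t
    rw [octTerm_zero, h2, Real.mul_rpow (by positivity) (by positivity), ← Real.rpow_mul h1.le,
      ← Real.rpow_mul (by positivity)]
    norm_num
  have h12 : AnalyticAt ℝ (fun t => 12 * octAlpha 1 t) 1 :=
    analyticAt_const.mul (analyticAt_octAlpha 1 1)
  have hψ := h12.rpow_const_of_pos (by rw [hα]; norm_num) (-(1 / 4))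
  set F : ℝ → ℝ := ₂F₁ (5 / 24 + ((0 : ℤ) : ℝ) / 2 - ((0 : ℤ) : ℝ) / 2)
    (17 / 24 + ((0 : ℤ) : ℝ) / 2 - ((0 : ℤ) : ℝ) / 2) (5 / 4 + ((0 : ℤ) : ℝ)) with hF
  set χ : ℝ → ℝ := fun t => (4 * (1 + t ^ 3)) ^ (1 / 12 : ℝ) * ((108 : ℝ) ^ (-(1 / 4) : ℝ) *
    (((1 + t + t ^ 2) / (1 + t ^ 3)) ^ (1 / 2 : ℝ) * F (tanhSq t))) with hχ
  have hYχ : ∀ t ∈ Set.Ioo (0 : ℝ) 1, familyQ' 0 0 t = (1 - t) ^ (1 / 2 : ℝ) * χ t := by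
    intro t ht
    have h0 := one_add_cube_pos ht.1
    have h1 : 0 < 1 - t := sub_pos.2 ht.2
    have h2 : 0 < (1 + t + t ^ 2) / (1 + t ^ 3) :=
      div_pos (by linarith [radicand_pos t]) h0
    have h3 : tanhSq t ^ (1 / 4 : ℝ) =
        (1 - t) ^ (1 / 2 : ℝ) * ((1 + t + t ^ 2) / (1 + t ^ 3)) ^ (1 / 2 : ℝ) := by
      rw [← Real.mul_rpow h1.le h2.le, tanhSq, ← Real.rpow_two, ← Real.rpow_mul]
      · rw [mul_div_assoc']
        ring_nf
      · exact (div_pos (one_sub_cube_pos ht.2) h0).le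
    have hc : constQ' 0 0 = (108 : ℝ) ^ (-(1 / 4) : ℝ) := by
      simp [constQ', risingFactorial_zero]
    simp only [familyQ', liftTanhSq, ← hF, hc, hχ]
    rw [show (1 / 4 + ((0 : ℤ) : ℝ)) = 1 / 4 by simp, h3,
      show 1 / 12 + ((0 : ℤ) : ℝ) + ((0 : ℤ) : ℝ) = 1 / 12 by simp]
    ring
  have hχa : AnalyticAt ℝ χ 1 := by
    refine analyticAt_four_mul_rpow_one.mul (analyticAt_const.mul
      ((AnalyticAt.rpow_const_of_pos ?_ (by norm_num) _).mul
      (analyticAt_hypergeometric_tanhSq_one (notInt_a' 0 0) (notInt_b' 0 0) (notInt_c' 0))))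
    exact AnalyticAt.div (by fun_prop) (by fun_prop) (by norm_num)
  have h := ((SolvesBaseEquation.of_isLadder isLadder_familyQ' hd).sub hE).eq_zero hE isOpen_Ioo
    isPreconnected_Ioo (fun t ht => ht.2) (fun t ht => octTerm_zero_ne (by norm_num) ht.2)
    (κ := 1 / 2) one_mem_closure (by norm_num)
    (φ := fun t => χ t - (12 * octAlpha 1 t) ^ (-(1 / 4) : ℝ))
    (fun t ht => by rw [hYχ t ht, hEψ t ht]; ring) hEψ (hχa.sub hψ) hψ ?_ ?_ (by simp)
  · intro t ht
    have := h t ht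
    simp only [one_mul, zero_mul, zero_add]
    linarith
  · have e : (24 : ℝ) ^ (-(1 / 4) : ℝ) = 2 ^ (1 / 4 : ℝ) * ((108 : ℝ) ^ (-(1 / 4) : ℝ) *
        (3 / 2) ^ (1 / 2 : ℝ)) := by
      have e1 : (3 / 2 : ℝ) ^ (1 / 2 : ℝ) = (9 / 4) ^ (1 / 4 : ℝ) := by
        rw [show (9 / 4 : ℝ) = (3 / 2) ^ (2 : ℝ) by norm_num, ← Real.rpow_mul (by norm_num)]
        norm_num
      rw [e1, Real.rpow_neg (by norm_num), Real.rpow_neg (by norm_num), ← Real.inv_rpow (by norm_num),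
        ← Real.inv_rpow (by norm_num), ← Real.mul_rpow (by norm_num) (by norm_num),
        ← Real.mul_rpow (by norm_num) (by norm_num)]
      norm_num
    simp only [hχ, hα, hF, show tanhSq 1 = 0 by norm_num [tanhSq], ordinaryHypergeometric_zero]
    norm_num at e ⊢
    have e2 := eight_rpow
    norm_num at e2
    rw [e, e2]
    ring
  · rw [hα]; positivity

end Base

section BaseLegendre

variable {t : ℝ}

lemma abs_legendreArg_lt_one_iff (h1 : t < 1) : |legendreArg t| < 1 ↔ 2 * t ^ 3 < 1 := by
  have hp := one_sub_cube_pos h1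
  rw [legendreArg, abs_div, abs_of_pos hp, div_lt_one hp, abs_neg, abs_lt]
  constructor
  · rintro ⟨h, h'⟩; linarith
  · intro h; constructor <;> linarith

lemma lt_one_of_two_mul_cube (h : 2 * t ^ 3 < 1) : t < 1 := by
  by_contra! h1
  have := one_le_pow₀ h1 (n := 3)
  linarith

lemma seriesDomain_eq : seriesDomain = {t | t ≠ 0 ∧ 2 * t ^ 3 < 1} := by
  ext t
  simp only [seriesDomain, Set.mem_ofPred_eq]
  constructor
  · exact fun h => ⟨h.2.1, (abs_legendreArg_lt_one_iff h.1).1 h.2.2⟩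
  · exact fun h => ⟨lt_one_of_two_mul_cube h.2, h.1,
      (abs_legendreArg_lt_one_iff (lt_one_of_two_mul_cube h.2)).2 h.2⟩

/-- A solution on the series domain vanishes there if it extends analytically to `t = 0`, with
value and derivative `0`. -/
lemma SolvesBaseEquation.eq_zero_of_zero {f : ℝ → ℝ} (hf : SolvesBaseEquation f seriesDomain)
    (ha : AnalyticAt ℝ f 0) (h0 : f 0 = 0) (h0' : deriv f 0 = 0) : ∀ t ∈ seriesDomain, f t = 0 := by
  have hd : ∀ t ∈ seriesDomain, t < 1 ∧ t ≠ 0 := fun t ht => ⟨ht.1, ht.2.1⟩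
  have hE := SolvesBaseEquation.octTerm_one (ε := 1) (by norm_num) hd
  have hα := analyticAt_octTerm_zero (octAlpha_one_pos 0).ne'
  have key : ∀ s : Set ℝ, s ⊆ seriesDomain → IsOpen s → IsPreconnected s → 0 ∈ closure s →
      ∀ t ∈ s, f t = 0 := fun s hs ho hc hcl =>
    (hf.mono hs).eq_zero (hE.mono hs) ho hc (fun t ht => (hs ht).1)
      (fun t ht => octTerm_zero_ne (by norm_num) (hs ht).1) (κ := 0) hcl le_rfl (by simp) (by simp)
      ha hα h0 (octTerm_zero_ne (by norm_num) (by norm_num)) (by rw [h0', mul_zero])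
  intro t ht
  have ht' := ht
  rw [seriesDomain_eq] at ht'
  rcases lt_or_gt_of_ne ht.2.1 with h | h
  · refine key (Set.Iio 0) ?_ isOpen_Iio isPreconnected_Iio (by simp [closure_Iio]) t h
    rw [seriesDomain_eq]
    intro s hs
    have : s ^ 3 < 0 := Odd.pow_neg (by decide) hs
    exact ⟨(Set.mem_Iio.1 hs).ne, by linarith⟩
  · obtain ⟨T, hT⟩ : ∃ T, T ∈ Set.Ioi t ∧ 2 * T ^ 3 < 1 := by
      have hc : ContinuousAt (fun t : ℝ => 2 * t ^ 3) t := by fun_prop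
      have h1 := (hc.eventually (gt_mem_nhds ht'.2)).filter_mono (nhdsWithin_le_nhds (s := Set.Ioi t))
      have h2 : ∀ᶠ T in 𝓝[>] t, T ∈ Set.Ioi t := self_mem_nhdsWithin
      exact (h2.and h1).exists
    refine key (Set.Ioo 0 T) ?_ isOpen_Ioo isPreconnected_Ioo ?_ t ⟨h, hT.1⟩
    · rw [seriesDomain_eq]
      intro s hs
      have := pow_lt_pow_left₀ hs.2 hs.1.le (n := 3) (by norm_num)
      exact ⟨hs.1.ne', by linarith [hT.2]⟩
    · rw [closure_Ioo (h.trans hT.1).ne]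
      exact ⟨le_rfl, (h.trans hT.1).le⟩

lemma octAlpha_zero (ε : ℝ) : octAlpha ε 0 = 1 / 2 + ε * (Real.sqrt 3 / 3) := by
  have h : Real.sqrt ((1 + 0 + 0 ^ 2) / 3) = Real.sqrt 3 / 3 := by
    rw [Real.sqrt_eq_iff_mul_self_eq (by norm_num) (by positivity)]
    nlinarith [Real.sq_sqrt (show (0 : ℝ) ≤ 3 by norm_num)]
  rw [octAlpha, h]; ring

lemma hasDerivAt_octTerm_zero {ε : ℝ} (hε : ε ^ 2 = 1) : HasDerivAt (octTerm ε (fun _ => 1) 0)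
    ((ε * Real.sqrt 3 - 1) / 4 * octTerm ε (fun _ => 1) 0 0) 0 := by
  have h := hasDerivAt_abs_rpow_quarter (hasDerivAt_octAlpha (t := 0) hε)
    (octAlpha_ne_zero hε (by norm_num))
  have h2 : octTerm ε (fun _ => 1) 0 = fun t => |octAlpha ε t| ^ (1 / 4 : ℝ) :=
    funext fun t => octTerm_zero ε t
  rw [h2]
  refine h.congr_deriv ?_
  have h3 := octAlpha_ne_zero (t := 0) hε (by norm_num)
  have h4 := octAlpha_sub_ne (t := 0) hε
  have h5 := Real.sq_sqrt (show (0 : ℝ) ≤ 3 by norm_num)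
  have h6 : ε * Real.sqrt 3 * (ε * Real.sqrt 3) = 3 := by linear_combination ε ^ 2 * h5 + 3 * hε
  have h7 : (octAlpha ε 0 - (1 - 0) / 6) / (2 * octAlpha ε 0 - 1 - 0) / octAlpha ε 0 =
      ε * Real.sqrt 3 - 1 := by
    rw [div_div, div_eq_iff (mul_ne_zero h4 h3), octAlpha_zero]
    rw [show ε * (Real.sqrt 3 / 3) = ε * Real.sqrt 3 / 3 by ring]
    generalize ε * Real.sqrt 3 = z at *
    linear_combination (-(2 * z + 1) / 9) * h6
  rw [h7]
  beta_reduce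
  ring

lemma sqrt_three_gt_one : 1 < Real.sqrt 3 := by
  rw [Real.lt_sqrt (by norm_num)]; norm_num

/-- The values at `t = 0` of the two branches, weighted as in the connection formula for `familyP`,
agree. -/
lemma sqrt_mul_octTerm_zero :
    Real.sqrt (Real.sqrt 3 - 1) * octTerm 1 (fun _ => 1) 0 0 = (3 : ℝ) ^ (-(1 / 8) : ℝ) ∧
    Real.sqrt (Real.sqrt 3 + 1) * octTerm (-1) (fun _ => 1) 0 0 = (3 : ℝ) ^ (-(1 / 8) : ℝ) := by
  have h3 := Real.sq_sqrt (show (0 : ℝ) ≤ 3 by norm_num)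
  have h1 := sqrt_three_gt_one
  have key : ∀ x y : ℝ, 0 ≤ x → 0 ≤ y → x ^ 2 * y = (Real.sqrt 3)⁻¹ →
      Real.sqrt x * y ^ (1 / 4 : ℝ) = (3 : ℝ) ^ (-(1 / 8) : ℝ) := by
    intro x y hx hy h
    have e1 : Real.sqrt x = (x ^ 2) ^ (1 / 4 : ℝ) := by
      rw [Real.sqrt_eq_rpow, ← Real.rpow_two, ← Real.rpow_mul hx]; norm_num
    rw [e1, ← Real.mul_rpow (by positivity) hy, h, Real.sqrt_eq_rpow, ← Real.rpow_neg (by norm_num),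
      ← Real.rpow_mul (by norm_num)]
    norm_num
  rw [octTerm_zero, octTerm_zero, octAlpha_zero, octAlpha_zero]
  constructor
  · refine key _ _ (by linarith) (abs_nonneg _) ?_
    rw [abs_of_pos (by positivity)]
    field_simp
    generalize Real.sqrt 3 = r at *
    linear_combination (2 * r ^ 2 - r + 2) * h3
  · refine key _ _ (by linarith) (abs_nonneg _) ?_
    rw [abs_of_neg (by nlinarith)]
    field_simp
    generalize Real.sqrt 3 = r at *
    linear_combination (2 * r ^ 2 + r + 2) * h3

/-- The common analytic factor of `familyP 0 0` and `familyP' 0 0`. -/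
noncomputable def baseLegendre (c t : ℝ) : ℝ :=
  (1 - t ^ 3) ^ (-(1 / 4) : ℝ) * ₂F₁ (3 / 4 : ℝ) (1 / 4) c (legendreArg t)

lemma baseLegendre_zero (c : ℝ) : baseLegendre c 0 = 1 := by
  simp [baseLegendre, legendreArg, ordinaryHypergeometric_zero]

lemma analyticAt_baseLegendre {c : ℝ} (hc : NotInt c) : AnalyticAt ℝ (baseLegendre c) 0 := by
  have h34 : NotInt (3 / 4 : ℝ) := by simpa using notInt_legendre 0
  have h14 : NotInt (1 / 4 : ℝ) := by simpa using notInt_legendre' 0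
  have h1 : AnalyticAt ℝ (fun t : ℝ => 1 - t ^ 3) 0 := by fun_prop
  refine (h1.rpow_const_of_pos (by norm_num) _).mul (AnalyticAt.comp (g := ₂F₁ (3 / 4 : ℝ) (1 / 4) c)
    (analyticAt_hypergeometric h34 h14 hc (by norm_num [legendreArg])) ?_)
  exact AnalyticAt.div (by fun_prop) h1 (by norm_num)

/-- Both factors are functions of `t³`. -/
lemma hasDerivAt_baseLegendre {c : ℝ} (hc : NotInt c) : HasDerivAt (baseLegendre c) 0 0 := by
  have h34 : NotInt (3 / 4 : ℝ) := by simpa using notInt_legendre 0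
  have h14 : NotInt (1 / 4 : ℝ) := by simpa using notInt_legendre' 0
  have h1 := ((hasDerivAt_pow 3 (0 : ℝ)).const_sub 1).rpow_const (p := -(1 / 4))
    (Or.inl (by norm_num))
  have h2 := (hasDerivAt_hypergeometric h34 h14 hc (x := legendreArg 0)
    (by norm_num [legendreArg])).comp 0 (hasDerivAt_legendreArg one_pos)
  exact (h1.mul h2).congr_deriv (by simp)

lemma familyP_zero (t : ℝ) : familyP 0 0 t = (3 : ℝ) ^ (3 / 8 : ℝ) / 2 *
    (t * baseLegendre (4 / 3) t) := by
  simp [familyP, constP, liftLegendre, baseLegendre, risingFactorial_zero]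
  ring

lemma familyP'_zero (t : ℝ) : familyP' 0 0 t = (3 : ℝ) ^ (3 / 8 : ℝ) * Real.sqrt 2 *
    baseLegendre (2 / 3) t := by
  simp [familyP', constP', liftLegendre, baseLegendre, risingFactorial_zero]

lemma three_rpow : (3 : ℝ) ^ (3 / 8 : ℝ) = (3 : ℝ) ^ (-(1 / 8) : ℝ) * Real.sqrt 3 := by
  rw [Real.sqrt_eq_rpow, ← Real.rpow_add (by norm_num)]
  norm_num

lemma represents_familyP_zero : Represents familyP seriesDomain (Real.sqrt (Real.sqrt 3 - 1))
    (-Real.sqrt (Real.sqrt 3 + 1)) 0 0 fun _ => 1 := by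
  have hd : ∀ t ∈ seriesDomain, t < 1 ∧ t ≠ 0 := fun t ht => ⟨ht.1, ht.2.1⟩
  have hE := SolvesBaseEquation.octTerm_one (ε := 1) (by norm_num) hd
  have hE' := SolvesBaseEquation.octTerm_one (ε := -1) (by norm_num) hd
  obtain ⟨v1, v2⟩ := sqrt_mul_octTerm_zero
  have hc : NotInt (4 / 3 : ℝ) := by simpa using notInt_neg_order 0
  set a := Real.sqrt (Real.sqrt 3 - 1)
  set b := Real.sqrt (Real.sqrt 3 + 1)
  have hZ := (SolvesBaseEquation.of_isLadder isLadder_familyP hd).sub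
    ((hE.const_mul a).sub (hE'.const_mul b))
  simp_rw [familyP_zero] at hZ
  have d1 : HasDerivAt _ _ (0 : ℝ) := (((hasDerivAt_id (0 : ℝ)).mul
      (hasDerivAt_baseLegendre hc)).const_mul
    ((3 : ℝ) ^ (3 / 8 : ℝ) / 2)).sub (((hasDerivAt_octTerm_zero (ε := 1) (by norm_num)).const_mul
      a).sub ((hasDerivAt_octTerm_zero (ε := -1) (by norm_num)).const_mul b))
  have h := hZ.eq_zero_of_zero ?_ ?_ (d1.deriv.trans ?_)
  · intro t ht
    have := h t ht
    rw [familyP_zero, add_zero]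
    linarith
  · exact (analyticAt_const.mul (analyticAt_id.mul (analyticAt_baseLegendre hc))).sub
      ((analyticAt_const.mul (analyticAt_octTerm_zero (octAlpha_one_pos 0).ne')).sub
        (analyticAt_const.mul (analyticAt_octTerm_zero (octAlpha_neg_one_neg one_pos).ne)))
  · rw [v1, v2]; ring
  · simp only [id, baseLegendre_zero]
    linear_combination three_rpow / 2 - (Real.sqrt 3 - 1) / 4 * v1 -
      (Real.sqrt 3 + 1) / 4 * v2

lemma represents_familyP'_zero : Represents familyP' seriesDomain (Real.sqrt (Real.sqrt 3 + 1))
    (Real.sqrt (Real.sqrt 3 - 1)) 0 0 fun _ => 1 := by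
  have hd : ∀ t ∈ seriesDomain, t < 1 ∧ t ≠ 0 := fun t ht => ⟨ht.1, ht.2.1⟩
  have hE := SolvesBaseEquation.octTerm_one (ε := 1) (by norm_num) hd
  have hE' := SolvesBaseEquation.octTerm_one (ε := -1) (by norm_num) hd
  obtain ⟨v1, v2⟩ := sqrt_mul_octTerm_zero
  have hc : NotInt (2 / 3 : ℝ) := by simpa using notInt_pos_order 0
  have h1 := sqrt_three_gt_one
  have ha := Real.sq_sqrt (show 0 ≤ Real.sqrt 3 - 1 by linarith)
  have hb := Real.sq_sqrt (show 0 ≤ Real.sqrt 3 + 1 by linarith)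
  have hab : Real.sqrt (Real.sqrt 3 - 1) * Real.sqrt (Real.sqrt 3 + 1) = Real.sqrt 2 := by
    rw [← Real.sqrt_mul (by linarith)]
    congr 1
    linear_combination Real.sq_sqrt (show (0 : ℝ) ≤ 3 by norm_num)
  have ha0 := Real.sqrt_pos.2 (show 0 < Real.sqrt 3 - 1 by linarith)
  have hb0 := Real.sqrt_pos.2 (show 0 < Real.sqrt 3 + 1 by linarith)
  set a := Real.sqrt (Real.sqrt 3 - 1)
  set b := Real.sqrt (Real.sqrt 3 + 1)
  -- the values of the two branches at `0`, with the weights of `familyP'`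
  have w1 : Real.sqrt 2 * (b * octTerm 1 (fun _ => 1) 0 0) =
      (Real.sqrt 3 + 1) * (3 : ℝ) ^ (-(1 / 8) : ℝ) := by
    rw [← hab, ← hb, ← v1]; ring
  have w2 : Real.sqrt 2 * (a * octTerm (-1) (fun _ => 1) 0 0) =
      (Real.sqrt 3 - 1) * (3 : ℝ) ^ (-(1 / 8) : ℝ) := by
    rw [← hab, ← ha, ← v2]; ring
  have hs2 := Real.sqrt_pos.2 (show (0 : ℝ) < 2 by norm_num)
  have hs2' := Real.sq_sqrt (show (0 : ℝ) ≤ 2 by norm_num)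
  have hZ := (SolvesBaseEquation.of_isLadder isLadder_familyP' hd).sub
    ((hE.const_mul b).sub (hE'.const_mul (-a)))
  simp_rw [familyP'_zero] at hZ
  have d1 : HasDerivAt _ _ (0 : ℝ) := ((hasDerivAt_baseLegendre hc).const_mul
    ((3 : ℝ) ^ (3 / 8 : ℝ) * Real.sqrt 2)).sub (((hasDerivAt_octTerm_zero (ε := 1)
      (by norm_num)).const_mul b).sub ((hasDerivAt_octTerm_zero (ε := -1)
      (by norm_num)).const_mul (-a)))
  have h := hZ.eq_zero_of_zero ?_ ?_ (d1.deriv.trans ?_)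
  · intro t ht
    have := h t ht
    rw [familyP'_zero, add_zero]
    linarith
  · exact (analyticAt_const.mul (analyticAt_baseLegendre hc)).sub
      ((analyticAt_const.mul (analyticAt_octTerm_zero (octAlpha_one_pos 0).ne')).sub
        (analyticAt_const.mul (analyticAt_octTerm_zero (octAlpha_neg_one_neg one_pos).ne)))
  · rw [baseLegendre_zero]
    refine (mul_eq_zero.1 (?_ : Real.sqrt 2 * _ = 0)).resolve_left hs2.ne'
    linear_combination -w1 - w2 + 2 * three_rpow + (3 : ℝ) ^ (3 / 8 : ℝ) * hs2'
  · refine (mul_eq_zero.1 (?_ : Real.sqrt 2 * _ = 0)).resolve_left hs2.ne'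
    linear_combination (-(Real.sqrt 3 - 1) / 4) * w1 + (Real.sqrt 3 + 1) / 4 * w2

end BaseLegendre

/-- For every pair of indices there is one rational function of the octahedral parameter that gives
all four families. -/
lemma exists_isOctahedralData (n m : ℤ) : ∃ ρ, IsOctahedralData n m ρ :=
  IsOctahedralData.exists_of_zero
    ⟨.const 1, represents_familyQ_zero, represents_familyQ'_zero, represents_familyP_zero,
      represents_familyP'_zero⟩ n m

/-! ### Continuation of the Gauss function -/

/-- An analytic function on `(-∞, 0)` that agrees with the Gauss series on `(-1, 0)` is its
continuation. -/
lemma gaussF_eq_of_neg {a b c : ℝ} (ha : NotInt a) (hb : NotInt b) (hc : NotInt c) {G : ℝ → ℝ}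
    (hG : AnalyticOnNhd ℝ G (Set.Iio 0)) (h : ∀ y ∈ Set.Ioo (-1 : ℝ) 0, ₂F₁ a b c y = G y)
    {y : ℝ} (hy : y < 0) : gaussF a b c y = G y := by
  classical
  have hex : ∃ F, IsGaussContinuation a b c F := by
    set F : ℝ → ℝ := fun y => if y < 0 then G y else ₂F₁ a b c y with hF
    have h1 : ∀ x ∈ Set.Ioo (-1 : ℝ) 1, F x = ₂F₁ a b c x := by
      intro x hx
      by_cases h0 : x < 0
      · rw [hF]; simp only [if_pos h0]; exact (h x ⟨hx.1, h0⟩).symm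
      · simp only [hF, if_neg h0]
    refine ⟨F, fun x hx => ?_, h1⟩
    by_cases h0 : x < 0
    · refine (hG x h0).congr ?_
      filter_upwards [gt_mem_nhds h0] with z hz
      simp only [hF, if_pos hz]
    · have hx' : x ∈ Set.Ioo (-1 : ℝ) 1 := ⟨by linarith, hx⟩
      refine (analyticAt_hypergeometric ha hb hc (abs_lt.2 hx')).congr ?_
      filter_upwards [isOpen_Ioo.mem_nhds hx'] with z hz using (h1 z hz).symm
  obtain ⟨hs1, hs2⟩ : IsGaussContinuation a b c (gaussF a b c) := Classical.epsilon_spec hex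
  have hm : (-(1 / 2) : ℝ) ∈ Set.Ioo (-1 : ℝ) 0 := by constructor <;> norm_num
  refine (hs1.mono (Set.Iio_subset_Iio zero_le_one)).eqOn_of_preconnected_of_eventuallyEq hG
    isPreconnected_Iio hm.2 ?_ hy
  filter_upwards [isOpen_Ioo.mem_nhds hm] with z hz
  rw [hs2 z ⟨hz.1, hz.2.trans one_pos⟩, h z hz]

/-- The inverse of `legendreArg`, from `(-∞, 0)` to `(0, 1)`. -/
noncomputable def legendreArgInv (y : ℝ) : ℝ := (y / (y - 1)) ^ (1 / 3 : ℝ)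

section LegendreArgInv

variable {y t : ℝ}

lemma legendreArgInv_cube (hy : y < 0) : legendreArgInv y ^ 3 = y / (y - 1) := by
  have h := div_pos_of_neg_of_neg hy (by linarith : y - 1 < 0)
  rw [legendreArgInv, ← Real.rpow_natCast, ← Real.rpow_mul h.le]
  norm_num

lemma legendreArgInv_mem (hy : y < 0) : legendreArgInv y ∈ Set.Ioo (0 : ℝ) 1 := by
  have h := div_pos_of_neg_of_neg hy (by linarith : y - 1 < 0)
  refine ⟨Real.rpow_pos_of_pos h _, Real.rpow_lt_one h.le ?_ (by norm_num)⟩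
  rw [div_lt_one_of_neg (by linarith)]
  linarith

lemma legendreArg_legendreArgInv (hy : y < 0) : legendreArg (legendreArgInv y) = y := by
  have h : y - 1 ≠ 0 := by linarith
  rw [legendreArg, legendreArgInv_cube hy]
  field_simp
  ring

lemma legendreArg_neg (ht : t ∈ Set.Ioo (0 : ℝ) 1) : legendreArg t < 0 :=
  div_neg_of_neg_of_pos (neg_neg_of_pos (pow_pos ht.1 3)) (one_sub_cube_pos ht.2)

lemma legendreArgInv_legendreArg (ht : t ∈ Set.Ioo (0 : ℝ) 1) :
    legendreArgInv (legendreArg t) = t := by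
  have hy := legendreArg_neg ht
  have h1 := legendreArgInv_cube hy
  have hp := (one_sub_cube_pos ht.2).ne'
  have h2 : legendreArg t / (legendreArg t - 1) = t ^ 3 := by
    have h3 : legendreArg t - 1 ≠ 0 := by linarith
    rw [div_eq_iff h3, legendreArg]
    field_simp
    ring
  rw [h2] at h1
  exact (pow_left_inj₀ (legendreArgInv_mem hy).1.le ht.1.le (by norm_num)).1 h1

lemma analyticAt_legendreArgInv (hy : y < 0) : AnalyticAt ℝ legendreArgInv y :=
  AnalyticAt.rpow_const_of_pos (f := fun y => y / (y - 1))
    (AnalyticAt.div (by fun_prop) (by fun_prop) (by linarith))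
    (div_pos_of_neg_of_neg hy (by linarith)) _

/-- A formula for the Gauss series in terms of a function analytic on `(0, 1)` stays true for the
continued Gauss function. -/
lemma eq_liftLegendre_gaussF {a b c C : ℝ} {j m : ℤ} (ha : NotInt a) (hb : NotInt b)
    (hc : NotInt c) (hC : C ≠ 0) {H : ℝ → ℝ} (hH : AnalyticOnNhd ℝ H (Set.Ioo 0 1))
    (h : ∀ t ∈ seriesDomain, C * liftLegendre j m (₂F₁ a b c) t = H t)
    (ht : t ∈ Set.Ioo (0 : ℝ) 1) : C * liftLegendre j m (gaussF a b c) t = H t := by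
  have hw : ∀ t ∈ Set.Ioo (0 : ℝ) 1, C * (t ^ j * (1 - t ^ 3) ^ ((m : ℝ) - 1 / 4)) ≠ 0 :=
    fun t ht => mul_ne_zero hC (mul_ne_zero (zpow_ne_zero _ ht.1.ne')
      (Real.rpow_pos_of_pos (one_sub_cube_pos ht.2) _).ne')
  have ha' : AnalyticOnNhd ℝ (fun t : ℝ => H t / (C * (t ^ j * (1 - t ^ 3) ^ ((m : ℝ) - 1 / 4))))
      (Set.Ioo 0 1) := fun t ht => by
    refine (hH t ht).div (analyticAt_const.mul ((AnalyticAt.zpow analyticAt_id ht.1.ne').mul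
      (AnalyticAt.rpow_const_of_pos (f := fun t => 1 - t ^ 3) (by fun_prop)
        (one_sub_cube_pos ht.2) _))) (hw t ht)
  have key := gaussF_eq_of_neg ha hb hc (G := fun y => H (legendreArgInv y) /
      (C * (legendreArgInv y ^ j * (1 - legendreArgInv y ^ 3) ^ ((m : ℝ) - 1 / 4))))
    (fun y hy => (ha' _ (legendreArgInv_mem hy)).comp (analyticAt_legendreArgInv hy))
    (fun y hy => ?_) (legendreArg_neg ht)
  · rw [liftLegendre, key, legendreArgInv_legendreArg ht, ← mul_assoc, mul_div_cancel₀ _ (hw t ht)]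
  · have hm := legendreArgInv_mem hy.2
    have hs : legendreArgInv y ∈ seriesDomain :=
      ⟨hm.2, hm.1.ne', by rw [legendreArg_legendreArgInv hy.2, abs_lt]; exact ⟨hy.1, by linarith [hy.2]⟩⟩
    rw [eq_div_iff (hw _ hm), ← h _ hs, liftLegendre, legendreArg_legendreArgInv hy.2]
    ring

end LegendreArgInv

lemma analyticAt_polynomial_eval (p : Polynomial ℝ) (u : ℝ) :
    AnalyticAt ℝ (fun u => p.eval u) u := by
  simpa using AnalyticAt.aeval_polynomial (analyticAt_id (𝕜 := ℝ) (z := u)) p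

lemma IsOctRational.analyticAt {ρ : ℝ → ℝ} (hρ : IsOctRational ρ) {u : ℝ}
    (hu : octDenom.eval u ≠ 0) : AnalyticAt ℝ ρ u := by
  obtain ⟨q, k, hq⟩ := hρ
  have hp := fun p => analyticAt_polynomial_eval p u
  refine ((hp q).div ((hp octDenom).pow k) (pow_ne_zero k hu)).congr ?_
  filter_upwards [octDenom.continuous.continuousAt.eventually_ne hu] with v hv
  exact (hq v hv).symm

lemma analyticAt_octU {ε t : ℝ} (hε : ε ^ 2 = 1) (ht : t < 1) : AnalyticAt ℝ (octU ε) t :=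
  AnalyticAt.div ((by fun_prop : AnalyticAt ℝ (fun t : ℝ => 1 + t) t).sub (analyticAt_octAlpha ε t))
    (analyticAt_octAlpha ε t) (octAlpha_ne_zero hε ht)

lemma analyticAt_octTerm {ε t : ℝ} {ρ : ℝ → ℝ} (hε : ε ^ 2 = 1) (k : ℤ) (hρ : IsOctRational ρ)
    (ht : t < 1) (h0 : t ≠ 0) : AnalyticAt ℝ (octTerm ε ρ k) t := by
  have h1 : AnalyticAt ℝ (fun t => |octAlpha ε t| ^ (1 / 4 : ℝ)) t :=
    (analyticAt_octTerm_zero (octAlpha_ne_zero hε ht)).congr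
      (Eventually.of_forall fun s => octTerm_zero ε s)
  exact (h1.mul ((analyticAt_octAlpha ε t).zpow (octAlpha_ne_zero hε ht))).mul
    ((hρ.analyticAt (octDenom_octU_ne_zero hε ht h0)).comp (analyticAt_octU hε ht))

lemma constP_ne_zero (n m : ℤ) : constP n m ≠ 0 :=
  div_ne_zero (mul_ne_zero (mul_ne_zero (by positivity) (by positivity))
      (risingFactorial_ne_zero notInt_thirteen_twelfths _))
    (mul_ne_zero (risingFactorial_ne_zero notInt_quarter _)
      (risingFactorial_ne_zero notInt_four_thirds _))

lemma constP'_ne_zero (n m : ℤ) : constP' n m ≠ 0 :=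
  div_ne_zero (mul_ne_zero (mul_ne_zero (by positivity) (by positivity))
      (risingFactorial_ne_zero notInt_five_twelfths _))
    (mul_ne_zero (risingFactorial_ne_zero notInt_quarter _)
      (risingFactorial_ne_zero notInt_two_thirds _))

namespace IsOctahedralData

variable {n m : ℤ} {ρ : ℝ → ℝ} {t : ℝ}

lemma analyticOnNhd_combination (h : IsOctRational ρ) (w w' : ℝ) (k : ℤ) : AnalyticOnNhd ℝ
    (fun t => w * octTerm 1 ρ k t + w' * octTerm (-1) ρ k t) (Set.Ioo 0 1) := fun t ht =>
  (analyticAt_const.mul (analyticAt_octTerm (by norm_num) k h ht.2 ht.1.ne')).add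
    (analyticAt_const.mul (analyticAt_octTerm (by norm_num) k h ht.2 ht.1.ne'))

/-- The formula for `familyP`, continued beyond the disk of convergence. -/
lemma gaussF_neg_order (h : IsOctahedralData n m ρ) (ht : t ∈ Set.Ioo (0 : ℝ) 1) :
    constP n m * liftLegendre (1 + 3 * n) m
      (gaussF (3 / 4 + (m : ℝ)) (1 / 4 - (m : ℝ)) (4 / 3 + (n : ℝ))) t =
    Real.sqrt (Real.sqrt 3 - 1) * octTerm 1 ρ (n + m) t +
      -Real.sqrt (Real.sqrt 3 + 1) * octTerm (-1) ρ (n + m) t :=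
  eq_liftLegendre_gaussF (notInt_legendre m) (notInt_legendre' m) (notInt_neg_order n)
    (constP_ne_zero n m) (analyticOnNhd_combination h.isOctRational _ _ _) h.familyP ht

/-- The formula for `familyP'`, continued beyond the disk of convergence. -/
lemma gaussF_pos_order (h : IsOctahedralData n m ρ) (ht : t ∈ Set.Ioo (0 : ℝ) 1) :
    constP' n m * liftLegendre 0 m
      (gaussF (3 / 4 + (m : ℝ)) (1 / 4 - (m : ℝ)) (2 / 3 - (n : ℝ))) t =
    Real.sqrt (Real.sqrt 3 + 1) * octTerm 1 ρ (n + m) t +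
      Real.sqrt (Real.sqrt 3 - 1) * octTerm (-1) ρ (n + m) t :=
  eq_liftLegendre_gaussF (notInt_legendre m) (notInt_legendre' m) (notInt_pos_order n)
    (constP'_ne_zero n m) (analyticOnNhd_combination h.isOctRational _ _ _) h.familyP' ht

end IsOctahedralData

/-! ### Existence and uniqueness of the octahedral functions -/

lemma ratFunc_eval_id (r : RatFunc ℝ) (u : ℝ) :
    r.eval (RingHom.id ℝ) u = r.num.eval u / r.denom.eval u := by
  simp [RatFunc.eval, Polynomial.eval₂_id]

/-- A rational function is determined by its values near a point. -/
lemma RatFunc.eq_of_eventually_eval_eq {r s : RatFunc ℝ} {u₀ : ℝ}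
    (h : ∀ᶠ u in 𝓝 u₀, r.eval (RingHom.id ℝ) u = s.eval (RingHom.id ℝ) u) : r = s := by
  have hzero : (r.num * s.denom - s.num * r.denom) * (r.denom * s.denom) = 0 := by
    refine Polynomial.eq_zero_of_infinite_isRoot _ ((infinite_of_mem_nhds u₀ h).mono fun u hu => ?_)
    have hu' : r.eval (RingHom.id ℝ) u = s.eval (RingHom.id ℝ) u := hu
    rw [ratFunc_eval_id, ratFunc_eval_id] at hu'
    change Polynomial.eval u _ = 0
    simp only [Polynomial.eval_mul, Polynomial.eval_sub]
    by_cases h1 : r.denom.eval u = 0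
    · rw [h1]; ring
    by_cases h2 : s.denom.eval u = 0
    · rw [h2]; ring
    rw [div_eq_div_iff h1 h2] at hu'
    rw [hu']; ring
  have h1 := (mul_eq_zero.1 hzero).resolve_right
    (mul_ne_zero r.denom_ne_zero s.denom_ne_zero)
  have hr := RatFunc.algebraMap_ne_zero r.denom_ne_zero
  have hs := RatFunc.algebraMap_ne_zero s.denom_ne_zero
  rw [← r.num_div_denom, ← s.num_div_denom, div_eq_div_iff hr hs, ← map_mul, ← map_mul,
    sub_eq_zero.1 h1]

lemma octDenom_ne_zero : octDenom ≠ 0 := fun h => by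
  have h1 := eval_octDenom (-1)
  rw [h] at h1
  norm_num [octPv] at h1

lemma octahedralPe_pos_near_zero : ∀ᶠ u in 𝓝 (0 : ℝ), 0 < octahedralPe u := by
  have hc : ContinuousAt octahedralPe 0 := by unfold octahedralPe; fun_prop
  exact hc.eventually (lt_mem_nhds (by norm_num [octahedralPe]))

/-- If a quotient of polynomials extends analytically to `0`, then the reduced denominator does not
vanish there and the rational function takes the values of the extension near `0`. -/
lemma RatFunc.eval_eventually_eq {q d : Polynomial ℝ} {g : ℝ → ℝ} (hg : AnalyticAt ℝ g 0)
    (hd : d ≠ 0) (h : ∃ᶠ u in 𝓝[≠] (0 : ℝ), g u * d.eval u = q.eval u) :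
    ∀ᶠ u in 𝓝 (0 : ℝ), g u = RatFunc.eval (RingHom.id ℝ) u
      (algebraMap (Polynomial ℝ) (RatFunc ℝ) q / algebraMap (Polynomial ℝ) (RatFunc ℝ) d) := by
  set r : RatFunc ℝ := algebraMap (Polynomial ℝ) (RatFunc ℝ) q / algebraMap _ _ d with hr
  have hp := fun p => analyticAt_polynomial_eval p 0
  have h1 : ∀ᶠ u in 𝓝 (0 : ℝ), g u * d.eval u = q.eval u :=
    ((hg.mul (hp d)).frequently_eq_iff_eventually_eq (hp q)).1 h
  have h2 : r.num * d = q * r.denom := (RatFunc.num_mul_eq_mul_denom_iff hd).2 hr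
  have h3 : ∃ᶠ u in 𝓝[≠] (0 : ℝ), g u * r.denom.eval u = r.num.eval u := by
    have hd0 : ∀ᶠ u in 𝓝[≠] (0 : ℝ), d.eval u ≠ 0 := by
      rcases (hp d).eventually_eq_zero_or_eventually_ne_zero with h0 | h0
      · exact absurd (Polynomial.eq_zero_of_infinite_isRoot d (infinite_of_mem_nhds 0 h0)) hd
      · exact h0
    refine Eventually.frequently ?_
    filter_upwards [hd0, h1.filter_mono nhdsWithin_le_nhds] with u hu hu1
    have h4 := congrArg (Polynomial.eval u) h2
    simp only [Polynomial.eval_mul] at h4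
    apply mul_right_cancel₀ hu
    rw [h4, ← hu1]; ring
  have h4 : ∀ᶠ u in 𝓝 (0 : ℝ), g u * r.denom.eval u = r.num.eval u :=
    ((hg.mul (hp _)).frequently_eq_iff_eventually_eq (hp _)).1 h3
  have h5 : r.denom.eval 0 ≠ 0 := by
    intro h0
    have h6 := h4.self_of_nhds
    rw [h0, mul_zero] at h6
    obtain ⟨a, b, hab⟩ := r.isCoprime_num_denom
    have := congrArg (Polynomial.eval 0) hab
    simp [h0, ← h6] at this
  filter_upwards [h4, r.denom.continuous.continuousAt.eventually_ne h5] with u hu hu0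
  rw [ratFunc_eval_id, eq_div_iff hu0, hu]

lemma octahedralR_octU {ε t : ℝ} (hε : ε ^ 2 = 1) (h0 : 0 < t) (h1 : t < 1) :
    octahedralR (octU ε t) = tanhSq t := by
  have hα := octAlpha_ne_zero (t := t) hε h1
  have hpe := octahedralPe_octU (t := t) hε h1
  have hs := one_sub_cube_sq (t := t) hε h1
  have hp := one_add_cube_pos h0
  have hpe' : octahedralPe (octU ε t) = 4 * (1 + t ^ 3) / octAlpha ε t ^ 3 := by
    rw [eq_div_iff (pow_ne_zero 3 hα), hpe]
  rw [octahedralR, hpe', tanhSq, div_pow (1 - t ^ 3), hs]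
  have := hp.ne'
  field_simp
  ring

namespace IsOctahedralData

variable {n m : ℤ} {ρ : ℝ → ℝ}

/-- The formula for `familyQ` in the form of the implicit definition of `r^m_n`. -/
lemma hypergeometric_eq (h : IsOctahedralData n m ρ) {t : ℝ} (ht : t ∈ Set.Ioo (0 : ℝ) 1) :
    ₂F₁ (-(1 / 24) - (m : ℝ) / 2 - (n : ℝ) / 2) (11 / 24 - (m : ℝ) / 2 - (n : ℝ) / 2)
        (3 / 4 - (m : ℝ)) (octahedralR (octU 1 t)) *
      octahedralPe (octU 1 t) ^ (1 / 12 + (m : ℝ) + (n : ℝ)) = ρ (octU 1 t) := by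
  have e := h.familyQ t ht
  have hα := octAlpha_one_pos t
  have hpe := octahedralPe_octU (ε := 1) (t := t) (by norm_num) ht.2
  have hp := one_add_cube_pos ht.1
  have hpe0 : 0 < octahedralPe (octU 1 t) :=
    pos_of_mul_pos_left (by rw [hpe]; positivity) (pow_pos hα 3).le
  rw [_root_.familyQ, liftTanhSq, ← hpe, Real.mul_rpow hpe0.le (by positivity), octTerm, abs_of_pos hα,
    ← octahedralR_octU (ε := 1) (by norm_num) ht.1 ht.2] at e
  have e2 : (octAlpha 1 t ^ 3) ^ (1 / 12 + (m : ℝ) + (n : ℝ)) =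
      octAlpha 1 t ^ (1 / 4 : ℝ) * octAlpha 1 t ^ (3 * (n + m)) := by
    rw [← Real.rpow_natCast, ← Real.rpow_mul hα.le, ← Real.rpow_intCast, ← Real.rpow_add hα]
    congr 1
    push_cast
    ring
  rw [e2] at e
  have hw : octAlpha 1 t ^ (1 / 4 : ℝ) * octAlpha 1 t ^ (3 * (n + m)) ≠ 0 := by positivity
  apply mul_left_cancel₀ hw
  linear_combination e

lemma frequently_octU {p : ℝ → Prop} (h : ∀ t ∈ Set.Ioo (0 : ℝ) 1, p (octU 1 t)) :
    ∃ᶠ u in 𝓝[≠] (0 : ℝ), p u := by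
  have hα : octAlpha 1 1 = 2 := by norm_num [octAlpha]
  have hc : ContinuousAt (octU 1) 1 :=
    ((continuousAt_const.add continuousAt_id).sub (analyticAt_octAlpha 1 1).continuousAt).div
      (analyticAt_octAlpha 1 1).continuousAt (by rw [hα]; norm_num)
  have h0 : octU 1 1 = 0 := by rw [octU, hα]; norm_num
  have hlim : Tendsto (octU 1) (𝓝[<] 1) (𝓝[≠] 0) := by
    refine tendsto_nhdsWithin_iff.2 ⟨?_, ?_⟩
    · exact h0 ▸ hc.tendsto.mono_left nhdsWithin_le_nhds
    · filter_upwards [self_mem_nhdsWithin] with t ht using octU_ne_zero (by norm_num) ht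
  refine hlim.frequently (Eventually.frequently ?_)
  filter_upwards [Ioo_mem_nhdsLT (show (0 : ℝ) < 1 by norm_num)] with t ht using h t ht

lemma exists_isOctahedralFunction (h : IsOctahedralData n m ρ) : ∃ r : RatFunc ℝ,
    IsOctahedralFunction n m r ∧
      ∀ u, octDenom.eval u ≠ 0 → r.eval (RingHom.id ℝ) u = ρ u := by
  obtain ⟨q, k, hq⟩ := h.isOctRational
  have hd : octDenom ^ k ≠ 0 := pow_ne_zero k octDenom_ne_zero
  set g : ℝ → ℝ := fun u =>
    ₂F₁ (-(1 / 24) - (m : ℝ) / 2 - (n : ℝ) / 2) (11 / 24 - (m : ℝ) / 2 - (n : ℝ) / 2)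
        (3 / 4 - (m : ℝ)) (octahedralR u) * octahedralPe u ^ (1 / 12 + (m : ℝ) + (n : ℝ)) with hg
  have hpe : AnalyticAt ℝ octahedralPe 0 := by unfold octahedralPe; fun_prop
  have hpe0 : octahedralPe 0 = 1 := by norm_num [octahedralPe]
  have hR : AnalyticAt ℝ octahedralR 0 := by
    unfold octahedralR
    exact AnalyticAt.div (by fun_prop) (hpe.pow 2) (by simp [hpe0])
  have hga : AnalyticAt ℝ g 0 := by
    refine (AnalyticAt.comp (analyticAt_hypergeometric (notInt_a n m) (notInt_b n m) (notInt_c m)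
      ?_) hR).mul (hpe.rpow_const_of_pos (by rw [hpe0]; norm_num) _)
    simp [octahedralR]
  have hfreq : ∃ᶠ u in 𝓝[≠] (0 : ℝ), g u * (octDenom ^ k).eval u = q.eval u := by
    refine frequently_octU fun t ht => ?_
    have hu := octDenom_octU_ne_zero (ε := 1) (by norm_num) ht.2 ht.1.ne'
    rw [hg]
    beta_reduce
    rw [h.hypergeometric_eq ht, hq _ hu, Polynomial.eval_pow, div_mul_cancel₀ _ (pow_ne_zero k hu)]
  refine ⟨algebraMap _ _ q / algebraMap _ _ (octDenom ^ k), ?_, fun u hu => ?_⟩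
  · filter_upwards [RatFunc.eval_eventually_eq hga hd hfreq, octahedralPe_pos_near_zero] with u hu hp
    rw [← hu, hg, mul_comm, mul_assoc, ← Real.rpow_add hp]
    ring_nf
    simp
  · set r : RatFunc ℝ := algebraMap _ _ q / algebraMap _ _ (octDenom ^ k) with hr
    have h2 : r.num * octDenom ^ k = q * r.denom := (RatFunc.num_mul_eq_mul_denom_iff hd).2 hr
    have h3 := congrArg (Polynomial.eval u) h2
    obtain ⟨d, h4⟩ : r.denom ∣ octDenom ^ k := RatFunc.denom_div_dvd _ _
    have h5 := congrArg (Polynomial.eval u) h4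
    simp only [Polynomial.eval_mul, Polynomial.eval_pow] at h3 h5
    have h6 : r.denom.eval u ≠ 0 := left_ne_zero_of_mul (h5 ▸ pow_ne_zero k hu)
    rw [ratFunc_eval_id, hq u hu, div_eq_div_iff h6 (pow_ne_zero k hu), h3]

end IsOctahedralData

lemma IsOctahedralFunction.unique {n m : ℤ} {r s : RatFunc ℝ} (hr : IsOctahedralFunction n m r)
    (hs : IsOctahedralFunction n m s) : r = s := by
  refine RatFunc.eq_of_eventually_eval_eq (u₀ := 0) ?_
  filter_upwards [hr, hs, octahedralPe_pos_near_zero] with u h1 h2 hp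
  exact mul_left_cancel₀ (Real.rpow_pos_of_pos hp _).ne' (h1.symm.trans h2)

lemma existsUnique_isOctahedralFunction (n m : ℤ) : ∃! r : RatFunc ℝ, IsOctahedralFunction n m r := by
  obtain ⟨ρ, hρ⟩ := exists_isOctahedralData n m
  obtain ⟨r, hr, -⟩ := hρ.exists_isOctahedralFunction
  exact ⟨r, hr, fun s hs => hs.unique hr⟩

/-- The four families are given by the octahedral function itself. -/
lemma isOctahedralData_octahedralEval (n m : ℤ) : IsOctahedralData n m (octahedralEval n m) := by
  obtain ⟨ρ, hρ⟩ := exists_isOctahedralData n m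
  obtain ⟨r, hr, he⟩ := hρ.exists_isOctahedralFunction
  have h1 : octahedralFunction n m = r :=
    IsOctahedralFunction.unique (Classical.epsilon_spec ⟨r, hr⟩) hr
  have h2 : ∀ u, octDenom.eval u ≠ 0 → octahedralEval n m u = ρ u := fun u hu => by
    rw [octahedralEval, h1, he u hu]
  refine hρ.step (hρ.isOctRational.congr h2) fun Y s w w' _ _ hs hY t ht => ?_
  obtain ⟨ht1, ht0⟩ := hs t ht
  rw [hY t ht]
  simp only [octTerm]
  rw [h2 _ (octDenom_octU_ne_zero (by norm_num) ht1 ht0),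
    h2 _ (octDenom_octU_ne_zero (by norm_num) ht1 ht0)]

/-! ### Special values of the Gamma function -/

/-- `Γ(s/3) Γ((s+1)/3) Γ((s+2)/3) 3^{s-1}`, normalized to be `1` at `s = 1`. -/
noncomputable def triplingGamma (s : ℝ) : ℝ :=
  Real.Gamma ((s + 0) / 3) * Real.Gamma ((s + 1) / 3) * Real.Gamma ((s + 2) / 3) * 3 ^ (s - 1) /
    (Real.Gamma (1 / 3) * Real.Gamma (2 / 3))

lemma convexOn_log_Gamma_third (k : ℝ) (hk : 0 ≤ k) :
    ConvexOn ℝ (Set.Ioi 0) fun s => Real.log (Real.Gamma ((s + k) / 3)) := by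
  refine ⟨convex_Ioi 0, fun x hx y hy a b ha hb hab => ?_⟩
  have hx' : 0 < (x + k) / 3 := div_pos (add_pos_of_pos_of_nonneg hx hk) three_pos
  have hy' : 0 < (y + k) / 3 := div_pos (add_pos_of_pos_of_nonneg hy hk) three_pos
  have h := Real.convexOn_log_Gamma.2 hx' hy' ha hb hab
  simp only [smul_eq_mul, Function.comp_apply] at h ⊢
  convert h using 3
  linear_combination (-(k / 3)) * hab

/-- By the Bohr–Mollerup theorem. -/
lemma triplingGamma_eq_Gamma {s : ℝ} (hs : 0 < s) : triplingGamma s = Real.Gamma s := by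
  have hc : 0 < Real.Gamma (1 / 3) * Real.Gamma (2 / 3) :=
    mul_pos (Real.Gamma_pos_of_pos (by norm_num)) (Real.Gamma_pos_of_pos (by norm_num))
  have hk : ∀ {x : ℝ}, 0 < x → ∀ k : ℝ, 0 ≤ k → 0 < Real.Gamma ((x + k) / 3) := fun hx k hk =>
    Real.Gamma_pos_of_pos (by positivity)
  refine Real.eq_Gamma_of_log_convex ?_ (fun {y} hy => ?_) (fun {y} hy => ?_) ?_ hs
  · have hlog : ∀ s ∈ Set.Ioi (0 : ℝ), (Real.log (Real.Gamma ((s + 0) / 3)) +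
        Real.log (Real.Gamma ((s + 1) / 3)) + Real.log (Real.Gamma ((s + 2) / 3)) +
        Real.log 3 * s) + (-Real.log 3 - Real.log (Real.Gamma (1 / 3) * Real.Gamma (2 / 3))) =
        (Real.log ∘ triplingGamma) s := by
      intro s hs
      have h0 := (hk hs 0 le_rfl).ne'
      have h1 := (hk hs 1 zero_le_one).ne'
      have h2 := (hk hs 2 zero_le_two).ne'
      have h3 : (3 : ℝ) ^ (s - 1) ≠ 0 := (Real.rpow_pos_of_pos three_pos _).ne'
      rw [Function.comp_apply, triplingGamma, Real.log_div (by positivity) hc.ne',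
        Real.log_mul (by positivity) h3, Real.log_mul (by positivity) h2, Real.log_mul h0 h1,
        Real.log_rpow three_pos]
      ring
    refine ConvexOn.congr ?_ hlog
    refine ((((convexOn_log_Gamma_third 0 le_rfl).add (convexOn_log_Gamma_third 1 zero_le_one)).add
      (convexOn_log_Gamma_third 2 zero_le_two)).add ?_).add_const _
    exact (convexOn_id (convex_Ioi (0 : ℝ))).smul (Real.log_pos (by norm_num)).le
  · have e : Real.Gamma ((y + 1 + 2) / 3) = (y + 0) / 3 * Real.Gamma ((y + 0) / 3) := by
      rw [← Real.Gamma_add_one (by positivity)]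
      congr 1; ring
    rw [triplingGamma, triplingGamma, e, show y + 1 + 0 = y + 1 by ring,
      show y + 1 + 1 = y + 2 by ring, show y + 1 - 1 = y - 1 + 1 by ring,
      Real.rpow_add_one (by norm_num)]
    ring
  · have h0 := hk hy 0 le_rfl
    have h1 := hk hy 1 zero_le_one
    have h2 := hk hy 2 zero_le_two
    rw [triplingGamma]
    positivity
  · rw [triplingGamma, div_eq_one_iff_eq hc.ne']
    norm_num

/-- The values at multiples of `1/12` needed for the second Legendre functions. -/
lemma Gamma_twelfths :
    Real.Gamma (5 / 12) * Real.Gamma (1 / 3) = Real.sqrt Real.pi * (3 : ℝ) ^ (-(1 / 8) : ℝ) *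
      (2 : ℝ) ^ (1 / 4 : ℝ) * Real.sqrt (Real.sqrt 3 - 1) * Real.Gamma (1 / 4) ∧
    Real.Gamma (11 / 12) * Real.Gamma (1 / 3) = Real.sqrt Real.pi * (3 : ℝ) ^ (-(3 / 8) : ℝ) *
      (2 : ℝ) ^ (1 / 4 : ℝ) * Real.sqrt (Real.sqrt 3 + 1) * Real.Gamma (3 / 4) := by
  have hpos : ∀ x : ℝ, 0 < x → 0 < Real.Gamma x := fun x hx => Real.Gamma_pos_of_pos hx
  have a0 := hpos (1 / 12) (by norm_num)
  have b0 := hpos (5 / 12) (by norm_num)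
  have c0 := hpos (7 / 12) (by norm_num)
  have g0 := hpos (1 / 4) (by norm_num)
  have k0 := hpos (3 / 4) (by norm_num)
  have h0 := hpos (1 / 3) (by norm_num)
  have l0 := hpos (2 / 3) (by norm_num)
  have i0 := hpos (1 / 6) (by norm_num)
  have hπ := Real.pi_pos
  have s3 := Real.sq_sqrt (show (0 : ℝ) ≤ 3 by norm_num)
  have s2 := Real.sq_sqrt (show (0 : ℝ) ≤ 2 by norm_num)
  have sπ := Real.sq_sqrt hπ.le
  have s3' := Real.sqrt_pos.2 (show (0 : ℝ) < 3 by norm_num)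
  have s2' := Real.sqrt_pos.2 (show (0 : ℝ) < 2 by norm_num)
  have h1 := sqrt_three_gt_one
  have ha := Real.sq_sqrt (show 0 ≤ Real.sqrt 3 - 1 by linarith)
  have hb := Real.sq_sqrt (show 0 ≤ Real.sqrt 3 + 1 by linarith)
  have ha' := Real.sqrt_pos.2 (show 0 < Real.sqrt 3 - 1 by linarith)
  have hab : Real.sqrt (Real.sqrt 3 - 1) * Real.sqrt (Real.sqrt 3 + 1) = Real.sqrt 2 := by
    rw [← Real.sqrt_mul (by linarith)]
    congr 1
    linear_combination s3
  -- the triplication formula at `1/12`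
  have T : Real.Gamma (1 / 12) * Real.Gamma (5 / 12) * Real.Gamma (3 / 4) * 3 ^ (-(3 / 4) : ℝ) =
      Real.Gamma (1 / 4) * (Real.Gamma (1 / 3) * Real.Gamma (2 / 3)) := by
    have h := triplingGamma_eq_Gamma (s := 1 / 4) (by norm_num)
    rw [triplingGamma, div_eq_iff (by positivity)] at h
    norm_num at h ⊢
    exact h
  -- reflection formulas
  have R4 : Real.Gamma (1 / 4) * Real.Gamma (3 / 4) * Real.sqrt 2 = 2 * Real.pi := by
    have h := Real.Gamma_mul_Gamma_one_sub (1 / 4)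
    rw [show Real.pi * (1 / 4) = Real.pi / 4 by ring, Real.sin_pi_div_four,
      eq_div_iff (by positivity)] at h
    norm_num at h ⊢
    linear_combination 2 * h
  have R3 : Real.Gamma (1 / 3) * Real.Gamma (2 / 3) * Real.sqrt 3 = 2 * Real.pi := by
    have h := Real.Gamma_mul_Gamma_one_sub (1 / 3)
    rw [show Real.pi * (1 / 3) = Real.pi / 3 by ring, Real.sin_pi_div_three,
      eq_div_iff (by positivity)] at h
    norm_num at h ⊢
    linear_combination 2 * h
  have R1 : Real.Gamma (1 / 12) * Real.Gamma (11 / 12) * (Real.sqrt 2 * (Real.sqrt 3 - 1)) =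
      4 * Real.pi := by
    have h := Real.Gamma_mul_Gamma_one_sub (1 / 12)
    have hs : Real.sin (Real.pi * (1 / 12)) = Real.sqrt 2 * (Real.sqrt 3 - 1) / 4 := by
      rw [show Real.pi * (1 / 12) = Real.pi / 4 - Real.pi / 6 by ring, Real.sin_sub,
        Real.sin_pi_div_four, Real.cos_pi_div_four, Real.sin_pi_div_six, Real.cos_pi_div_six]
      ring
    rw [hs, eq_div_iff (div_pos (mul_pos s2' (by linarith)) four_pos).ne'] at h
    norm_num at h ⊢
    linear_combination 4 * h
  have R5 : Real.Gamma (5 / 12) * Real.Gamma (7 / 12) * (Real.sqrt 2 * (Real.sqrt 3 + 1)) =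
      4 * Real.pi := by
    have h := Real.Gamma_mul_Gamma_one_sub (5 / 12)
    have hs : Real.sin (Real.pi * (5 / 12)) = Real.sqrt 2 * (Real.sqrt 3 + 1) / 4 := by
      rw [show Real.pi * (5 / 12) = Real.pi / 4 + Real.pi / 6 by ring, Real.sin_add,
        Real.sin_pi_div_four, Real.cos_pi_div_four, Real.sin_pi_div_six, Real.cos_pi_div_six]
      ring
    rw [hs, eq_div_iff (by positivity)] at h
    norm_num at h ⊢
    linear_combination 4 * h
  -- duplication formulas
  have D1 : Real.Gamma (1 / 12) * Real.Gamma (7 / 12) =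
      Real.Gamma (1 / 6) * 2 ^ (5 / 6 : ℝ) * Real.sqrt Real.pi := by
    have h := Real.Gamma_mul_Gamma_add_half (1 / 12)
    norm_num at h ⊢
    exact h
  have D2 : Real.Gamma (1 / 6) * Real.Gamma (2 / 3) =
      Real.Gamma (1 / 3) * 2 ^ (2 / 3 : ℝ) * Real.sqrt Real.pi := by
    have h := Real.Gamma_mul_Gamma_add_half (1 / 6)
    norm_num at h ⊢
    exact h
  have p2 : (2 : ℝ) ^ (5 / 6 : ℝ) * 2 ^ (2 / 3 : ℝ) = 2 * Real.sqrt 2 := by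
    rw [← Real.rpow_add two_pos, Real.sqrt_eq_rpow, show (5 / 6 + 2 / 3 : ℝ) = 1 + 1 / 2 by norm_num,
      Real.rpow_add two_pos, Real.rpow_one]
  have p3 : (3 : ℝ) ^ (-(3 / 4) : ℝ) * (3 : ℝ) ^ (1 / 4 : ℝ) * Real.sqrt 3 = 1 := by
    rw [Real.sqrt_eq_rpow, ← Real.rpow_add three_pos, ← Real.rpow_add three_pos]
    norm_num
  have p4 : (3 : ℝ) ^ (-(1 / 4) : ℝ) * (3 : ℝ) ^ (1 / 4 : ℝ) = 1 := by
    rw [← Real.rpow_add three_pos]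
    norm_num
  have p5 : ((3 : ℝ) ^ (-(1 / 8) : ℝ)) ^ 2 = (3 : ℝ) ^ (-(1 / 4) : ℝ) := by
    rw [← Real.rpow_natCast, ← Real.rpow_mul (by norm_num)]
    norm_num
  have p6 : ((2 : ℝ) ^ (1 / 4 : ℝ)) ^ 2 = Real.sqrt 2 := by
    rw [← Real.rpow_natCast, ← Real.rpow_mul (by norm_num), Real.sqrt_eq_rpow]
    norm_num
  have p7 : (3 : ℝ) ^ (-(3 / 8) : ℝ) * (3 : ℝ) ^ (1 / 4 : ℝ) = (3 : ℝ) ^ (-(1 / 8) : ℝ) := by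
    rw [← Real.rpow_add three_pos]
    norm_num
  -- the product and the quotient of `Γ(1/12)` and `Γ(5/12)`
  have hprod : Real.Gamma (1 / 12) * Real.Gamma (5 / 12) * Real.Gamma (3 / 4) =
      2 * Real.pi * (3 : ℝ) ^ (1 / 4 : ℝ) * Real.Gamma (1 / 4) := by
    linear_combination (3 : ℝ) ^ (1 / 4 : ℝ) * Real.sqrt 3 * T +
      (3 : ℝ) ^ (1 / 4 : ℝ) * Real.Gamma (1 / 4) * R3 -
      Real.Gamma (1 / 12) * Real.Gamma (5 / 12) * Real.Gamma (3 / 4) * p3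
  have hprod2 : Real.Gamma (1 / 12) * Real.Gamma (5 / 12) =
      Real.sqrt 2 * (3 : ℝ) ^ (1 / 4 : ℝ) * Real.Gamma (1 / 4) ^ 2 := by
    apply mul_right_cancel₀ k0.ne'
    linear_combination hprod - (3 : ℝ) ^ (1 / 4 : ℝ) * Real.Gamma (1 / 4) * R4
  have hquot : 2 * Real.Gamma (1 / 12) * Real.pi =
      Real.Gamma (5 / 12) * (Real.sqrt 3 * (Real.sqrt 3 + 1) * Real.Gamma (1 / 3) ^ 2) := by
    apply mul_right_cancel₀ (mul_pos c0 l0).ne'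
    generalize (2 : ℝ) ^ (5 / 6 : ℝ) = x at *
    generalize (2 : ℝ) ^ (2 / 3 : ℝ) = y at *
    have e1 : Real.Gamma (1 / 12) * Real.Gamma (7 / 12) * Real.Gamma (2 / 3) =
        2 * Real.sqrt 2 * Real.pi * Real.Gamma (1 / 3) := by
      linear_combination Real.Gamma (2 / 3) * D1 + x * Real.sqrt Real.pi * D2 +
        Real.Gamma (1 / 3) * Real.sqrt Real.pi ^ 2 * p2 +
        Real.Gamma (1 / 3) * 2 * Real.sqrt 2 * sπ
    have e2 : Real.sqrt 2 * (Real.Gamma (5 / 12) * Real.Gamma (7 / 12) * (Real.sqrt 3 + 1)) =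
        Real.sqrt 2 * (2 * Real.sqrt 2 * Real.pi) := by
      linear_combination R5 - 2 * Real.pi * s2
    have e3 := mul_left_cancel₀ s2'.ne' e2
    linear_combination 2 * Real.pi * e1 -
      Real.sqrt 3 * Real.Gamma (1 / 3) ^ 2 * Real.Gamma (2 / 3) * e3 -
      2 * Real.sqrt 2 * Real.pi * Real.Gamma (1 / 3) * R3
  have key : Real.Gamma (5 / 12) * Real.Gamma (1 / 3) =
      Real.sqrt Real.pi * (3 : ℝ) ^ (-(1 / 8) : ℝ) *
      (2 : ℝ) ^ (1 / 4 : ℝ) * Real.sqrt (Real.sqrt 3 - 1) * Real.Gamma (1 / 4) := by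
    refine (pow_left_inj₀ (by positivity) (by positivity) two_ne_zero).1 ?_
    apply mul_left_cancel₀ (mul_pos s3' (show 0 < Real.sqrt 3 + 1 by linarith)).ne'
    simp only [mul_pow, sπ, p5, p6, ha]
    have e1 : (3 : ℝ) ^ (1 / 4 : ℝ) = (3 : ℝ) ^ (-(1 / 4) : ℝ) * Real.sqrt 3 := by
      rw [Real.sqrt_eq_rpow, ← Real.rpow_add three_pos]
      norm_num
    rw [e1] at hprod2
    linear_combination (-Real.Gamma (5 / 12)) * hquot + 2 * Real.pi * hprod2 -
      (Real.pi * (3 : ℝ) ^ (-(1 / 4) : ℝ) * Real.sqrt 2 * Real.Gamma (1 / 4) ^ 2 * Real.sqrt 3) * s3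
  refine ⟨key, ?_⟩
  apply mul_left_cancel₀ (mul_pos a0 b0).ne'
  apply mul_left_cancel₀ (mul_pos s2' ha').ne'
  apply mul_left_cancel₀ ha'.ne'
  have e : Real.sqrt 2 * (Real.sqrt 3 - 1) = Real.sqrt 2 * Real.sqrt (Real.sqrt 3 - 1) ^ 2 := by
    rw [ha]
  rw [e] at R1
  generalize Real.sqrt (Real.sqrt 3 - 1) = α at *
  generalize Real.sqrt (Real.sqrt 3 + 1) = β at *
  generalize Real.sqrt 2 = τ at *
  generalize (2 : ℝ) ^ (1 / 4 : ℝ) = x at *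
  generalize (3 : ℝ) ^ (-(3 / 8) : ℝ) = y at *
  generalize (3 : ℝ) ^ (1 / 4 : ℝ) = z at *
  generalize (3 : ℝ) ^ (-(1 / 8) : ℝ) = w at *
  generalize Real.Gamma (3 / 4) = k at *
  generalize Real.Gamma (5 / 12) = b at *
  generalize Real.Gamma (1 / 3) = h at *
  generalize Real.Gamma (1 / 12) = a at *
  generalize Real.Gamma (11 / 12) = d at *
  generalize Real.Gamma (1 / 4) = g at *
  linear_combination b * h * R1 + 4 * Real.pi * key -
    τ * α ^ 2 * β * √Real.pi * y * x * hprod - 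
    (2 * Real.pi * g * τ * α * √Real.pi * y * x * z) * hab - 
    (2 * Real.pi * g * α * √Real.pi * y * x * z) * s2 - 
    (4 * Real.pi * g * α * √Real.pi * x) * p7

/-- `Γ(x + k)` for an integer `k`. -/
lemma Gamma_add_int {x : ℝ} (hx : NotInt x) (k : ℤ) :
    Real.Gamma (x + k) = risingFactorial x k * Real.Gamma x := by
  have step : ∀ k : ℤ, Real.Gamma (x + (k + 1 : ℤ)) = (x + k) * Real.Gamma (x + k) := fun k => by
    rw [← Real.Gamma_add_one (hx.add_int k).ne_zero]
    push_cast
    ring_nf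
  induction k using Int.induction_on with
  | zero => simp [risingFactorial_zero]
  | succ k ih => rw [step, ih, risingFactorial_add_one hx]; ring
  | pred k ih =>
    have h1 := step (-(k : ℤ) - 1)
    have h2 := risingFactorial_add_one hx (-(k : ℤ) - 1)
    rw [sub_add_cancel] at h1 h2
    apply mul_left_cancel₀ (hx.add_int (-(k : ℤ) - 1)).ne_zero
    rw [← h1, ih, h2]
    ring

lemma risingFactorial_neg_mul {x : ℝ} (hx : NotInt x) (k : ℤ) :
    risingFactorial x (-k) * risingFactorial (1 - x) k = (-1) ^ k := by
  have hx' : NotInt (1 - x) := fun j h => hx (1 - j) (by push_cast; linarith)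
  have step : ∀ k : ℤ, risingFactorial x (-(k + 1)) * risingFactorial (1 - x) (k + 1) =
      -(risingFactorial x (-k) * risingFactorial (1 - x) k) := fun k => by
    have h1 := risingFactorial_add_one hx (-(k + 1))
    rw [show -(k + 1) + 1 = -k by ring] at h1
    rw [risingFactorial_add_one hx', h1]
    push_cast
    ring
  have hz : ∀ k : ℤ, (-1 : ℝ) ^ (k + 1) = -(-1) ^ k := fun k => by
    rw [zpow_add_one₀ (by norm_num)]; ring
  induction k using Int.induction_on with
  | zero => simp [risingFactorial_zero]
  | succ k ih => rw [step, ih, hz]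
  | pred k ih =>
    have h1 := step (-(k : ℤ) - 1)
    have h2 := hz (-(k : ℤ) - 1)
    rw [sub_add_cancel] at h1 h2
    rw [← neg_inj, ← h1, ih, h2]

/-! ### The constants of the formulas -/

section Constants

variable (n m : ℤ)

lemma three_rpow_mul : (3 : ℝ) ^ (3 / 8 : ℝ) * (3 : ℝ) ^ (-(3 / 8) : ℝ) = 1 := by
  rw [← Real.rpow_add three_pos]; norm_num

/-- The constant of the formula for `P_{-3/4-m}^{-1/3-n}`. -/
lemma constP_mul : constP n m * Real.Gamma (4 / 3 + n) *
    ((2 : ℝ) ^ (5 / 4 - 2 * (m : ℝ) - 3 * (n : ℝ)) * (3 : ℝ) ^ (-(3 / 8) : ℝ) *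
      risingFactorial (1 / 4) m * (risingFactorial (13 / 12) (m + n))⁻¹ *
      (Real.Gamma (4 / 3))⁻¹) = (2 : ℝ) ^ (1 / 4 - (m : ℝ)) := by
  have h1 := risingFactorial_ne_zero notInt_thirteen_twelfths (m + n)
  have h2 := risingFactorial_ne_zero notInt_quarter m
  have h3 := risingFactorial_ne_zero notInt_four_thirds n
  have h4 := (Real.Gamma_pos_of_pos (show (0 : ℝ) < 4 / 3 by norm_num)).ne'
  have p : (2 : ℝ) ^ (-1 + m + 3 * n) * (2 : ℝ) ^ (5 / 4 - 2 * (m : ℝ) - 3 * (n : ℝ)) =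
      (2 : ℝ) ^ (1 / 4 - (m : ℝ)) := by
    rw [← Real.rpow_intCast, ← Real.rpow_add two_pos]
    congr 1
    push_cast
    ring
  rw [constP, Gamma_add_int notInt_four_thirds, ← p]
  field_simp
  linear_combination three_rpow_mul

/-- The constant of the formula for `P_{-3/4-m}^{1/3+n}`. -/
lemma constP'_mul : constP' n m * Real.Gamma (2 / 3 - n) *
    ((2 : ℝ) ^ (-(1 / 4) - 2 * (m : ℝ) - 3 * (n : ℝ)) * (3 : ℝ) ^ (-(3 / 8) : ℝ) *
      risingFactorial (1 / 4) m * (risingFactorial (5 / 12) (m - n))⁻¹ *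
      (Real.Gamma (2 / 3))⁻¹) = (2 : ℝ) ^ (1 / 4 - (m : ℝ)) := by
  have h1 := risingFactorial_ne_zero notInt_five_twelfths (m - n)
  have h2 := risingFactorial_ne_zero notInt_quarter m
  have h3 := risingFactorial_ne_zero notInt_two_thirds (-n)
  have h4 := (Real.Gamma_pos_of_pos (show (0 : ℝ) < 2 / 3 by norm_num)).ne'
  have p : Real.sqrt 2 * (2 : ℝ) ^ (m + 3 * n) *
      (2 : ℝ) ^ (-(1 / 4) - 2 * (m : ℝ) - 3 * (n : ℝ)) = (2 : ℝ) ^ (1 / 4 - (m : ℝ)) := by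
    rw [← Real.rpow_intCast, Real.sqrt_eq_rpow, ← Real.rpow_add two_pos, ← Real.rpow_add two_pos]
    congr 1
    push_cast
    ring
  have g := Gamma_add_int notInt_two_thirds (-n)
  rw [Int.cast_neg, ← sub_eq_add_neg] at g
  rw [constP', g, ← p]
  field_simp
  linear_combination three_rpow_mul

lemma two_mul_sqrt_pi_div : 2 / Real.pi * Real.sqrt Real.pi = 2 / Real.sqrt Real.pi := by
  have h := Real.sq_sqrt Real.pi_pos.le
  have h0 := Real.sqrt_pos.2 Real.pi_pos
  rw [div_mul_eq_mul_div, div_eq_div_iff Real.pi_pos.ne' h0.ne']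
  linear_combination 2 * h

lemma neg_one_zpow_mul_self (k : ℤ) : (-1 : ℝ) ^ k * (-1) ^ k = 1 := by
  rw [← mul_zpow]; simp

/-- The constant of the formula for `Q̂_{-3/4-m}^{-1/3-n}`. -/
lemma constQ_eq : 2 / Real.pi * (Real.sqrt Real.pi / (2 : ℝ) ^ (1 / 4 - (m : ℝ))) *
    (Real.Gamma (-(1 / 12) - m - n) / Real.Gamma (3 / 4 - m)) =
    (8 : ℝ) ^ (1 / 12 + (m : ℝ) + (n : ℝ)) *
    (((2 : ℝ) ^ (11 / 4 - 2 * (m : ℝ) - 3 * (n : ℝ)) * (3 : ℝ) ^ (-(3 / 8) : ℝ) *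
            risingFactorial (1 / 4) m * (risingFactorial (13 / 12) (m + n))⁻¹ *
            (Real.Gamma (4 / 3))⁻¹) * (-(-1 : ℝ) ^ n * Real.sqrt (Real.sqrt 3 + 1))) := by
  have q1 : NotInt (-(1 / 12) : ℝ) := notInt_of_mul_eq 12 (-1) (by norm_num) (by norm_num)
  have q2 : NotInt (3 / 4 : ℝ) := by simpa using notInt_legendre 0
  have h1 := risingFactorial_ne_zero notInt_thirteen_twelfths (m + n)
  have h2 := risingFactorial_ne_zero notInt_quarter m
  have e1 := risingFactorial_neg_mul q1 (m + n)
  have e2 := risingFactorial_neg_mul q2 m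
  have h5 := risingFactorial_ne_zero q2 (-m)
  have g1 := Gamma_add_int q1 (-(m + n))
  have g2 := Gamma_add_int q2 (-m)
  rw [show (-(1 / 12) : ℝ) + ((-(m + n) : ℤ) : ℝ) = -(1 / 12) - m - n by push_cast; ring] at g1
  rw [show (3 / 4 : ℝ) + ((-m : ℤ) : ℝ) = 3 / 4 - m by push_cast; ring] at g2
  rw [show (1 : ℝ) - -(1 / 12) = 13 / 12 by norm_num] at e1
  rw [show (1 : ℝ) - 3 / 4 = 1 / 4 by norm_num] at e2
  have k1 : Real.Gamma (11 / 12) = -(1 / 12) * Real.Gamma (-(1 / 12)) := by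
    rw [← Real.Gamma_add_one (by norm_num)]; norm_num
  have k2 : Real.Gamma (4 / 3) = 1 / 3 * Real.Gamma (1 / 3) := by
    rw [← Real.Gamma_add_one (by norm_num)]; norm_num
  have k3 := (Real.Gamma_pos_of_pos (show (0 : ℝ) < 1 / 3 by norm_num)).ne'
  have k4 := (Real.Gamma_pos_of_pos (show (0 : ℝ) < 3 / 4 by norm_num)).ne'
  have key := Gamma_twelfths.2
  rw [k1] at key
  have p : (8 : ℝ) ^ (1 / 12 + (m : ℝ) + (n : ℝ)) *
      (2 : ℝ) ^ (11 / 4 - 2 * (m : ℝ) - 3 * (n : ℝ)) * (2 : ℝ) ^ (1 / 4 - (m : ℝ)) =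
      8 * (2 : ℝ) ^ (1 / 4 : ℝ) := by
    rw [show (8 : ℝ) = 2 ^ (3 : ℝ) by norm_num, ← Real.rpow_mul two_pos.le, ← Real.rpow_add two_pos,
      ← Real.rpow_add two_pos, ← Real.rpow_add two_pos]
    congr 1
    ring
  have hp : (2 : ℝ) ^ (1 / 4 - (m : ℝ)) ≠ 0 := by positivity
  have hz := neg_one_zpow_mul_self m
  rw [zpow_add₀ (by norm_num : (-1 : ℝ) ≠ 0)] at e1
  have hs := (Real.sqrt_pos.2 Real.pi_pos).ne'
  have hsq := Real.sq_sqrt Real.pi_pos.le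
  rw [← mul_div_assoc (2 / Real.pi), two_mul_sqrt_pi_div, g1, g2, k2]
  generalize (8 : ℝ) ^ (1 / 12 + (m : ℝ) + (n : ℝ)) = x8 at *
  generalize (2 : ℝ) ^ (11 / 4 - 2 * (m : ℝ) - 3 * (n : ℝ)) = x2 at *
  generalize (2 : ℝ) ^ (1 / 4 - (m : ℝ)) = y at *
  generalize (2 : ℝ) ^ (1 / 4 : ℝ) = z at *
  generalize (3 : ℝ) ^ (-(3 / 8) : ℝ) = w at *
  generalize Real.Gamma (-(1 / 12)) = G at *
  generalize Real.Gamma (3 / 4) = K at *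
  generalize Real.Gamma (1 / 3) = L at *
  generalize Real.sqrt (Real.sqrt 3 + 1) = b at *
  have f1 : risingFactorial (-(1 / 12)) (-(m + n)) =
      (-1) ^ m * (-1) ^ n * (risingFactorial (13 / 12) (m + n))⁻¹ := by
    rw [← e1, mul_assoc, mul_inv_cancel₀ h1, mul_one]
  have f2 : risingFactorial (3 / 4) (-m) = (-1) ^ m * (risingFactorial (1 / 4) m)⁻¹ := by
    rw [← e2, mul_assoc, mul_inv_cancel₀ h2, mul_one]
  rw [f1, f2]
  have hm : (-1 : ℝ) ^ m ≠ 0 := zpow_ne_zero _ (by norm_num)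
  field_simp
  linear_combination (-24) * key + 3 * w * b * √Real.pi * K * p

/-- The constant of the formula for `Q̂_{-1/4+m}^{-1/3-n}`. -/
lemma constQ'_eq : 2 / Real.pi * (Real.sqrt Real.pi / (2 : ℝ) ^ (3 / 4 + (m : ℝ))) *
    (Real.Gamma (5 / 12 + m - n) / Real.Gamma (5 / 4 + m)) =
    (8 : ℝ) ^ (1 / 12 + (m : ℝ) + (n : ℝ)) * constQ' n m *
    (((2 : ℝ) ^ (11 / 4 - 2 * (m : ℝ) - 3 * (n : ℝ)) * (3 : ℝ) ^ (-(3 / 8) : ℝ) *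
            risingFactorial (1 / 4) m * (risingFactorial (13 / 12) (m + n))⁻¹ *
            (Real.Gamma (4 / 3))⁻¹) * ((-1 : ℝ) ^ n * Real.sqrt (Real.sqrt 3 - 1))) := by
  have h1 := risingFactorial_ne_zero notInt_thirteen_twelfths (m + n)
  have h2 := risingFactorial_ne_zero notInt_quarter m
  have h3 := risingFactorial_ne_zero notInt_five_quarters m
  have g1 := Gamma_add_int notInt_five_twelfths (m - n)
  have g2 := Gamma_add_int notInt_five_quarters m
  rw [show (5 / 12 : ℝ) + ((m - n : ℤ) : ℝ) = 5 / 12 + m - n by push_cast; ring] at g1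
  have k1 : Real.Gamma (5 / 4) = 1 / 4 * Real.Gamma (1 / 4) := by
    rw [← Real.Gamma_add_one (by norm_num)]; norm_num
  have k2 : Real.Gamma (4 / 3) = 1 / 3 * Real.Gamma (1 / 3) := by
    rw [← Real.Gamma_add_one (by norm_num)]; norm_num
  have k3 := (Real.Gamma_pos_of_pos (show (0 : ℝ) < 1 / 3 by norm_num)).ne'
  have k4 := (Real.Gamma_pos_of_pos (show (0 : ℝ) < 1 / 4 by norm_num)).ne'
  have key := Gamma_twelfths.1
  have p : (8 : ℝ) ^ (1 / 12 + (m : ℝ) + (n : ℝ)) * (2 : ℝ) ^ (-2 * m) *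
      (2 : ℝ) ^ (11 / 4 - 2 * (m : ℝ) - 3 * (n : ℝ)) * (2 : ℝ) ^ (3 / 4 + (m : ℝ)) *
      (108 : ℝ) ^ (-(1 / 4) : ℝ) * (3 : ℝ) ^ (-(3 / 8) : ℝ) * 3 =
      8 * (2 : ℝ) ^ (1 / 4 : ℝ) * (3 : ℝ) ^ (-(1 / 8) : ℝ) := by
    have e : (108 : ℝ) ^ (-(1 / 4) : ℝ) = 2 ^ (-(1 / 2) : ℝ) * 3 ^ (-(3 / 4) : ℝ) := by
      rw [show (108 : ℝ) = 2 ^ (2 : ℝ) * 3 ^ (3 : ℝ) by norm_num,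
        Real.mul_rpow (by positivity) (by positivity), ← Real.rpow_mul two_pos.le,
        ← Real.rpow_mul three_pos.le]
      norm_num
    have e3 : (3 : ℝ) ^ (-(3 / 4) : ℝ) * (3 : ℝ) ^ (-(3 / 8) : ℝ) * 3 =
        (3 : ℝ) ^ (-(1 / 8) : ℝ) := by
      rw [← Real.rpow_add three_pos, ← Real.rpow_add_one three_ne_zero]
      norm_num
    have e2 : (8 : ℝ) ^ (1 / 12 + (m : ℝ) + (n : ℝ)) * (2 : ℝ) ^ (-2 * m) *
        (2 : ℝ) ^ (11 / 4 - 2 * (m : ℝ) - 3 * (n : ℝ)) * (2 : ℝ) ^ (3 / 4 + (m : ℝ)) *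
        2 ^ (-(1 / 2) : ℝ) = 8 * (2 : ℝ) ^ (1 / 4 : ℝ) := by
      rw [show (8 : ℝ) = 2 ^ (3 : ℝ) by norm_num, ← Real.rpow_mul two_pos.le, ← Real.rpow_intCast,
        ← Real.rpow_add two_pos, ← Real.rpow_add two_pos, ← Real.rpow_add two_pos,
        ← Real.rpow_add two_pos, ← Real.rpow_add two_pos]
      congr 1
      push_cast
      ring
    rw [e, ← e2, ← e3]
    ring
  have hp : (2 : ℝ) ^ (3 / 4 + (m : ℝ)) ≠ 0 := by positivity
  have hz := neg_one_zpow_mul_self n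
  have hs := (Real.sqrt_pos.2 Real.pi_pos).ne'
  rw [← mul_div_assoc (2 / Real.pi), two_mul_sqrt_pi_div, g1, g2, k1, k2, constQ']
  generalize (8 : ℝ) ^ (1 / 12 + (m : ℝ) + (n : ℝ)) = x8 at *
  generalize (2 : ℝ) ^ (11 / 4 - 2 * (m : ℝ) - 3 * (n : ℝ)) = x2 at *
  generalize (2 : ℝ) ^ (3 / 4 + (m : ℝ)) = y at *
  generalize (2 : ℝ) ^ (1 / 4 : ℝ) = z at *
  generalize (2 : ℝ) ^ (-2 * m) = z2 at *
  generalize (3 : ℝ) ^ (-(3 / 8) : ℝ) = w at *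
  generalize (3 : ℝ) ^ (-(1 / 8) : ℝ) = v at *
  generalize (108 : ℝ) ^ (-(1 / 4) : ℝ) = w108 at *
  generalize Real.Gamma (5 / 12) = G at *
  generalize Real.Gamma (1 / 4) = K at *
  generalize Real.Gamma (1 / 3) = L at *
  generalize Real.sqrt (Real.sqrt 3 - 1) = a at *
  generalize (-1 : ℝ) ^ n = sg at *
  field_simp
  linear_combination risingFactorial (5 / 12) (m - n) * (8 * key - √Real.pi * K * a * p -
    √Real.pi * y * K * x8 * w108 * z2 * x2 * w * 3 * a * hz)

end Constants

/-! ### Hyperbolic parametrization -/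

/-- The parameter `t = ± τ²` with `τ = e^{-ξ/3}`, together with the hyperbolic quantities it
stands for: `S = sinh ξ` and `A, A' = A_+, A_-` for the upper sign, `S = cosh ξ` and
`A, A' = C_+, C_-` for the lower sign. -/
structure IsHyperbolicParam (τ t S A A' : ℝ) : Prop where
  pos : 0 < τ
  S_pos : 0 < S
  A_pos : 0 < A
  A'_pos : 0 < A'
  lt_one : t < 1
  one_sub_cube : 1 - t ^ 3 = 2 * τ ^ 3 * S
  octAlpha_one : octAlpha 1 t = τ * A
  octAlpha_neg_one : octAlpha (-1) t = -(τ * A')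

section Exponentials

variable (ξ : ℝ)

lemma exp_third_inv : Real.exp (ξ / 3) = (Real.exp (-(ξ / 3)))⁻¹ := by
  rw [Real.exp_neg, inv_inv]

lemma exp_eq_inv_cube : Real.exp ξ = (Real.exp (-(ξ / 3)) ^ 3)⁻¹ := by
  rw [← Real.exp_nat_mul, ← Real.exp_neg]
  congr 1
  push_cast
  ring

lemma exp_neg_eq_cube : Real.exp (-ξ) = Real.exp (-(ξ / 3)) ^ 3 := by
  rw [← Real.exp_nat_mul]
  congr 1
  push_cast
  ring

lemma sinh_eq_of_exp : Real.sinh ξ =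
    (1 - Real.exp (-(ξ / 3)) ^ 6) / (2 * Real.exp (-(ξ / 3)) ^ 3) := by
  have h := Real.exp_pos (-(ξ / 3))
  rw [Real.sinh_eq, exp_eq_inv_cube ξ, exp_neg_eq_cube ξ]
  field_simp

lemma cosh_eq_of_exp : Real.cosh ξ =
    (1 + Real.exp (-(ξ / 3)) ^ 6) / (2 * Real.exp (-(ξ / 3)) ^ 3) := by
  have h := Real.exp_pos (-(ξ / 3))
  rw [Real.cosh_eq, exp_eq_inv_cube ξ, exp_neg_eq_cube ξ]
  field_simp

lemma sinh_third_eq_of_exp : Real.sinh (ξ / 3) =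
    (1 - Real.exp (-(ξ / 3)) ^ 2) / (2 * Real.exp (-(ξ / 3))) := by
  have h := Real.exp_pos (-(ξ / 3))
  rw [Real.sinh_eq, exp_third_inv]
  field_simp

lemma cosh_third_eq_of_exp : Real.cosh (ξ / 3) =
    (1 + Real.exp (-(ξ / 3)) ^ 2) / (2 * Real.exp (-(ξ / 3))) := by
  have h := Real.exp_pos (-(ξ / 3))
  rw [Real.cosh_eq, exp_third_inv]
  field_simp

end Exponentials

lemma sqrt_radicand_div {τ t x : ℝ} (hτ : 0 < τ) (h : x = (1 + t + t ^ 2) / 3 / τ ^ 2) :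
    Real.sqrt x = Real.sqrt ((1 + t + t ^ 2) / 3) / τ := by
  rw [h, Real.sqrt_div (radicand_pos t).le, Real.sqrt_sq hτ.le]

lemma isHyperbolicParam_sinh {ξ : ℝ} (hξ : 0 < ξ) : IsHyperbolicParam (Real.exp (-(ξ / 3)))
    (Real.exp (-(ξ / 3)) ^ 2) (Real.sinh ξ) (Aplus ξ) (Aminus ξ) := by
  have h0 := Real.exp_pos (-(ξ / 3))
  have h1 : Real.exp (-(ξ / 3)) < 1 := by
    rw [← Real.exp_zero]
    exact Real.exp_lt_exp.2 (by linarith)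
  have hs := sinh_eq_of_exp ξ
  have hs3 := sinh_third_eq_of_exp ξ
  have hc3 := cosh_third_eq_of_exp ξ
  set τ := Real.exp (-(ξ / 3))
  have ht1 : τ ^ 2 < 1 := pow_lt_one₀ h0.le h1 (by norm_num)
  have hne : 1 - τ ^ 2 ≠ 0 := (sub_pos.2 ht1).ne'
  have hB := sqrt_radicand_div (t := τ ^ 2) (x := Real.sinh ξ / (3 * Real.sinh (ξ / 3))) h0 (by
    rw [hs, hs3]
    field_simp
    ring)
  have e1 : octAlpha 1 (τ ^ 2) = τ * Aplus ξ := by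
    rw [octAlpha, Aplus, hB, hc3]
    field_simp
  have e2 : octAlpha (-1) (τ ^ 2) = -(τ * Aminus ξ) := by
    rw [octAlpha, Aminus, hB, hc3]
    field_simp
    ring
  refine ⟨h0, Real.sinh_pos_iff.2 hξ, ?_, ?_, ht1, ?_, e1, e2⟩
  · exact pos_of_mul_pos_right (e1 ▸ octAlpha_one_pos _) h0.le
  · exact pos_of_mul_pos_right (neg_lt_zero.1 (e2 ▸ octAlpha_neg_one_neg ht1)) h0.le
  · rw [hs]
    field_simp

lemma isHyperbolicParam_cosh (ξ : ℝ) : IsHyperbolicParam (Real.exp (-(ξ / 3)))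
    (-Real.exp (-(ξ / 3)) ^ 2) (Real.cosh ξ) (Cplus ξ) (Cminus ξ) := by
  have h0 := Real.exp_pos (-(ξ / 3))
  have hc := cosh_eq_of_exp ξ
  have hs3 := sinh_third_eq_of_exp ξ
  have hc3 := cosh_third_eq_of_exp ξ
  set τ := Real.exp (-(ξ / 3))
  have ht1 : -τ ^ 2 < 1 := by nlinarith
  have hB := sqrt_radicand_div (t := -τ ^ 2) (x := Real.cosh ξ / (3 * Real.cosh (ξ / 3))) h0 (by
    rw [hc, hc3]
    field_simp
    ring)
  have e1 : octAlpha 1 (-τ ^ 2) = τ * Cplus ξ := by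
    rw [octAlpha, Cplus, hB, hs3]
    field_simp
    ring
  have e2 : octAlpha (-1) (-τ ^ 2) = -(τ * Cminus ξ) := by
    rw [octAlpha, Cminus, hB, hs3]
    field_simp
    ring
  refine ⟨h0, Real.cosh_pos ξ, ?_, ?_, ht1, ?_, e1, e2⟩
  · exact pos_of_mul_pos_right (e1 ▸ octAlpha_one_pos _) h0.le
  · exact pos_of_mul_pos_right (neg_lt_zero.1 (e2 ▸ octAlpha_neg_one_neg ht1)) h0.le
  · rw [hc]
    field_simp
    ring

namespace IsHyperbolicParam

variable {τ t S A A' : ℝ} {n m : ℤ} {ρ : ℝ → ℝ}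

lemma octTerm_one (h : IsHyperbolicParam τ t S A A') (ρ : ℝ → ℝ) (n m : ℤ) :
    octTerm 1 ρ (n + m) t = τ ^ (1 / 4 + 3 * (m : ℝ) + 3 * (n : ℝ)) *
      (A ^ (1 / 4 + 3 * (m : ℝ) + 3 * (n : ℝ)) * ρ (-A' / A)) := by
  have hu : octU 1 t = -A' / A := by
    have h1 : 1 + t - octAlpha 1 t = octAlpha (-1) t := by simp only [octAlpha]; ring
    rw [octU, h1, h.octAlpha_one, h.octAlpha_neg_one, neg_div, neg_div,
      mul_div_mul_left _ _ h.pos.ne']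
  have hp := mul_pos h.pos h.A_pos
  rw [octTerm, hu, h.octAlpha_one, abs_of_pos hp, ← Real.rpow_intCast, ← Real.rpow_add hp,
    ← mul_assoc, ← Real.mul_rpow h.pos.le h.A_pos.le]
  congr 2
  push_cast
  ring

lemma octTerm_neg_one (h : IsHyperbolicParam τ t S A A') (ρ : ℝ → ℝ) (n m : ℤ) :
    octTerm (-1) ρ (n + m) t = (-1) ^ (n + m) * τ ^ (1 / 4 + 3 * (m : ℝ) + 3 * (n : ℝ)) *
      (A' ^ (1 / 4 + 3 * (m : ℝ) + 3 * (n : ℝ)) * ρ (-A / A')) := by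
  have hu : octU (-1) t = -A / A' := by
    have h1 : 1 + t - octAlpha (-1) t = octAlpha 1 t := by simp only [octAlpha]; ring
    rw [octU, h1, h.octAlpha_one, h.octAlpha_neg_one, div_neg, neg_div,
      mul_div_mul_left _ _ h.pos.ne']
  have hp := mul_pos h.pos h.A'_pos
  have hz : (-(τ * A')) ^ (3 * (n + m)) = (-1) ^ (n + m) * (τ * A') ^ (3 * (n + m)) := by
    rw [neg_eq_neg_one_mul, mul_zpow, zpow_mul]
    norm_num
  rw [octTerm, hu, h.octAlpha_neg_one, abs_neg, abs_of_pos hp, hz, ← Real.rpow_intCast (τ * A'),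
    mul_left_comm, ← Real.rpow_add hp, mul_assoc ((-1) ^ (n + m)), mul_assoc ((-1) ^ (n + m)),
    ← mul_assoc (τ ^ _), ← Real.mul_rpow h.pos.le h.A'_pos.le]
  congr 3
  push_cast
  ring

lemma rpow_one_sub_cube (h : IsHyperbolicParam τ t S A A') (m : ℤ) :
    (1 - t ^ 3) ^ ((m : ℝ) - 1 / 4) * (τ ^ (3 / 4 - 3 * (m : ℝ)) *
      (2 : ℝ) ^ (1 / 4 - (m : ℝ)) * S ^ (1 / 4 - (m : ℝ))) = 1 := by
  have hS := h.S_pos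
  have hτ := h.pos
  rw [h.one_sub_cube, Real.mul_rpow (by positivity) hS.le, Real.mul_rpow (by positivity)
    (by positivity), ← Real.rpow_natCast τ 3, ← Real.rpow_mul hτ.le,
    show (m : ℝ) - 1 / 4 = -(1 / 4 - m) by ring, Real.rpow_neg two_pos.le, Real.rpow_neg hS.le,
    show ((3 : ℕ) : ℝ) * -(1 / 4 - (m : ℝ)) = -(3 / 4 - 3 * m) by push_cast; ring,
    Real.rpow_neg hτ.le]
  field_simp

/-- The formulas for `P_{-3/4-m}^{-1/3-n}`, with `g` the value of the Gauss function and `σ` the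
sign of `t^{1+3n}`. -/
lemma neg_order_formula (h : IsHyperbolicParam τ t S A A') {σ g : ℝ} (hσ : σ * σ = 1)
    (ht : t ^ (1 + 3 * n) = σ * τ ^ (2 + 6 * (n : ℝ)))
    (hg : constP n m * (t ^ (1 + 3 * n) * (1 - t ^ 3) ^ ((m : ℝ) - 1 / 4) * g) =
      Real.sqrt (Real.sqrt 3 - 1) * octTerm 1 ρ (n + m) t +
        -Real.sqrt (Real.sqrt 3 + 1) * octTerm (-1) ρ (n + m) t) :
    1 / Real.Gamma (4 / 3 + n) * τ ^ (1 + 3 * (n : ℝ)) * g =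
      ((2 : ℝ) ^ (5 / 4 - 2 * (m : ℝ) - 3 * (n : ℝ)) * (3 : ℝ) ^ (-(3 / 8) : ℝ) *
        risingFactorial (1 / 4) m * (risingFactorial (13 / 12) (m + n))⁻¹ *
        (Real.Gamma (4 / 3))⁻¹) * S ^ (1 / 4 - (m : ℝ)) * (σ *
      (Real.sqrt (Real.sqrt 3 - 1) *
          (A ^ (1 / 4 + 3 * (m : ℝ) + 3 * (n : ℝ)) * ρ (-A' / A)) -
        (-1) ^ (n + m) * Real.sqrt (Real.sqrt 3 + 1) *
          (A' ^ (1 / 4 + 3 * (m : ℝ) + 3 * (n : ℝ)) * ρ (-A / A')))) := by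
  have hw := h.rpow_one_sub_cube m
  have hK := constP_mul n m
  have hΓ : Real.Gamma (4 / 3 + n) ≠ 0 := by
    rw [Gamma_add_int notInt_four_thirds]
    exact mul_ne_zero (risingFactorial_ne_zero notInt_four_thirds n)
      (Real.Gamma_pos_of_pos (by norm_num)).ne'
  have hc := constP_ne_zero n m
  have p1 : τ ^ (2 + 6 * (n : ℝ)) = τ ^ (1 + 3 * (n : ℝ)) * τ ^ (1 + 3 * (n : ℝ)) := by
    rw [← Real.rpow_add h.pos]; congr 1; ring
  have p2 : τ ^ (1 / 4 + 3 * (m : ℝ) + 3 * (n : ℝ)) * τ ^ (3 / 4 - 3 * (m : ℝ)) =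
      τ ^ (1 + 3 * (n : ℝ)) := by
    rw [← Real.rpow_add h.pos]; congr 1; ring
  have hx := (Real.rpow_pos_of_pos h.pos (1 + 3 * (n : ℝ))).ne'
  have hσ0 : σ ≠ 0 := left_ne_zero_of_mul (by rw [hσ]; norm_num)
  rw [ht, p1, h.octTerm_one, h.octTerm_neg_one] at hg
  generalize ((2 : ℝ) ^ (5 / 4 - 2 * (m : ℝ) - 3 * (n : ℝ)) * (3 : ℝ) ^ (-(3 / 8) : ℝ) *
        risingFactorial (1 / 4) m * (risingFactorial (13 / 12) (m + n))⁻¹ *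
        (Real.Gamma (4 / 3))⁻¹) = K at *
  generalize (A ^ (1 / 4 + 3 * (m : ℝ) + 3 * (n : ℝ)) * ρ (-A' / A)) = E at *
  generalize (A' ^ (1 / 4 + 3 * (m : ℝ) + 3 * (n : ℝ)) * ρ (-A / A')) = E' at *
  generalize τ ^ (1 / 4 + 3 * (m : ℝ) + 3 * (n : ℝ)) = y at *
  generalize τ ^ (3 / 4 - 3 * (m : ℝ)) = z at *
  generalize τ ^ (1 + 3 * (n : ℝ)) = x at *
  generalize (2 : ℝ) ^ (1 / 4 - (m : ℝ)) = w2 at *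
  generalize S ^ (1 / 4 - (m : ℝ)) = w at *
  generalize (1 - t ^ 3) ^ ((m : ℝ) - 1 / 4) = v at *
  generalize Real.Gamma (4 / 3 + n) = G at *
  generalize Real.sqrt (Real.sqrt 3 - 1) = a at *
  generalize Real.sqrt (Real.sqrt 3 + 1) = b at *
  generalize (-1 : ℝ) ^ (n + m) = sg at *
  rw [div_mul_eq_mul_div, div_mul_eq_mul_div, div_eq_iff hΓ]
  apply mul_left_cancel₀ (mul_ne_zero hc (mul_ne_zero hσ0 hx))
  linear_combination w * w2 * z * hg - constP n m * σ * x * x * g * hw -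
    (σ * x * σ * w * (a * E - sg * b * E')) * hK +
    (w * w2 * (a * E - sg * b * E')) * p2 - w * w2 * x * (a * E - sg * b * E') * hσ

/-- The formulas for `P_{-3/4-m}^{1/3+n}`, with `g` the value of the Gauss function. -/
lemma pos_order_formula (h : IsHyperbolicParam τ t S A A') {g : ℝ}
    (hg : constP' n m * (t ^ (0 : ℤ) * (1 - t ^ 3) ^ ((m : ℝ) - 1 / 4) * g) =
      Real.sqrt (Real.sqrt 3 + 1) * octTerm 1 ρ (n + m) t +
        Real.sqrt (Real.sqrt 3 - 1) * octTerm (-1) ρ (n + m) t) :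
    1 / Real.Gamma (2 / 3 - n) * τ ^ (-1 - 3 * (n : ℝ)) * g =
      ((2 : ℝ) ^ (-(1 / 4) - 2 * (m : ℝ) - 3 * (n : ℝ)) * (3 : ℝ) ^ (-(3 / 8) : ℝ) *
        risingFactorial (1 / 4) m * (risingFactorial (5 / 12) (m - n))⁻¹ *
        (Real.Gamma (2 / 3))⁻¹) * S ^ (1 / 4 - (m : ℝ)) *
      (Real.sqrt (Real.sqrt 3 + 1) *
          (A ^ (1 / 4 + 3 * (m : ℝ) + 3 * (n : ℝ)) * ρ (-A' / A)) +
        (-1) ^ (n + m) * Real.sqrt (Real.sqrt 3 - 1) *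
          (A' ^ (1 / 4 + 3 * (m : ℝ) + 3 * (n : ℝ)) * ρ (-A / A'))) := by
  have hw := h.rpow_one_sub_cube m
  have hK := constP'_mul n m
  have hΓ : Real.Gamma (2 / 3 - n) ≠ 0 := by
    have e := Gamma_add_int notInt_two_thirds (-n)
    rw [Int.cast_neg, ← sub_eq_add_neg] at e
    rw [e]
    exact mul_ne_zero (risingFactorial_ne_zero notInt_two_thirds (-n))
      (Real.Gamma_pos_of_pos (by norm_num)).ne'
  have hc := constP'_ne_zero n m
  have p2 : τ ^ (1 / 4 + 3 * (m : ℝ) + 3 * (n : ℝ)) * τ ^ (3 / 4 - 3 * (m : ℝ)) *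
      τ ^ (-1 - 3 * (n : ℝ)) = 1 := by
    rw [← Real.rpow_add h.pos, ← Real.rpow_add h.pos]
    ring_nf
    exact Real.rpow_zero τ
  rw [zpow_zero, one_mul, h.octTerm_one, h.octTerm_neg_one] at hg
  generalize ((2 : ℝ) ^ (-(1 / 4) - 2 * (m : ℝ) - 3 * (n : ℝ)) * (3 : ℝ) ^ (-(3 / 8) : ℝ) *
        risingFactorial (1 / 4) m * (risingFactorial (5 / 12) (m - n))⁻¹ *
        (Real.Gamma (2 / 3))⁻¹) = K at *
  generalize (A ^ (1 / 4 + 3 * (m : ℝ) + 3 * (n : ℝ)) * ρ (-A' / A)) = E at *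
  generalize (A' ^ (1 / 4 + 3 * (m : ℝ) + 3 * (n : ℝ)) * ρ (-A / A')) = E' at *
  generalize τ ^ (1 / 4 + 3 * (m : ℝ) + 3 * (n : ℝ)) = y at *
  generalize τ ^ (3 / 4 - 3 * (m : ℝ)) = z at *
  generalize τ ^ (-1 - 3 * (n : ℝ)) = x at *
  generalize (2 : ℝ) ^ (1 / 4 - (m : ℝ)) = w2 at *
  generalize S ^ (1 / 4 - (m : ℝ)) = w at *
  generalize (1 - t ^ 3) ^ ((m : ℝ) - 1 / 4) = v at *
  generalize Real.Gamma (2 / 3 - n) = G at *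
  generalize Real.sqrt (Real.sqrt 3 - 1) = a at *
  generalize Real.sqrt (Real.sqrt 3 + 1) = b at *
  generalize (-1 : ℝ) ^ (n + m) = sg at *
  rw [div_mul_eq_mul_div, div_mul_eq_mul_div, div_eq_iff hΓ]
  apply mul_left_cancel₀ hc
  linear_combination w * w2 * z * x * hg - constP' n m * x * g * hw -
    (w * (b * E + sg * a * E')) * hK + (w * w2 * (b * E + sg * a * E')) * p2

end IsHyperbolicParam

/-! ### The Legendre functions in the hyperbolic parametrization -/

section Hyperbolic

variable {ξ : ℝ}

lemma tanhSq_exp (ξ : ℝ) :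
    tanhSq (Real.exp (-(ξ / 3)) ^ 2) = (Real.sinh ξ / Real.cosh ξ) ^ 2 := by
  have h0 := Real.exp_pos (-(ξ / 3))
  rw [tanhSq, sinh_eq_of_exp, cosh_eq_of_exp]
  congr 1
  field_simp

lemma four_mul_one_add_cube (ξ : ℝ) : 4 * (1 + (Real.exp (-(ξ / 3)) ^ 2) ^ 3) =
    8 * Real.exp (-(ξ / 3)) ^ 3 * Real.cosh ξ := by
  have h0 := Real.exp_pos (-(ξ / 3))
  rw [cosh_eq_of_exp]
  field_simp
  ring

lemma legendreQhat_hypCoth (hξ : 0 < ξ) (ν μ : ℝ) : legendreQhat ν μ (hypCoth ξ) =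
    Real.sqrt Real.pi / (2 : ℝ) ^ (ν + 1) * (Real.Gamma (ν + μ + 1) / Real.Gamma (ν + 3 / 2)) *
      (Real.sinh ξ ^ (ν + 1) / Real.cosh ξ ^ (ν + μ + 1)) *
      ₂F₁ (ν / 2 + μ / 2 + 1 / 2) (ν / 2 + μ / 2 + 1) (ν + 3 / 2)
        (tanhSq (Real.exp (-(ξ / 3)) ^ 2)) := by
  have hs := Real.sinh_pos_iff.2 hξ
  have hc := Real.cosh_pos ξ
  have e1 : hypCoth ξ ^ 2 - 1 = Real.sinh ξ ^ (-2 : ℝ) := by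
    rw [hypCoth, Real.rpow_neg hs.le, Real.rpow_two, div_pow, Real.cosh_sq]
    field_simp
    ring
  have e2 : 1 / hypCoth ξ ^ 2 = tanhSq (Real.exp (-(ξ / 3)) ^ 2) := by
    rw [tanhSq_exp ξ, hypCoth]
    field_simp
  have e3 : Real.sinh ξ ^ (ν + 1) =
      (Real.sinh ξ ^ (-2 : ℝ)) ^ (μ / 2) * Real.sinh ξ ^ (ν + μ + 1) := by
    rw [← Real.rpow_mul hs.le, ← Real.rpow_add hs]
    congr 1
    ring
  rw [legendreQhat, e2, e1, hypCoth, Real.div_rpow hc.le hs.le, e3]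
  have := Real.rpow_pos_of_pos hs (ν + μ + 1)
  have := Real.rpow_pos_of_pos hc (ν + μ + 1)
  congr 2
  field_simp

lemma eight_mul_rpow (ξ p : ℝ) : (4 * (1 + (Real.exp (-(ξ / 3)) ^ 2) ^ 3)) ^ p =
    8 ^ p * Real.exp (-(ξ / 3)) ^ (3 * p) * Real.cosh ξ ^ p := by
  have h0 := Real.exp_pos (-(ξ / 3))
  have hc := Real.cosh_pos ξ
  rw [four_mul_one_add_cube, Real.mul_rpow (by positivity) hc.le,
    Real.mul_rpow (by positivity) (by positivity), ← Real.rpow_natCast, ← Real.rpow_mul h0.le]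
  norm_num

lemma mem_Ioo_of_pos (hξ : 0 < ξ) : Real.exp (-(ξ / 3)) ^ 2 ∈ Set.Ioo (0 : ℝ) 1 :=
  ⟨pow_pos (Real.exp_pos _) 2, (isHyperbolicParam_sinh hξ).lt_one⟩

lemma legendreQhat_formula (n m : ℤ) (hξ : 0 < ξ) :
    (2 / Real.pi) * legendreQhat (-(3 / 4) - (m : ℝ)) (-(1 / 3) - (n : ℝ)) (hypCoth ξ) =
        ((2 : ℝ) ^ (11 / 4 - 2 * (m : ℝ) - 3 * (n : ℝ)) * (3 : ℝ) ^ (-(3 / 8) : ℝ) *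
            risingFactorial (1 / 4) m * (risingFactorial (13 / 12) (m + n))⁻¹ *
            (Real.Gamma (4 / 3))⁻¹) *
          Real.sinh ξ ^ (1 / 4 - (m : ℝ)) *
          (-(-1 : ℝ) ^ n * Real.sqrt (Real.sqrt 3 + 1) *
            Aplus ξ ^ (1 / 4 + 3 * (m : ℝ) + 3 * (n : ℝ)) *
            octahedralEval n m (-Aminus ξ / Aplus ξ)) := by
  have h := isHyperbolicParam_sinh hξ
  have hc := Real.cosh_pos ξ
  have e := (isOctahedralData_octahedralEval n m).familyQ _ (mem_Ioo_of_pos hξ)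
  have hK := constQ_eq n m
  rw [h.octTerm_one, zero_mul, add_zero, one_mul, familyQ, liftTanhSq, eight_mul_rpow,
    show 3 * (1 / 12 + (m : ℝ) + (n : ℝ)) = 1 / 4 + 3 * (m : ℝ) + 3 * (n : ℝ) by ring] at e
  have hτ := (Real.rpow_pos_of_pos h.pos (1 / 4 + 3 * (m : ℝ) + 3 * (n : ℝ))).ne'
  have e' : (8 : ℝ) ^ (1 / 12 + (m : ℝ) + (n : ℝ)) * (Real.cosh ξ ^ (1 / 12 + (m : ℝ) + (n : ℝ)) *
      ₂F₁ (-(1 / 24) - (m : ℝ) / 2 - (n : ℝ) / 2) (11 / 24 - (m : ℝ) / 2 - (n : ℝ) / 2)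
        (3 / 4 - (m : ℝ)) (tanhSq (Real.exp (-(ξ / 3)) ^ 2))) =
      Aplus ξ ^ (1 / 4 + 3 * (m : ℝ) + 3 * (n : ℝ)) *
        octahedralEval n m (-Aminus ξ / Aplus ξ) := by
    apply mul_left_cancel₀ hτ
    rw [← e]; ring
  rw [legendreQhat_hypCoth hξ,
    show -(3 / 4) - (m : ℝ) + 1 = 1 / 4 - m by ring,
    show -(3 / 4) - (m : ℝ) + 3 / 2 = 3 / 4 - m by ring,
    show -(3 / 4) - (m : ℝ) + (-(1 / 3) - (n : ℝ)) + 1 = -(1 / 12) - m - n by ring,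
    show (-(3 / 4) - (m : ℝ)) / 2 + (-(1 / 3) - (n : ℝ)) / 2 + 1 / 2 =
      -(1 / 24) - (m : ℝ) / 2 - (n : ℝ) / 2 by ring,
    show (-(3 / 4) - (m : ℝ)) / 2 + (-(1 / 3) - (n : ℝ)) / 2 + 1 =
      11 / 24 - (m : ℝ) / 2 - (n : ℝ) / 2 by ring]
  have hcosh : Real.cosh ξ ^ (-(1 / 12) - (m : ℝ) - n) =
      (Real.cosh ξ ^ (1 / 12 + (m : ℝ) + (n : ℝ)))⁻¹ := by
    rw [← Real.rpow_neg hc.le]; congr 1; ring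
  rw [hcosh, div_inv_eq_mul]
  linear_combination Real.sinh ξ ^ (1 / 4 - (m : ℝ)) *
    (Real.cosh ξ ^ (1 / 12 + (m : ℝ) + (n : ℝ)) *
      ₂F₁ (-(1 / 24) - (m : ℝ) / 2 - (n : ℝ) / 2) (11 / 24 - (m : ℝ) / 2 - (n : ℝ) / 2)
        (3 / 4 - (m : ℝ)) (tanhSq (Real.exp (-(ξ / 3)) ^ 2))) * hK +
    ((2 : ℝ) ^ (11 / 4 - 2 * (m : ℝ) - 3 * (n : ℝ)) * (3 : ℝ) ^ (-(3 / 8) : ℝ) *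
            risingFactorial (1 / 4) m * (risingFactorial (13 / 12) (m + n))⁻¹ *
            (Real.Gamma (4 / 3))⁻¹) * Real.sinh ξ ^ (1 / 4 - (m : ℝ)) *
      (-(-1 : ℝ) ^ n * Real.sqrt (Real.sqrt 3 + 1)) * e'

lemma legendreQhat_formula' (n m : ℤ) (hξ : 0 < ξ) :
    (2 / Real.pi) * legendreQhat (-(1 / 4) + (m : ℝ)) (-(1 / 3) - (n : ℝ)) (hypCoth ξ) =
        ((2 : ℝ) ^ (11 / 4 - 2 * (m : ℝ) - 3 * (n : ℝ)) * (3 : ℝ) ^ (-(3 / 8) : ℝ) *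
            risingFactorial (1 / 4) m * (risingFactorial (13 / 12) (m + n))⁻¹ *
            (Real.Gamma (4 / 3))⁻¹) *
          Real.sinh ξ ^ (1 / 4 - (m : ℝ)) *
          ((-1 : ℝ) ^ m * Real.sqrt (Real.sqrt 3 - 1) *
            Aminus ξ ^ (1 / 4 + 3 * (m : ℝ) + 3 * (n : ℝ)) *
            octahedralEval n m (-Aplus ξ / Aminus ξ)) := by
  have h := isHyperbolicParam_sinh hξ
  have hc := Real.cosh_pos ξ
  have hs := Real.sinh_pos_iff.2 hξ
  have e := (isOctahedralData_octahedralEval n m).familyQ' _ (mem_Ioo_of_pos hξ)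
  have hK := constQ'_eq n m
  -- the power of `tanh ξ` in `familyQ'`, rearranged as it occurs in the Legendre function
  have hpow : Real.sinh ξ ^ (3 / 4 + (m : ℝ)) / Real.cosh ξ ^ (5 / 12 + (m : ℝ) - n) =
      Real.sinh ξ ^ (1 / 4 - (m : ℝ)) * (Real.cosh ξ ^ (1 / 12 + (m : ℝ) + (n : ℝ)) *
        tanhSq (Real.exp (-(ξ / 3)) ^ 2) ^ (1 / 4 + (m : ℝ))) := by
    have e1 : tanhSq (Real.exp (-(ξ / 3)) ^ 2) ^ (1 / 4 + (m : ℝ)) =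
        Real.sinh ξ ^ (1 / 2 + 2 * (m : ℝ)) / Real.cosh ξ ^ (1 / 2 + 2 * (m : ℝ)) := by
      rw [tanhSq_exp ξ, ← Real.rpow_two, ← Real.rpow_mul (div_pos hs hc).le,
        Real.div_rpow hs.le hc.le]
      ring_nf
    have e2 : Real.sinh ξ ^ (3 / 4 + (m : ℝ)) =
        Real.sinh ξ ^ (1 / 4 - (m : ℝ)) * Real.sinh ξ ^ (1 / 2 + 2 * (m : ℝ)) := by
      rw [← Real.rpow_add hs]; congr 1; ring
    have e3 : Real.cosh ξ ^ (1 / 2 + 2 * (m : ℝ)) =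
        Real.cosh ξ ^ (1 / 12 + (m : ℝ) + (n : ℝ)) * Real.cosh ξ ^ (5 / 12 + (m : ℝ) - n) := by
      rw [← Real.rpow_add hc]; congr 1; ring
    rw [e1, e2, e3]
    have h1 := (Real.rpow_pos_of_pos hc (1 / 12 + (m : ℝ) + (n : ℝ))).ne'
    have h2 := (Real.rpow_pos_of_pos hc (5 / 12 + (m : ℝ) - n)).ne'
    field_simp
  rw [h.octTerm_neg_one, zero_mul, zero_add, one_mul, familyQ', liftTanhSq, eight_mul_rpow,
    show 3 * (1 / 12 + (m : ℝ) + (n : ℝ)) = 1 / 4 + 3 * (m : ℝ) + 3 * (n : ℝ) by ring] at e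
  have hτ := (Real.rpow_pos_of_pos h.pos (1 / 4 + 3 * (m : ℝ) + 3 * (n : ℝ))).ne'
  set T := tanhSq (Real.exp (-(ξ / 3)) ^ 2)
  have e' : (8 : ℝ) ^ (1 / 12 + (m : ℝ) + (n : ℝ)) * constQ' n m *
      (Real.cosh ξ ^ (1 / 12 + (m : ℝ) + (n : ℝ)) * T ^ (1 / 4 + (m : ℝ)) *
      ₂F₁ (5 / 24 + (m : ℝ) / 2 - (n : ℝ) / 2) (17 / 24 + (m : ℝ) / 2 - (n : ℝ) / 2)
        (5 / 4 + (m : ℝ)) T) = (-1) ^ (n + m) *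
      (Aminus ξ ^ (1 / 4 + 3 * (m : ℝ) + 3 * (n : ℝ)) *
        octahedralEval n m (-Aplus ξ / Aminus ξ)) := by
    apply mul_left_cancel₀ hτ
    linear_combination e
  rw [legendreQhat_hypCoth hξ,
    show -(1 / 4) + (m : ℝ) + 1 = 3 / 4 + m by ring,
    show -(1 / 4) + (m : ℝ) + 3 / 2 = 5 / 4 + m by ring,
    show -(1 / 4) + (m : ℝ) + (-(1 / 3) - (n : ℝ)) + 1 = 5 / 12 + m - n by ring,
    show (-(1 / 4) + (m : ℝ)) / 2 + (-(1 / 3) - (n : ℝ)) / 2 + 1 / 2 =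
      5 / 24 + (m : ℝ) / 2 - (n : ℝ) / 2 by ring,
    show (-(1 / 4) + (m : ℝ)) / 2 + (-(1 / 3) - (n : ℝ)) / 2 + 1 =
      17 / 24 + (m : ℝ) / 2 - (n : ℝ) / 2 by ring, hpow]
  have hz := neg_one_zpow_mul_self n
  rw [zpow_add₀ (by norm_num : (-1 : ℝ) ≠ 0)] at e'
  generalize ₂F₁ (5 / 24 + (m : ℝ) / 2 - (n : ℝ) / 2) (17 / 24 + (m : ℝ) / 2 - (n : ℝ) / 2)
    (5 / 4 + (m : ℝ)) T = F at *
  generalize ((2 : ℝ) ^ (11 / 4 - 2 * (m : ℝ) - 3 * (n : ℝ)) * (3 : ℝ) ^ (-(3 / 8) : ℝ) *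
            risingFactorial (1 / 4) m * (risingFactorial (13 / 12) (m + n))⁻¹ *
            (Real.Gamma (4 / 3))⁻¹) = K at *
  generalize Real.sinh ξ ^ (1 / 4 - (m : ℝ)) = s at *
  generalize Real.cosh ξ ^ (1 / 12 + (m : ℝ) + (n : ℝ)) * T ^ (1 / 4 + (m : ℝ)) = x at *
  linear_combination s * x * F * hK +
    K * s * ((-1 : ℝ) ^ n * Real.sqrt (Real.sqrt 3 - 1)) * e' +
    K * s * Real.sqrt (Real.sqrt 3 - 1) * (-1) ^ m *
      (Aminus ξ ^ (1 / 4 + 3 * (m : ℝ) + 3 * (n : ℝ)) *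
        octahedralEval n m (-Aplus ξ / Aminus ξ)) * hz

/-- The factor `((z + 1)/(z - 1))^{μ/2}` at `z = coth ξ` and `((1 + x)/(1 - x))^{μ/2}` at
`x = tanh ξ`. -/
lemma exp_ratio_rpow (ξ μ : ℝ) {r : ℝ} (h : r = ((Real.exp (-(ξ / 3))) ^ 6)⁻¹) :
    r ^ (μ / 2) = Real.exp (-(ξ / 3)) ^ (-3 * μ) := by
  have h0 := Real.exp_pos (-(ξ / 3))
  rw [h, ← Real.rpow_natCast, ← Real.rpow_neg h0.le, ← Real.rpow_mul h0.le]
  congr 1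
  push_cast
  ring

lemma hypCoth_ratio (hξ : 0 < ξ) :
    (hypCoth ξ + 1) / (hypCoth ξ - 1) = ((Real.exp (-(ξ / 3))) ^ 6)⁻¹ := by
  have h0 := Real.exp_pos (-(ξ / 3))
  have hs := (Real.sinh_pos_iff.2 hξ).ne'
  have e1 : hypCoth ξ + 1 = (Real.exp (-(ξ / 3)) ^ 3)⁻¹ / Real.sinh ξ := by
    rw [hypCoth, div_add_one hs, Real.cosh_add_sinh, exp_eq_inv_cube ξ]
  have e2 : hypCoth ξ - 1 = Real.exp (-(ξ / 3)) ^ 3 / Real.sinh ξ := by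
    rw [hypCoth, div_sub_one hs, Real.cosh_sub_sinh, exp_neg_eq_cube ξ]
  rw [e1, e2]
  field_simp

lemma legendreArg_coth (hξ : 0 < ξ) :
    (1 - hypCoth ξ) / 2 = legendreArg (Real.exp (-(ξ / 3)) ^ 2) := by
  have h0 := Real.exp_pos (-(ξ / 3))
  have hs := (Real.sinh_pos_iff.2 hξ).ne'
  have h1 : 1 - Real.exp (-(ξ / 3)) ^ 6 ≠ 0 := fun h => hs (by rw [sinh_eq_of_exp, h, zero_div])
  rw [hypCoth, legendreArg, sinh_eq_of_exp, cosh_eq_of_exp, ← pow_mul]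
  field_simp
  ring

lemma tanh_ratio (ξ : ℝ) :
    (1 + Real.tanh ξ) / (1 - Real.tanh ξ) = ((Real.exp (-(ξ / 3))) ^ 6)⁻¹ := by
  have h0 := Real.exp_pos (-(ξ / 3))
  have hc := (Real.cosh_pos ξ).ne'
  have e1 : 1 + Real.tanh ξ = (Real.exp (-(ξ / 3)) ^ 3)⁻¹ / Real.cosh ξ := by
    rw [Real.tanh_eq_sinh_div_cosh, one_add_div hc, Real.cosh_add_sinh, exp_eq_inv_cube ξ]
  have e2 : 1 - Real.tanh ξ = Real.exp (-(ξ / 3)) ^ 3 / Real.cosh ξ := by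
    rw [Real.tanh_eq_sinh_div_cosh, one_sub_div hc, Real.cosh_sub_sinh, exp_neg_eq_cube ξ]
  rw [e1, e2]
  field_simp

lemma legendreArg_tanh (ξ : ℝ) :
    (1 - Real.tanh ξ) / 2 = legendreArg (-Real.exp (-(ξ / 3)) ^ 2) := by
  have h0 := Real.exp_pos (-(ξ / 3))
  have h1 : 1 - (-Real.exp (-(ξ / 3)) ^ 2) ^ 3 = 1 + Real.exp (-(ξ / 3)) ^ 6 := by ring
  rw [Real.tanh_eq_sinh_div_cosh, legendreArg, h1, sinh_eq_of_exp, cosh_eq_of_exp]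
  field_simp
  ring

lemma mem_seriesDomain (ξ : ℝ) : -Real.exp (-(ξ / 3)) ^ 2 ∈ seriesDomain := by
  have h0 := pow_pos (Real.exp_pos (-(ξ / 3))) 2
  rw [seriesDomain_eq]
  have : (-Real.exp (-(ξ / 3)) ^ 2) ^ 3 < 0 := Odd.pow_neg (by decide) (neg_lt_zero.2 h0)
  exact ⟨(neg_lt_zero.2 h0).ne, by linarith⟩

lemma sq_zpow_eq_rpow {τ : ℝ} (h : 0 < τ) (n : ℤ) :
    (τ ^ 2) ^ (1 + 3 * n) = τ ^ (2 + 6 * (n : ℝ)) := by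
  rw [← Real.rpow_intCast, ← Real.rpow_natCast, ← Real.rpow_mul h.le]
  congr 1
  push_cast
  ring

lemma neg_sq_zpow_eq_rpow {τ : ℝ} (h : 0 < τ) (n : ℤ) :
    (-τ ^ 2) ^ (1 + 3 * n) = -(-1) ^ n * τ ^ (2 + 6 * (n : ℝ)) := by
  have e : (-1 : ℝ) ^ (1 + 3 * n) = -(-1) ^ n := by
    rw [zpow_add₀ (by norm_num), zpow_mul]
    norm_num
  rw [← sq_zpow_eq_rpow h, ← e, ← mul_zpow, neg_one_mul]

end Hyperbolic

theorem theorem8 (n m : ℤ) :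
    -- the octahedral function with indices n, m exists and is unique
    (∃! r : RatFunc ℝ, IsOctahedralFunction n m r) ∧
    -- the second Legendre functions
    (∀ ξ : ℝ, 0 < ξ →
      (2 / Real.pi) * legendreQhat (-(3 / 4) - (m : ℝ)) (-(1 / 3) - (n : ℝ)) (hypCoth ξ) =
        ((2 : ℝ) ^ (11 / 4 - 2 * (m : ℝ) - 3 * (n : ℝ)) * (3 : ℝ) ^ (-(3 / 8) : ℝ) *
            risingFactorial (1 / 4) m * (risingFactorial (13 / 12) (m + n))⁻¹ *
            (Real.Gamma (4 / 3))⁻¹) *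
          Real.sinh ξ ^ (1 / 4 - (m : ℝ)) *
          (-(-1 : ℝ) ^ n * Real.sqrt (Real.sqrt 3 + 1) *
            Aplus ξ ^ (1 / 4 + 3 * (m : ℝ) + 3 * (n : ℝ)) *
            octahedralEval n m (-Aminus ξ / Aplus ξ))) ∧
    (∀ ξ : ℝ, 0 < ξ →
      (2 / Real.pi) * legendreQhat (-(1 / 4) + (m : ℝ)) (-(1 / 3) - (n : ℝ)) (hypCoth ξ) =
        ((2 : ℝ) ^ (11 / 4 - 2 * (m : ℝ) - 3 * (n : ℝ)) * (3 : ℝ) ^ (-(3 / 8) : ℝ) *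
            risingFactorial (1 / 4) m * (risingFactorial (13 / 12) (m + n))⁻¹ *
            (Real.Gamma (4 / 3))⁻¹) *
          Real.sinh ξ ^ (1 / 4 - (m : ℝ)) *
          ((-1 : ℝ) ^ m * Real.sqrt (Real.sqrt 3 - 1) *
            Aminus ξ ^ (1 / 4 + 3 * (m : ℝ) + 3 * (n : ℝ)) *
            octahedralEval n m (-Aplus ξ / Aminus ξ))) ∧
    -- the first Legendre functions
    (∀ ξ : ℝ, 0 < ξ →
      legendreP (-(3 / 4) - (m : ℝ)) (-(1 / 3) - (n : ℝ)) (hypCoth ξ) =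
        ((-1 : ℝ) ^ n * (2 : ℝ) ^ (5 / 4 - 2 * (m : ℝ) - 3 * (n : ℝ)) *
            (3 : ℝ) ^ (-(3 / 8) : ℝ) *
            risingFactorial (1 / 4) m * (risingFactorial (13 / 12) (m + n))⁻¹ *
            (Real.Gamma (4 / 3))⁻¹) *
          Real.sinh ξ ^ (1 / 4 - (m : ℝ)) *
          ((-1 : ℝ) ^ n * Real.sqrt (Real.sqrt 3 - 1) *
              Aplus ξ ^ (1 / 4 + 3 * (m : ℝ) + 3 * (n : ℝ)) *
              octahedralEval n m (-Aminus ξ / Aplus ξ) -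
            (-1 : ℝ) ^ m * Real.sqrt (Real.sqrt 3 + 1) *
              Aminus ξ ^ (1 / 4 + 3 * (m : ℝ) + 3 * (n : ℝ)) *
              octahedralEval n m (-Aplus ξ / Aminus ξ))) ∧
    (∀ ξ : ℝ, 0 < ξ →
      legendreP (-(3 / 4) - (m : ℝ)) (1 / 3 + (n : ℝ)) (hypCoth ξ) =
        ((-1 : ℝ) ^ n * (2 : ℝ) ^ (-(1 / 4) - 2 * (m : ℝ) - 3 * (n : ℝ)) *
            (3 : ℝ) ^ (-(3 / 8) : ℝ) *
            risingFactorial (1 / 4) m * (risingFactorial (5 / 12) (m - n))⁻¹ *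
            (Real.Gamma (2 / 3))⁻¹) *
          Real.sinh ξ ^ (1 / 4 - (m : ℝ)) *
          ((-1 : ℝ) ^ n * Real.sqrt (Real.sqrt 3 + 1) *
              Aplus ξ ^ (1 / 4 + 3 * (m : ℝ) + 3 * (n : ℝ)) *
              octahedralEval n m (-Aminus ξ / Aplus ξ) +
            (-1 : ℝ) ^ m * Real.sqrt (Real.sqrt 3 - 1) *
              Aminus ξ ^ (1 / 4 + 3 * (m : ℝ) + 3 * (n : ℝ)) *
              octahedralEval n m (-Aplus ξ / Aminus ξ))) ∧
    -- the first Ferrers functions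
    (∀ ξ : ℝ,
      ferrersP (-(3 / 4) - (m : ℝ)) (-(1 / 3) - (n : ℝ)) (Real.tanh ξ) =
        ((2 : ℝ) ^ (5 / 4 - 2 * (m : ℝ) - 3 * (n : ℝ)) * (3 : ℝ) ^ (-(3 / 8) : ℝ) *
            risingFactorial (1 / 4) m * (risingFactorial (13 / 12) (m + n))⁻¹ *
            (Real.Gamma (4 / 3))⁻¹) *
          Real.cosh ξ ^ (1 / 4 - (m : ℝ)) *
          (-(-1 : ℝ) ^ n * Real.sqrt (Real.sqrt 3 - 1) *
              Cplus ξ ^ (1 / 4 + 3 * (m : ℝ) + 3 * (n : ℝ)) *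
              octahedralEval n m (-Cminus ξ / Cplus ξ) +
            (-1 : ℝ) ^ m * Real.sqrt (Real.sqrt 3 + 1) *
              Cminus ξ ^ (1 / 4 + 3 * (m : ℝ) + 3 * (n : ℝ)) *
              octahedralEval n m (-Cplus ξ / Cminus ξ))) ∧
    (∀ ξ : ℝ,
      ferrersP (-(3 / 4) - (m : ℝ)) (1 / 3 + (n : ℝ)) (Real.tanh ξ) =
        ((-1 : ℝ) ^ n * (2 : ℝ) ^ (-(1 / 4) - 2 * (m : ℝ) - 3 * (n : ℝ)) *
            (3 : ℝ) ^ (-(3 / 8) : ℝ) *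
            risingFactorial (1 / 4) m * (risingFactorial (5 / 12) (m - n))⁻¹ *
            (Real.Gamma (2 / 3))⁻¹) *
          Real.cosh ξ ^ (1 / 4 - (m : ℝ)) *
          ((-1 : ℝ) ^ n * Real.sqrt (Real.sqrt 3 + 1) *
              Cplus ξ ^ (1 / 4 + 3 * (m : ℝ) + 3 * (n : ℝ)) *
              octahedralEval n m (-Cminus ξ / Cplus ξ) +
            (-1 : ℝ) ^ m * Real.sqrt (Real.sqrt 3 - 1) *
              Cminus ξ ^ (1 / 4 + 3 * (m : ℝ) + 3 * (n : ℝ)) *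
              octahedralEval n m (-Cplus ξ / Cminus ξ))) := by
  have hD := isOctahedralData_octahedralEval n m
  have hn := neg_one_zpow_mul_self n
  have hnm : (-1 : ℝ) ^ (n + m) = (-1) ^ n * (-1) ^ m := zpow_add₀ (by norm_num) n m
  have p1 : -(-(3 / 4) - (m : ℝ)) = 3 / 4 + m := by ring
  have p2 : -(3 / 4) - (m : ℝ) + 1 = 1 / 4 - m := by ring
  have p3 : (1 : ℝ) - (-(1 / 3) - n) = 4 / 3 + n := by ring
  have p4 : (1 : ℝ) - (1 / 3 + n) = 2 / 3 - n := by ring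
  have p5 : (-3 : ℝ) * (-(1 / 3) - n) = 1 + 3 * n := by ring
  have p6 : (-3 : ℝ) * (1 / 3 + n) = -1 - 3 * n := by ring
  refine ⟨existsUnique_isOctahedralFunction n m, fun ξ hξ => legendreQhat_formula n m hξ,
    fun ξ hξ => legendreQhat_formula' n m hξ, fun ξ hξ => ?_, fun ξ hξ => ?_, fun ξ => ?_,
    fun ξ => ?_⟩
  · have h := isHyperbolicParam_sinh hξ
    rw [legendreP, exp_ratio_rpow ξ _ (hypCoth_ratio hξ), legendreArg_coth hξ, p1, p2, p3, p5,
      h.neg_order_formula (one_mul 1) (by rw [one_mul, sq_zpow_eq_rpow h.pos])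
        (hD.gaussF_neg_order (mem_Ioo_of_pos hξ)), hnm]
    generalize Real.sinh ξ ^ (1 / 4 - (m : ℝ)) = s
    generalize (2 : ℝ) ^ (5 / 4 - 2 * (m : ℝ) - 3 * (n : ℝ)) = w
    linear_combination (-(w * (3 : ℝ) ^ (-(3 / 8) : ℝ) * risingFactorial (1 / 4) m *
      (risingFactorial (13 / 12) (m + n))⁻¹ * (Real.Gamma (4 / 3))⁻¹ * s *
      (Real.sqrt (Real.sqrt 3 - 1) * Aplus ξ ^ (1 / 4 + 3 * (m : ℝ) + 3 * (n : ℝ)) *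
        octahedralEval n m (-Aminus ξ / Aplus ξ)))) * hn
  · have h := isHyperbolicParam_sinh hξ
    rw [legendreP, exp_ratio_rpow ξ _ (hypCoth_ratio hξ), legendreArg_coth hξ, p1, p2, p4, p6,
      h.pos_order_formula (hD.gaussF_pos_order (mem_Ioo_of_pos hξ)), hnm]
    generalize Real.sinh ξ ^ (1 / 4 - (m : ℝ)) = s
    generalize (2 : ℝ) ^ (-(1 / 4) - 2 * (m : ℝ) - 3 * (n : ℝ)) = w
    linear_combination (-(w * (3 : ℝ) ^ (-(3 / 8) : ℝ) * risingFactorial (1 / 4) m *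
      (risingFactorial (5 / 12) (m - n))⁻¹ * (Real.Gamma (2 / 3))⁻¹ * s *
      (Real.sqrt (Real.sqrt 3 + 1) * Aplus ξ ^ (1 / 4 + 3 * (m : ℝ) + 3 * (n : ℝ)) *
        octahedralEval n m (-Aminus ξ / Aplus ξ)))) * hn
  · have h := isHyperbolicParam_cosh ξ
    rw [ferrersP, exp_ratio_rpow ξ _ (tanh_ratio ξ), legendreArg_tanh, p1, p2, p3, p5,
      h.neg_order_formula (by rw [neg_mul_neg, hn]) (neg_sq_zpow_eq_rpow h.pos n)
        (hD.familyP _ (mem_seriesDomain ξ)), hnm]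
    generalize Real.cosh ξ ^ (1 / 4 - (m : ℝ)) = s
    generalize (2 : ℝ) ^ (5 / 4 - 2 * (m : ℝ) - 3 * (n : ℝ)) = w
    linear_combination (w * (3 : ℝ) ^ (-(3 / 8) : ℝ) * risingFactorial (1 / 4) m *
      (risingFactorial (13 / 12) (m + n))⁻¹ * (Real.Gamma (4 / 3))⁻¹ * s *
      ((-1) ^ m * Real.sqrt (Real.sqrt 3 + 1) * Cminus ξ ^ (1 / 4 + 3 * (m : ℝ) + 3 * (n : ℝ)) *
        octahedralEval n m (-Cplus ξ / Cminus ξ))) * hn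
  · have h := isHyperbolicParam_cosh ξ
    rw [ferrersP, exp_ratio_rpow ξ _ (tanh_ratio ξ), legendreArg_tanh, p1, p2, p4, p6,
      h.pos_order_formula (hD.familyP' _ (mem_seriesDomain ξ)), hnm]
    generalize Real.cosh ξ ^ (1 / 4 - (m : ℝ)) = s
    generalize (2 : ℝ) ^ (-(1 / 4) - 2 * (m : ℝ) - 3 * (n : ℝ)) = w
    linear_combination (-(w * (3 : ℝ) ^ (-(3 / 8) : ℝ) * risingFactorial (1 / 4) m *
      (risingFactorial (5 / 12) (m - n))⁻¹ * (Real.Gamma (2 / 3))⁻¹ * s *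
      (Real.sqrt (Real.sqrt 3 + 1) * Cplus ξ ^ (1 / 4 + 3 * (m : ℝ) + 3 * (n : ℝ)) *
        octahedralEval n m (-Cminus ξ / Cplus ξ)))) * hn
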